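/- **Setting.** An identity concealment game consists of a finite set $\mathcal S$ of states ($S=|\mathcal S|$), finite action sets $\mathcal A^1,\mathcal A^2$ ($A=\max(|\mathcal A^1|,|\mathcal A^2|)$) with nonempty sets $\mathcal A^1(s),\mathcal A^2(s)$ of actions available at $s$, transition probabilities $\mathcal P(s,a^1,a^2,\cdot)$, an initial state $s_0$, a set $\mathcal S^R\subseteq\mathcal S$ of absorbing winning states of Player 1, and a stationary policy $\pi^{\mathsf{Av}}$ of Player 1 (the average player's policy). Both players act simultaneously; policies are randomized and may depend on the whole history of states and actions. Assume $\pi^{\mathsf{Av}}(s,a)>0$ for all $s$ and $a\in\mathcal A^1(s)$. Let $\Pr^{\pi^1,\pi^2}$ be the law of the infinite run of states and actions, $\lozenge C$ (resp. $\lozenge_{\le L}C$) the event that $C$ is reached (resp. within $L$ steps), and $KL(\pi^1,\pi^2\|\pi^{\mathsf{Av}},\pi^2)$ the Kullback–Leibler divergence between the laws of the runs under $(\pi^1,\pi^2)$ and $(\pi^{\mathsf{Av}},\pi^2)$. A policy $\pi^1$ is winning if $\Pr^{\pi^1,\pi^2}(\lozenge\mathcal S^R\mid s_0)=1$ for all $\pi^2$;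 $\Pi^{1,win}$ is the set of winning policies. Assume that some $\pi^1\in\Pi^{1,win}$ has $\sup_{\pi^2}KL(\pi^1,\pi^2\|\pi^{\mathsf{Av}},\pi^2)<\infty$, and let $v^*=\inf_{\pi^1\in\Pi^{1,win}}\sup_{\pi^2}KL(\pi^1,\pi^2\|\pi^{\mathsf{Av}},\pi^2)$ be the equilibrium value. A state $s$ is a trap if $\Pr^{\pi^{\mathsf{Av}},\pi^2}(\lozenge\mathcal S^R\mid s)=0$ for some $\pi^2$; $\mathcal S^+$ is the set of states from which some policy of Player 1, against every policy of Player 2, reaches $\mathcal S^R$ with probability $1$ and avoids the trap states with probability $1$; an action $a^1\in\mathcal A^1(s)$ is safe if $\mathcal P(s,a^1,a^2,q)=0$ for all $a^2\in\mathcal A^2(s)$, $q\notin\mathcal S^+$. Let $C_{max}$ be the maximum of $KL(p\,\|\,\pi^{\mathsf{Av}}(s))$ over $s\in\mathcal S^+$ and distributions $p$ on the safe actions at $s$, and assume $C_{max}>0$. **Algorithm 1** (parameters $n,m\ge1$). Collect $n$ independent runs under $(\pi^{\mathsf{Av}},\pi^{2,*})$, where $\pi^{2,*}$ is the stationary policy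 of Player 2, unknown to Player 1. A state of $\mathcal S^+$ is known ($s\in\mathcal S^K$) if it is visited at least $m$ times in the sample, counted with multiplicity; then $\pi^2(s)$ is the empirical distribution of the first $m$ actions of Player 2 at $s$. Put $\mathcal S^U=\mathcal S^+\setminus\mathcal S^K$, and let $IC'$ be the game in which the states of $\mathcal S^U\cup\mathcal S^R$ are made absorbing and are the winning states. Let $\pi^{1'}$ be an optimal stationary policy for $IC'$ against $\pi^2$, that is, one which from every potentially winning state of $IC'$ wins $IC'$ with probability $1$ against every policy of Player 2 and, among the policies with this property, minimizes the KL objective against $\pi^2$. The output $\pi^1$ plays $\pi^{1'}$ as long as all previous states are known, and $\pi^{\mathsf{Av}}$ otherwise. **Proposition.** Let $\varepsilon>0$, $\delta\in(0,1]$, $\lambda\in(0,1]$, $\beta<1$, let $L\ge1$ be an integer, and let $w=(v^*+\log2+\varepsilon)/\lambda$. Assume that, for almost every sample, the output policy $\pi^1$ and the estimated policy $\pi^2$ have an $\bigl(L,\beta-\frac{\varepsilon(1-\beta)^2}{C_{max}L}\bigr)$-contraction, where $(\pi^1,\pi^2)$ has an $(L,\beta')$-contraction if $\min_{s\in\mathcal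 S^+}\Pr^{\pi^1,\pi^2}(\lozenge_{\le L}(\mathcal S^R\cup\mathcal S^U)\mid s)\ge1-\beta'$. If $$m\ge\frac{4C_{max}^2L^4\left(2\log(2)A+\log(2S/\delta)\right)}{(1-\beta)^4\varepsilon^2},\qquad n\ge\frac{e^{2w}\log(4/\delta)}2+2Se^wm,$$ then, with probability at least $1-\delta$ over the sample, the algorithm has an output and every output $\pi^1$ satisfies $$KL(\pi^1,\pi^{2,*}\|\pi^{\mathsf{Av}},\pi^{2,*})\le\inf_{\pi\in\Pi^{1,win}}KL(\pi,\pi^{2,*}\|\pi^{\mathsf{Av}},\pi^{2,*})+\varepsilon\quad\text{and}\quad\Pr^{\pi^1,\pi^{2,*}}(\lozenge\mathcal S^R\mid s_0)\ge1-\lambda .$$ -/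

import Mathlib

open MeasureTheory ProbabilityTheory
open scoped ENNReal

noncomputable section

/-- One stage `s_t a¹_t a²_t` of a run. -/
structure Step (S A₁ A₂ : Type*) where
  state : S
  act₁ : A₁
  act₂ : A₂

instance {S A₁ A₂ : Type*} : MeasurableSpace (Step S A₁ A₂) := ⊤

instance {S A₁ A₂ : Type*} : DiscreteMeasurableSpace (Step S A₁ A₂) := ⟨fun _ => trivial⟩

instance {S A₁ A₂ : Type*} [Finite S] [Finite A₁] [Finite A₂] : Finite (Step S A₁ A₂) :=
  Finite.of_injective (fun x : Step S A₁ A₂ => (x.state, x.act₁, x.act₂)) (by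
    rintro ⟨s, a, b⟩ ⟨s', a', b'⟩ h
    simp only [Prod.mk.injEq] at h
    obtain ⟨rfl, rfl, rfl⟩ := h
    rfl)

/-- A (history-dependent, randomized) policy of a player with available actions `avail`.
A history `s₀ a¹₀ a²₀ … s_{t-1} a¹_{t-1} a²_{t-1} s_t` is given by the list of its completed
stages, in chronological order, and the current state `s_t`. -/
structure Policy (S A₁ A₂ : Type*) {A : Type*} (avail : S → Finset A) where
  act : List (Step S A₁ A₂) → S → PMF A
  act_avail : ∀ h s, (act h s).support ⊆ ↑(avail s)

/-- A stationary policy. -/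
structure StationaryPolicy {S A : Type*} (avail : S → Finset A) where
  dist : S → PMF A
  dist_avail : ∀ s, (dist s).support ⊆ ↑(avail s)

/-- A stationary policy, as a policy. -/
def StationaryPolicy.toPolicy {S A : Type*} {avail : S → Finset A}
    (μ : StationaryPolicy avail) (A₁ A₂ : Type*) : Policy S A₁ A₂ avail where
  act _ s := μ.dist s
  act_avail _ s := μ.dist_avail s

/-- An identity concealment game: a two-player stochastic reachability game together with the
(stationary) policy of the average player. Values of `trans s a b` at unavailable actions play no
role. -/
structure ICGame (S A₁ A₂ : Type*) where
  avail₁ : S → Finset A₁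
  avail₂ : S → Finset A₂
  avail₁_nonempty : ∀ s, (avail₁ s).Nonempty
  avail₂_nonempty : ∀ s, (avail₂ s).Nonempty
  trans : S → A₁ → A₂ → PMF S
  init : S
  /-- the winning states of Player 1 -/
  win : Set S
  win_absorbing : ∀ s ∈ win, ∀ a ∈ avail₁ s, ∀ b ∈ avail₂ s, trans s a b = PMF.pure s
  /-- the average player's policy -/
  average : StationaryPolicy avail₁

namespace ICGame

variable {S A₁ A₂ : Type*}

/-- Policies of Player 1. -/
abbrev Policy₁ (G : ICGame S A₁ A₂) := Policy S A₁ A₂ G.avail₁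

/-- Policies of Player 2. -/
abbrev Policy₂ (G : ICGame S A₁ A₂) := Policy S A₁ A₂ G.avail₂

/-- The average player's policy, as a policy. -/
abbrev averagePolicy (G : ICGame S A₁ A₂) : G.Policy₁ := G.average.toPolicy A₁ A₂

/-- The law of a stage at state `s` after the completed stages `h`: both players choose their
actions simultaneously and independently. -/
def stageLaw (G : ICGame S A₁ A₂) (π₁ : G.Policy₁) (π₂ : G.Policy₂)
    (h : List (Step S A₁ A₂)) (s : S) : PMF (Step S A₁ A₂) :=
  (π₁.act h s).bind fun a => (π₂.act h s).bind fun b => PMF.pure ⟨s, a, b⟩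

/-- The law of stage `t + 1` given the stages `0, …, t`. -/
def stageKernel [Finite S] [Finite A₁] [Finite A₂] (G : ICGame S A₁ A₂)
    (π₁ : G.Policy₁) (π₂ : G.Policy₂) (t : ℕ) :
    Kernel ((i : Finset.Iic t) → Step S A₁ A₂) (Step S A₁ A₂) :=
  Kernel.ofFunOfCountable fun x =>
    let last := x ⟨t, Finset.mem_Iic.2 le_rfl⟩
    ((G.trans last.state last.act₁ last.act₂).bind fun q =>
      G.stageLaw π₁ π₂
        (List.ofFn fun i : Fin (t + 1) => x ⟨i, Finset.mem_Iic.2 (Nat.lt_succ_iff.1 i.2)⟩)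
        q).toMeasure

instance [Finite S] [Finite A₁] [Finite A₂] (G : ICGame S A₁ A₂)
    (π₁ : G.Policy₁) (π₂ : G.Policy₂) (t : ℕ) : IsMarkovKernel (G.stageKernel π₁ π₂ t) :=
  ⟨fun _ => PMF.toMeasure.isProbabilityMeasure _⟩

/-- The law of the run when the game starts at `s` (Ionescu-Tulcea). -/
def runLaw [Finite S] [Finite A₁] [Finite A₂] (G : ICGame S A₁ A₂)
    (π₁ : G.Policy₁) (π₂ : G.Policy₂) (s : S) : Measure (ℕ → Step S A₁ A₂) :=
  Kernel.trajMeasure (X := fun _ => Step S A₁ A₂)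
    (G.stageLaw π₁ π₂ [] s).toMeasure (G.stageKernel π₁ π₂)

instance [Finite S] [Finite A₁] [Finite A₂] (G : ICGame S A₁ A₂)
    (π₁ : G.Policy₁) (π₂ : G.Policy₂) (s : S) : IsProbabilityMeasure (G.runLaw π₁ π₂ s) := by
  unfold runLaw
  infer_instance

/-- The event that `C` is eventually reached. -/
def reach (C : Set S) : Set (ℕ → Step S A₁ A₂) := {γ | ∃ t, (γ t).state ∈ C}

/-- The event that `C` is reached in at most `L` time steps. -/
def reachWithin (L : ℕ) (C : Set S) : Set (ℕ → Step S A₁ A₂) := {γ | ∃ t ≤ L, (γ t).state ∈ C}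

section

variable [Finite S] [Finite A₁] [Finite A₂]

/-- `π₁` wins from `s` with probability one against every policy of Player 2. -/
def WinsFrom (G : ICGame S A₁ A₂) (s : S) (π₁ : G.Policy₁) : Prop :=
  ∀ π₂ : G.Policy₂, G.runLaw π₁ π₂ s (reach G.win) = 1

/-- Winning policies of Player 1. -/
def IsWinning (G : ICGame S A₁ A₂) (π₁ : G.Policy₁) : Prop := G.WinsFrom G.init π₁

/-- The KL objective `KL(π₁, π₂ ‖ πᴬᵛ, π₂)` of the game started at `s`. -/
def klFrom (G : ICGame S A₁ A₂) (s : S) (π₁ : G.Policy₁) (π₂ : G.Policy₂) : ℝ≥0∞ :=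
  InformationTheory.klDiv (G.runLaw π₁ π₂ s) (G.runLaw G.averagePolicy π₂ s)

/-- The KL objective of the game. -/
def kl (G : ICGame S A₁ A₂) (π₁ : G.Policy₁) (π₂ : G.Policy₂) : ℝ≥0∞ := G.klFrom G.init π₁ π₂

/-- The equilibrium value `v*` of the game: Player 1 minimizes the KL objective over its winning
policies, Player 2 maximizes it. -/
def value (G : ICGame S A₁ A₂) : ℝ≥0∞ :=
  ⨅ π₁ : G.Policy₁, ⨅ _ : G.IsWinning π₁, ⨆ π₂ : G.Policy₂, G.kl π₁ π₂

/-- Trap states: some policy of Player 2 prevents the average player from winning. -/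
def trap (G : ICGame S A₁ A₂) : Set S :=
  {s | ∃ π₂ : G.Policy₂, G.runLaw G.averagePolicy π₂ s (reach G.win) = 0}

/-- Potentially winning states `S⁺`: some policy of Player 1 wins with probability one and avoids
the trap states, against every policy of Player 2. -/
def potential (G : ICGame S A₁ A₂) : Set S :=
  {s | ∃ π₁ : G.Policy₁, G.WinsFrom s π₁ ∧
    ∀ π₂ : G.Policy₂, G.runLaw π₁ π₂ s (reach G.trap) = 0}

/-- Safe actions of Player 1. -/
def IsSafe (G : ICGame S A₁ A₂) (s : S) (a : A₁) : Prop :=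
  a ∈ G.avail₁ s ∧ ∀ b ∈ G.avail₂ s, ∀ q, q ∉ G.potential → G.trans s a b q = 0

/-- The set of all KL divergences, over the states in `S⁺`, of a distribution on the safe actions
from the average player's action distribution. -/
def safeDivergences [Fintype A₁] (G : ICGame S A₁ A₂) : Set ℝ :=
  {c | ∃ s ∈ G.potential, ∃ p : PMF A₁, (∀ a ∈ p.support, G.IsSafe s a) ∧
    c = ∑ a, (p a).toReal * Real.log ((p a).toReal / (G.average.dist s a).toReal)}

/-- `C_max`. -/
def cMax [Fintype A₁] (G : ICGame S A₁ A₂) : ℝ := sSup G.safeDivergences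

/-- `(π₁, π₂)` has an `(L, β)`-contraction, where `U` is the set of unknown states. -/
def HasContraction (G : ICGame S A₁ A₂) (U : Set S) (π₁ : G.Policy₁) (π₂ : G.Policy₂)
    (L : ℕ) (β : ℝ) : Prop :=
  ∀ s ∈ G.potential, 1 - β ≤ (G.runLaw π₁ π₂ s).real (reachWithin L (G.win ∪ U))

/-- A stationary policy of Player 1 that is an optimal winning policy against `π₂`, from every
potentially winning state. -/
def IsOptimalAgainst (G : ICGame S A₁ A₂) (π₂ : G.Policy₂) (μ : StationaryPolicy G.avail₁) :
    Prop :=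
  ∀ s ∈ G.potential, G.WinsFrom s (μ.toPolicy A₁ A₂) ∧
    ∀ π₁ : G.Policy₁, G.WinsFrom s π₁ → G.klFrom s (μ.toPolicy A₁ A₂) π₂ ≤ G.klFrom s π₁ π₂

end

open scoped Classical in
/-- The game in which the states in `E` are made absorbing and are the winning states. -/
abbrev withEnd (G : ICGame S A₁ A₂) (E : Set S) : ICGame S A₁ A₂ where
  avail₁ := G.avail₁
  avail₂ := G.avail₂
  avail₁_nonempty := G.avail₁_nonempty
  avail₂_nonempty := G.avail₂_nonempty
  trans s a b := if s ∈ E then PMF.pure s else G.trans s a b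
  init := G.init
  win := E
  win_absorbing _ hs _ _ _ _ := if_pos hs
  average := G.average

/-! ### The learning algorithm

A sample is a sequence of `n` runs. A visit of the sample is a pair `(i, t)` (run, time), and visits
are ordered lexicographically: the runs one after the other, each run in the order of time. -/

/-- The visits to the state `s`. -/
def visits {n : ℕ} (D : Fin n → ℕ → Step S A₁ A₂) (s : S) : Set (Fin n ×ₗ ℕ) :=
  {v | (D (ofLex v).1 (ofLex v).2).state = s}

/-- `v` lists, in increasing order, the first `m` visits to `s`. -/
def IsFirstVisits {n m : ℕ} (D : Fin n → ℕ → Step S A₁ A₂) (s : S)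
    (v : Fin m → Fin n ×ₗ ℕ) : Prop :=
  StrictMono v ∧ (∀ k, v k ∈ visits D s) ∧
    ∀ u ∈ visits D s, u ∈ Set.range v ∨ ∀ k, v k < u

section

variable [Finite S] [Finite A₁] [Finite A₂]

/-- The law of `n` independent runs under the average player's policy and `π₂`. -/
def sampleLaw (G : ICGame S A₁ A₂) (π₂ : G.Policy₂) (n : ℕ) :
    Measure (Fin n → ℕ → Step S A₁ A₂) :=
  Measure.pi fun _ => G.runLaw G.averagePolicy π₂ G.init

/-- The known states: potentially winning states with at least `m` sample transitions. -/
def known (G : ICGame S A₁ A₂) (m : ℕ) {n : ℕ} (D : Fin n → ℕ → Step S A₁ A₂) : Set S :=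
  {s | s ∈ G.potential ∧ (m : ℕ∞) ≤ (visits D s).encard}

/-- The unknown states. -/
def unknown (G : ICGame S A₁ A₂) (m : ℕ) {n : ℕ} (D : Fin n → ℕ → Step S A₁ A₂) : Set S :=
  G.potential \ G.known m D

open scoped Classical in
/-- The estimated policy of Player 2: at a state with at least `m` visits, the empirical
distribution of the first `m` observed actions of Player 2 (almost surely these are available
actions). At the other states, where the estimate is not used, the value is arbitrary. -/
def estimate (G : ICGame S A₁ A₂) (m : ℕ) [NeZero m] {n : ℕ}
    (D : Fin n → ℕ → Step S A₁ A₂) : StationaryPolicy G.avail₂ where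
  dist s :=
    if h : ∃ v : Fin m → Fin n ×ₗ ℕ, IsFirstVisits D s v ∧
        ∀ k, (D (ofLex (v k)).1 (ofLex (v k)).2).act₂ ∈ G.avail₂ s then
      (PMF.uniformOfFintype (Fin m)).map
        fun k => (D (ofLex (h.choose k)).1 (ofLex (h.choose k)).2).act₂
    else PMF.uniformOfFinset (G.avail₂ s) (G.avail₂_nonempty s)
  dist_avail s := by
    split_ifs with h
    · intro b hb
      obtain ⟨k, -, rfl⟩ := (PMF.mem_support_map_iff _ _ _).1 hb
      exact h.choose_spec.2 k
    · rw [PMF.support_uniformOfFinset]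

/-- The estimated policy, as a policy. -/
abbrev estimatePolicy (G : ICGame S A₁ A₂) (m : ℕ) [NeZero m] {n : ℕ}
    (D : Fin n → ℕ → Step S A₁ A₂) : G.Policy₂ := (G.estimate m D).toPolicy A₁ A₂

/-- `μ` is a policy that the algorithm may synthesize from the sample `D`: an optimal stationary
policy against the estimated policy, in the modified game whose winning states are the unknown
states and the winning states of `G`. -/
def IsSynthesized (G : ICGame S A₁ A₂) (m : ℕ) [NeZero m] {n : ℕ}
    (D : Fin n → ℕ → Step S A₁ A₂) (μ : StationaryPolicy G.avail₁) : Prop :=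
  (G.withEnd (G.unknown m D ∪ G.win)).IsOptimalAgainst (G.estimatePolicy m D) μ

open scoped Classical in
/-- Use `μ` as long as all previous states are known, and the average player's policy otherwise. -/
def switchPolicy (G : ICGame S A₁ A₂) (K : Set S) (μ : StationaryPolicy G.avail₁) :
    G.Policy₁ where
  act h s := if ∀ x ∈ h, x.state ∈ K then μ.dist s else G.average.dist s
  act_avail h s := by
    split_ifs
    · exact μ.dist_avail s
    · exact G.average.dist_avail s

/-- `π₁` is an output of the algorithm, with parameter `m`, on the sample `D`. -/
def IsOutput (G : ICGame S A₁ A₂) (m : ℕ) [NeZero m] {n : ℕ}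
    (D : Fin n → ℕ → Step S A₁ A₂) (π₁ : G.Policy₁) : Prop :=
  ∃ μ : StationaryPolicy G.avail₁, G.IsSynthesized m D μ ∧
    π₁ = G.switchPolicy (G.known m D) μ

end

end ICGame

end

/-! The KL objective is the supremum over N of the expected sum of the first N stage divergences
(`klDiv_eq_iSup_frestrictLe`, `klDiv_map_frestrictLe`). It is therefore governed by one-step
inequalities: a nonnegative function that dominates the stage cost plus its own expected next value
bounds the divergence (`stopKl_le_of_supersolution`). A contraction bounds the expected time before
the end by L/(1-β), hence the stopped divergence by C_max L/(1-β). Moving Player 2's action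
distributions by t in total variation then costs at most t C_max L²/(1-β)² (`stopKl_le_of_tvLe`).
With κ = ε(1-β)²/(C_max L) and t = rκ/L this is rε. The games that end early are under control
because S⁺ is the almost sure winning region (`potential_eq_winSet`), and ending the game inside
that region does not change it (`winSet_withEnd`).

The obstacle is that contraction is assumed only for outputs of the algorithm against their own
estimates, while a comparison with the optimum against the true policy σ seems to need it for an
optimal policy ν against σ. The proof applies the assumption to a second sample. Let v be the
optimal value against σ. At each state σ is rounded to an empirical distribution ρ of m actions, in
such a way that the expected next value of v under ν does not increase
(`exists_empirical_rounding`). With positive probability a sample has all reachable states known and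
estimates exactly ρ at each of them (`sampleLaw_prescribed_pos`), so some sample of this kind
satisfies the contraction. Its synthesized policy μ' is at least as good against ρ as ν, so its
stopped divergence is at most v. Passing from ρ to the estimate σ' of the actual sample costs 5ε/8.
The policy μ synthesized from the actual sample is optimal against σ' and inherits the bound, and
passing from σ' to σ costs 3ε/8 (`stopKl_le_of_isOptimalAgainst`). The output imitates the average
player after an unknown state, so its divergence is at most the stopped one.

Two concentration bounds carry the probability 1-δ, both by exponential supermartingales over the
runs. A union bound over states and sets of actions gives the accuracy 3κ/(8L) of the estimate
(`sampleLaw_empirical_gt_le`). Moreover, the average player seldom has probability more than e^{-w}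
of reaching the unknown states: otherwise every run would have had more than that chance of visiting
an insufficiently visited state, and there is room for at most Sm such runs
(`sampleLaw_lt_reach_le`). Finally, a Donsker-Varadhan inequality turns a divergence of at most v* +
ε and the bound e^{-w} into a probability of at most λ that the output reaches an unknown state.
Apart from that event it wins, since it reaches an unknown or winning state almost surely. -/

noncomputable section

/-! ### First-step decomposition of the law of a run -/

namespace ICGame

variable {S A₁ A₂ : Type*}

/-- The run that starts with the stage `x` and goes on as `γ`. -/
def consRun (x : Step S A₁ A₂) (γ : ℕ → Step S A₁ A₂) : ℕ → Step S A₁ A₂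
  | 0 => x
  | t + 1 => γ t

@[simp] lemma consRun_zero (x : Step S A₁ A₂) (γ : ℕ → Step S A₁ A₂) : consRun x γ 0 = x := rfl

@[simp] lemma consRun_succ (x : Step S A₁ A₂) (γ : ℕ → Step S A₁ A₂) (t : ℕ) :
    consRun x γ (t + 1) = γ t := rfl

lemma measurable_consRun (x : Step S A₁ A₂) : Measurable (consRun x) := by
  refine measurable_pi_lambda _ fun t => ?_
  cases t with
  | zero => exact measurable_const
  | succ t => exact measurable_pi_apply t

/-- The first `N` stages of a run. -/
def runPrefix (N : ℕ) (γ : ℕ → Step S A₁ A₂) : List (Step S A₁ A₂) := List.ofFn fun i : Fin N => γ i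

@[simp] lemma runPrefix_zero (γ : ℕ → Step S A₁ A₂) : runPrefix 0 γ = [] := rfl

@[simp] lemma runPrefix_succ_consRun (N : ℕ) (x : Step S A₁ A₂) (γ : ℕ → Step S A₁ A₂) :
    runPrefix (N + 1) (consRun x γ) = x :: runPrefix N γ := by
  simp [runPrefix, List.ofFn_succ]

lemma runPrefix_succ (N : ℕ) (γ : ℕ → Step S A₁ A₂) :
    runPrefix (N + 1) γ = runPrefix N γ ++ [γ N] := by
  simp only [runPrefix, List.ofFn_succ']
  simp [List.concat_eq_append]

end ICGame

/-- The policy `π` after the stage `x`. -/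
def Policy.shift {S A₁ A₂ A : Type*} {avail : S → Finset A} (π : Policy S A₁ A₂ avail)
    (x : Step S A₁ A₂) : Policy S A₁ A₂ avail where
  act h s := π.act (x :: h) s
  act_avail h s := π.act_avail (x :: h) s

namespace ICGame

variable {S A₁ A₂ : Type*}

lemma toPolicy_shift {A : Type*} {avail : S → Finset A} (μ : StationaryPolicy avail)
    (x : Step S A₁ A₂) : (μ.toPolicy A₁ A₂).shift x = μ.toPolicy A₁ A₂ := rfl

lemma stageLaw_shift (G : ICGame S A₁ A₂) (π₁ : G.Policy₁) (π₂ : G.Policy₂) (x : Step S A₁ A₂)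
    (h : List (Step S A₁ A₂)) :
    G.stageLaw (π₁.shift x) (π₂.shift x) h = G.stageLaw π₁ π₂ (x :: h) := rfl

lemma sum_pmf {A : Type*} [Fintype A] (p : PMF A) : ∑ a, p a = 1 := by
  rw [← tsum_fintype (L := .unconditional _)]
  exact p.tsum_coe

variable [Fintype S]

/-- The probability that a run from `s` starts with the given stages. -/
def pathWeight (G : ICGame S A₁ A₂) (π₁ : G.Policy₁) (π₂ : G.Policy₂) (s : S) :
    List (Step S A₁ A₂) → ℝ≥0∞
  | [] => 1
  | x :: l => G.stageLaw π₁ π₂ [] s x *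
      ∑ q, G.trans x.state x.act₁ x.act₂ q * pathWeight G (π₁.shift x) (π₂.shift x) q l

/-- The recursion for `pathWeight` peels off the first stage, whereas the Ionescu-Tulcea
construction adds a last one; this identity reconciles the two. -/
lemma pathWeight_append (G : ICGame S A₁ A₂) (l : List (Step S A₁ A₂)) (z y : Step S A₁ A₂) :
    ∀ (π₁ : G.Policy₁) (π₂ : G.Policy₂) (s : S), G.pathWeight π₁ π₂ s (l ++ [z] ++ [y]) =
      G.pathWeight π₁ π₂ s (l ++ [z]) *
        ∑ q, G.trans z.state z.act₁ z.act₂ q * G.stageLaw π₁ π₂ (l ++ [z]) q y := by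
  induction l with
  | nil =>
    intro π₁ π₂ s
    simp [pathWeight, sum_pmf, stageLaw_shift]
  | cons x l ih =>
    intro π₁ π₂ s
    simp only [List.cons_append, pathWeight, ih]
    simp only [← mul_assoc, ← Finset.sum_mul, stageLaw_shift]

variable [Fintype A₁] [Fintype A₂]

omit [Fintype S] [Fintype A₁] [Fintype A₂] in
lemma measurable_runPrefix_fin (N : ℕ) :
    Measurable fun (γ : ℕ → Step S A₁ A₂) (i : Fin N) => γ i :=
  measurable_pi_lambda _ fun _ => measurable_pi_apply _

lemma measurableSet_runPrefix (N : ℕ) (p : List (Step S A₁ A₂) → Prop) :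
    MeasurableSet {γ : ℕ → Step S A₁ A₂ | p (runPrefix N γ)} :=
  (measurable_runPrefix_fin N) (t := {v | p (List.ofFn v)}) (Set.toFinite _).measurableSet

/-- The kernel extends a prefix by one stage with the same factor as in `pathWeight_append`. From
here on the kernel construction of `runLaw` is not needed any more. -/
lemma runLaw_runPrefix (G : ICGame S A₁ A₂) (π₁ : G.Policy₁) (π₂ : G.Policy₂) (s : S) (N : ℕ) :
    ∀ l : List (Step S A₁ A₂), l.length = N + 1 →
      G.runLaw π₁ π₂ s {γ | runPrefix (N + 1) γ = l} = G.pathWeight π₁ π₂ s l := by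
  induction N with
  | zero =>
    intro l hl
    obtain ⟨x, rfl⟩ := List.length_eq_one_iff.1 hl
    simp only [pathWeight, mul_one, sum_pmf]
    have h1 : {γ : ℕ → Step S A₁ A₂ | runPrefix (0 + 1) γ = [x]} =
        (Preorder.frestrictLe (π := fun _ => Step S A₁ A₂) 0) ⁻¹'
          {v | v ⟨0, Finset.mem_Iic.2 le_rfl⟩ = x} := by
      ext γ
      simp [runPrefix]
    rw [h1, ← Measure.map_apply (by fun_prop) (Set.toFinite _).measurableSet, runLaw,
      Kernel.trajMeasure, Measure.map_comp _ _ (by fun_prop), Kernel.traj_map_frestrictLe,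
      Kernel.partialTraj_self, Measure.id_comp,
      Measure.map_apply (by fun_prop) (Set.toFinite _).measurableSet]
    rw [← PMF.toMeasure_apply_singleton _ _ (measurableSet_singleton x)]
    rfl
  | succ N ih =>
    intro l hl
    obtain rfl | ⟨l', y, rfl⟩ := List.eq_nil_or_concat l
    · simp at hl
    replace hl : l'.length = N + 1 := by simpa using hl
    obtain rfl | ⟨l'', z, rfl⟩ := List.eq_nil_or_concat l'
    · simp at hl
    rw [List.concat_eq_append] at hl
    simp only [List.concat_eq_append]
    rw [pathWeight_append, ← ih _ hl]
    have key := Kernel.map_frestrictLe_trajMeasure_compProd_eq_map_trajMeasure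
      (X := fun _ => Step S A₁ A₂) (μ₀ := (G.stageLaw π₁ π₂ [] s).toMeasure)
      (κ := G.stageKernel π₁ π₂) (a := N)
    set v : (i : Finset.Iic N) → Step S A₁ A₂ := fun i =>
      (l'' ++ [z]).get ⟨i, by have := Finset.mem_Iic.1 i.2; omega⟩ with hv
    have hlist : ∀ w : (i : Finset.Iic N) → Step S A₁ A₂, (List.ofFn fun i : Fin (N + 1) =>
        w ⟨i, Finset.mem_Iic.2 (Nat.lt_succ_iff.1 i.2)⟩) = l'' ++ [z] ↔ w = v := by
      intro w
      constructor
      · intro h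
        funext i
        simp only [hv, List.get_eq_getElem, ← h, List.getElem_ofFn]
      · rintro rfl
        apply List.ext_get
        · simp [hl]
        · intro n h1 h2
          simp only [hv, List.get_eq_getElem, List.getElem_ofFn]
    have hvl : v ⟨N, Finset.mem_Iic.2 le_rfl⟩ = z := by
      have : N = l''.length := by simpa using hl.symm
      subst this
      simp [hv]
    have h2 : (fun x : ℕ → Step S A₁ A₂ =>
          (Preorder.frestrictLe (π := fun _ => Step S A₁ A₂) N x, x (N + 1))) ⁻¹' ({v} ×ˢ {y}) =
        {γ | runPrefix (N + 1 + 1) γ = l'' ++ [z] ++ [y]} := by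
      ext γ
      rw [Set.mem_preimage, Set.mem_prod, Set.mem_singleton_iff, Set.mem_singleton_iff, ← hlist]
      change _ ↔ runPrefix _ _ = _
      rw [runPrefix_succ (N + 1)]
      constructor
      · rintro ⟨h, h'⟩
        rw [← h', ← h]
        rfl
      · intro h
        obtain ⟨h, h'⟩ := List.append_inj h (by rw [hl]; simp [runPrefix])
        exact ⟨h, by simpa using h'⟩
    have h3 : (Preorder.frestrictLe (π := fun _ => Step S A₁ A₂) N) ⁻¹' {v} =
        {γ | runPrefix (N + 1) γ = l'' ++ [z]} := by
      ext γ
      rw [Set.mem_preimage, Set.mem_singleton_iff, ← hlist]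
      rfl
    have key2 := congrArg (fun ρ => ρ ({v} ×ˢ {y})) key
    rw [Measure.map_apply (by fun_prop) ((Set.toFinite _).measurableSet), h2,
      Measure.compProd_apply_prod (measurableSet_singleton _) (measurableSet_singleton _),
      lintegral_singleton, Measure.map_apply (by fun_prop) (measurableSet_singleton _), h3] at key2
    rw [← runLaw] at key2
    rw [← key2, mul_comm]
    congr 1
    change PMF.toMeasure _ {y} = _
    rw [PMF.toMeasure_apply_singleton _ _ (measurableSet_singleton _), PMF.bind_apply,
      tsum_fintype, (hlist v).2 rfl, hvl]

/-- Two finite measures on runs that agree on all prefixes are equal. -/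
lemma measure_ext_runPrefix {ρ ρ' : Measure (ℕ → Step S A₁ A₂)} [IsFiniteMeasure ρ]
    (h : ∀ (N : ℕ) (l : List (Step S A₁ A₂)), l.length = N + 1 →
      ρ {γ | runPrefix (N + 1) γ = l} = ρ' {γ | runPrefix (N + 1) γ = l}) : ρ = ρ' := by
  have hmap : ∀ N, ρ.map (Preorder.frestrictLe (π := fun _ => Step S A₁ A₂) N) =
      ρ'.map (Preorder.frestrictLe (π := fun _ => Step S A₁ A₂) N) := by
    intro N
    refine Measure.ext_of_singleton fun v => ?_
    rw [Measure.map_apply (by fun_prop) (measurableSet_singleton _),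
      Measure.map_apply (by fun_prop) (measurableSet_singleton _)]
    have : (Preorder.frestrictLe (π := fun _ => Step S A₁ A₂) N) ⁻¹' {v} =
        {γ | runPrefix (N + 1) γ =
          List.ofFn fun i : Fin (N + 1) => v ⟨i, Finset.mem_Iic.2 (Nat.lt_succ_iff.1 i.2)⟩} := by
      ext γ
      simp only [Set.mem_preimage, Set.mem_singleton_iff, runPrefix]
      change _ ↔ List.ofFn _ = List.ofFn _
      rw [List.ofFn_injective.eq_iff]
      constructor
      · rintro rfl; rfl
      · intro h
        funext i
        exact congrFun h ⟨i, Nat.lt_succ_iff.2 (Finset.mem_Iic.1 i.2)⟩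
    rw [this]
    exact h N _ (by simp)
  -- Every finite set of times lies in an initial segment, so agreement on prefixes makes both
  -- measures projective limits of the same family.
  have hlim : IsProjectiveLimit ρ' fun I => ρ.map I.restrict := by
    intro I
    have := hmap (I.sup id)
    have hs : I.restrict (π := fun _ => Step S A₁ A₂) =
      Finset.restrict₂ I.subset_Iic_sup_id ∘ Preorder.frestrictLe (I.sup id) := rfl
    rw [hs, ← Measure.map_map (by fun_prop) (by fun_prop), ← this,
      Measure.map_map (by fun_prop) (by fun_prop), ← hs]
  exact IsProjectiveLimit.unique (P := fun I => ρ.map I.restrict) (fun I => rfl) hlim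

/-- The first step of a run. -/
theorem runLaw_eq (G : ICGame S A₁ A₂) (π₁ : G.Policy₁) (π₂ : G.Policy₂) (s : S) :
    G.runLaw π₁ π₂ s = ∑ a, ∑ b, ∑ q,
      (π₁.act [] s a * π₂.act [] s b * G.trans s a b q) •
        (G.runLaw (π₁.shift ⟨s, a, b⟩) (π₂.shift ⟨s, a, b⟩) q).map (consRun ⟨s, a, b⟩) := by
  classical
  -- On a prefix `x :: l` both sides unfold to the recursion of `pathWeight`: the image under
  -- `consRun y` charges this prefix only if `y = x`.
  refine measure_ext_runPrefix fun N l hl => ?_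
  rw [runLaw_runPrefix _ _ _ _ _ _ hl]
  obtain ⟨x, l, rfl⟩ := List.exists_cons_of_length_eq_add_one hl
  simp only [List.length_cons, Nat.add_right_cancel_iff] at hl
  have hrun : ∀ (π₁ : G.Policy₁) (π₂ : G.Policy₂) (q : S),
      G.runLaw π₁ π₂ q {γ | runPrefix N γ = l} = G.pathWeight π₁ π₂ q l := by
    intro π₁ π₂ q
    cases N with
    | zero =>
      rw [List.length_eq_zero_iff] at hl
      subst hl
      simp [pathWeight]
    | succ N => exact runLaw_runPrefix G π₁ π₂ q N l hl
  simp only [Measure.coe_finsetSum, Finset.sum_apply, Measure.smul_apply, smul_eq_mul]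
  have hmap : ∀ (ρ : Measure (ℕ → Step S A₁ A₂)) (y : Step S A₁ A₂),
      ρ.map (consRun y) {γ | runPrefix (N + 1) γ = x :: l} =
        if y = x then ρ {γ | runPrefix N γ = l} else 0 := by
    intro ρ y
    rw [Measure.map_apply (measurable_consRun y) (measurableSet_runPrefix _ (· = x :: l))]
    split_ifs with h
    · subst h
      congr 1
      ext γ
      change runPrefix _ _ = _ ↔ runPrefix _ _ = _
      simp
    · convert measure_empty (μ := ρ)
      ext γ
      change runPrefix _ _ = _ ↔ False
      simp [h]
  simp only [hmap, hrun, pathWeight]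
  obtain ⟨s', a', b'⟩ := x
  simp only [stageLaw, PMF.bind_apply, tsum_fintype, PMF.pure_apply, Step.mk.injEq]
  by_cases hs : s = s'
  · subst hs
    have h1 : ∑ a, π₁.act [] s a * ∑ b, π₂.act [] s b *
        (if s = s ∧ a' = a ∧ b' = b then (1 : ℝ≥0∞) else 0) =
          π₁.act [] s a' * π₂.act [] s b' := by
      simp [ite_and, Finset.sum_ite_eq]
    rw [h1, Finset.mul_sum]
    simp [ite_and, Finset.sum_ite_irrel, Finset.sum_ite_eq', mul_assoc]
  · simp [hs, Ne.symm hs]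

theorem lintegral_runLaw (G : ICGame S A₁ A₂) (π₁ : G.Policy₁) (π₂ : G.Policy₂) (s : S)
    {F : (ℕ → Step S A₁ A₂) → ℝ≥0∞} (hF : Measurable F) :
    ∫⁻ γ, F γ ∂(G.runLaw π₁ π₂ s) = ∑ a, ∑ b, ∑ q,
      (π₁.act [] s a * π₂.act [] s b * G.trans s a b q) *
        ∫⁻ γ, F (consRun ⟨s, a, b⟩ γ)
          ∂(G.runLaw (π₁.shift ⟨s, a, b⟩) (π₂.shift ⟨s, a, b⟩) q) := by
  rw [runLaw_eq]
  simp only [lintegral_finsetSum_measure, lintegral_smul_measure, smul_eq_mul]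
  simp only [lintegral_map hF (measurable_consRun _)]

theorem runLaw_apply (G : ICGame S A₁ A₂) (π₁ : G.Policy₁) (π₂ : G.Policy₂) (s : S)
    {B : Set (ℕ → Step S A₁ A₂)} (hB : MeasurableSet B) :
    G.runLaw π₁ π₂ s B = ∑ a, ∑ b, ∑ q,
      (π₁.act [] s a * π₂.act [] s b * G.trans s a b q) *
        G.runLaw (π₁.shift ⟨s, a, b⟩) (π₂.shift ⟨s, a, b⟩) q (consRun ⟨s, a, b⟩ ⁻¹' B) := by
  rw [runLaw_eq]
  simp only [Measure.coe_finsetSum, Finset.sum_apply, Measure.smul_apply, smul_eq_mul,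
    Measure.map_apply (measurable_consRun _) hB]

theorem integral_runLaw (G : ICGame S A₁ A₂) (π₁ : G.Policy₁) (π₂ : G.Policy₂) (s : S)
    {F : (ℕ → Step S A₁ A₂) → ℝ} (hF : Measurable F) {c : ℝ} (hc : ∀ γ, |F γ| ≤ c) :
    ∫ γ, F γ ∂(G.runLaw π₁ π₂ s) = ∑ a, ∑ b, ∑ q,
      ((π₁.act [] s a).toReal * (π₂.act [] s b).toReal * (G.trans s a b q).toReal) *
        ∫ γ, F (consRun ⟨s, a, b⟩ γ)
          ∂(G.runLaw (π₁.shift ⟨s, a, b⟩) (π₂.shift ⟨s, a, b⟩) q) := by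
  have hint : ∀ a b q, Integrable F ((π₁.act [] s a * π₂.act [] s b * G.trans s a b q) •
        (G.runLaw (π₁.shift ⟨s, a, b⟩) (π₂.shift ⟨s, a, b⟩) q).map (consRun ⟨s, a, b⟩)) := by
    intro a b q
    have : IsProbabilityMeasure ((G.runLaw (π₁.shift ⟨s, a, b⟩) (π₂.shift ⟨s, a, b⟩) q).map
      (consRun ⟨s, a, b⟩)) := Measure.isProbabilityMeasure_map (measurable_consRun _).aemeasurable
    refine Integrable.smul_measure ?_ ?_
    · exact Integrable.of_bound hF.aestronglyMeasurable c (ae_of_all _ hc)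
    · exact ENNReal.mul_ne_top (ENNReal.mul_ne_top (PMF.apply_ne_top _ _) (PMF.apply_ne_top _ _))
        (PMF.apply_ne_top _ _)
  rw [runLaw_eq, integral_finsetSum_measure]
  · refine Finset.sum_congr rfl fun a _ => ?_
    rw [integral_finsetSum_measure]
    · refine Finset.sum_congr rfl fun b _ => ?_
      rw [integral_finsetSum_measure (fun q _ => hint a b q)]
      refine Finset.sum_congr rfl fun q _ => ?_
      rw [integral_smul_measure, integral_map (measurable_consRun _).aemeasurable
        hF.aestronglyMeasurable]
      simp
    · exact fun b _ => integrable_finsetSum_measure.2 fun q _ => hint a b q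
  · exact fun a _ => integrable_finsetSum_measure.2 fun b _ =>
      integrable_finsetSum_measure.2 fun q _ => hint a b q

end ICGame
end

/-! ### Donsker-Varadhan bound and divergences of laws of sequences -/

noncomputable section

open InformationTheory Filter Topology in
/-- A consequence of the Donsker-Varadhan inequality for a multiple of an indicator. -/
lemma mul_measureReal_sub_log_two_le_klDiv {Ω : Type*} [MeasurableSpace Ω] {μ ν : Measure Ω}
    [IsProbabilityMeasure μ] [IsProbabilityMeasure ν] (h : klDiv μ ν ≠ ∞) {B : Set Ω}
    (hB : MeasurableSet B) {w : ℝ} (hw : ν.real B * Real.exp w ≤ 1) :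
    w * μ.real B - Real.log 2 ≤ (klDiv μ ν).toReal := by
  obtain ⟨hac, hint⟩ := klDiv_ne_top_iff.1 h
  rw [toReal_klDiv_eq_integral_klFun hac]
  -- Young's inequality for the conjugate pair x log x - x + 1 and e^g - 1. It is used with g = w -
  -- log 2 on B and g = -log 2 elsewhere; the shift by log 2 makes the integral of e^g against ν at
  -- most 1.
  have hyoung : ∀ x g : ℝ, 0 ≤ x → x * g - Real.exp g + 1 ≤ klFun x := by
    intro x g hx
    rw [klFun_apply]
    rcases hx.eq_or_lt with rfl | hx
    · simpa using (Real.exp_pos g).le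
    · have h1 := Real.log_le_sub_one_of_pos (div_pos (Real.exp_pos g) hx)
      rw [Real.log_div (Real.exp_pos g).ne' hx.ne', Real.log_exp] at h1
      have h2 := mul_le_mul_of_nonneg_left h1 hx.le
      rw [mul_sub, mul_sub, mul_div_cancel₀ _ hx.ne'] at h2
      linarith
  set f : Ω → ℝ := fun x => (μ.rnDeriv ν x).toReal with hf
  have hfint : Integrable f ν := Measure.integrable_toReal_rnDeriv
  have hf1 : ∫ x, f x ∂ν = 1 := by
    have := Measure.setIntegral_toReal_rnDeriv hac Set.univ
    simpa using this
  have hfB : ∫ x in B, f x ∂ν = μ.real B := Measure.setIntegral_toReal_rnDeriv hac B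
  have hlow : ∫ x, ((B.indicator f x * w - f x * Real.log 2) -
      (B.indicator (fun _ => (Real.exp w - 1) / 2) x + 1 / 2) + 1) ∂ν ≤
        ∫ x, klFun (f x) ∂ν := by
    refine integral_mono ?_ ((integrable_klFun_rnDeriv_iff hac).2 hint) ?_
    · exact ((((hfint.indicator hB).mul_const _).sub (hfint.mul_const _)).sub
        (((integrable_const _).indicator hB).add (integrable_const _))).add (integrable_const _)
    · intro x
      by_cases hx : x ∈ B
      · have := hyoung (f x) (w - Real.log 2) ENNReal.toReal_nonneg
        rw [Real.exp_sub, Real.exp_log two_pos] at this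
        simp only [hx, Set.indicator_of_mem]
        linarith
      · have := hyoung (f x) (- Real.log 2) ENNReal.toReal_nonneg
        rw [Real.exp_neg, Real.exp_log two_pos] at this
        simp only [hx, not_false_eq_true, Set.indicator_of_notMem]
        linarith
  refine le_trans ?_ hlow
  rw [integral_add, integral_sub, integral_sub, integral_add, integral_mul_const,
    integral_indicator hB, hfB, integral_mul_const, hf1, integral_indicator hB]
  · simp only [integral_const, smul_eq_mul, measureReal_restrict_apply_univ, probReal_univ]
    nlinarith [measureReal_nonneg (μ := ν) (s := B)]
  · exact (integrable_const _).indicator hB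
  · exact integrable_const _
  · exact (hfint.indicator hB).mul_const _
  · exact hfint.mul_const _
  · exact ((hfint.indicator hB).mul_const _).sub (hfint.mul_const _)
  · exact ((integrable_const _).indicator hB).add (integrable_const _)
  · exact (((hfint.indicator hB).mul_const _).sub (hfint.mul_const _)).sub
        (((integrable_const _).indicator hB).add (integrable_const _))
  · exact integrable_const _

open InformationTheory Filter Topology Preorder in
-- Suppose that B is ν-null and μ(B) > 0. A cylinder close to B for μ + ν has μ-measure at least p =
-- μ(B)/2 and ν-measure at most e^{-w}, and it is an event of a finite prefix. The Donsker-Varadhan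
-- bound then gives w p - log 2 ≤ C, which fails for large w.
lemma absolutelyContinuous_of_klDiv_frestrictLe_le {α : Type*} [MeasurableSpace α]
    {μ ν : Measure (ℕ → α)} [IsProbabilityMeasure μ] [IsProbabilityMeasure ν] {C : ℝ≥0∞}
    (hC : C ≠ ∞)
    (h : ∀ N, klDiv (μ.map (frestrictLe (π := fun _ => α) N))
      (ν.map (frestrictLe (π := fun _ => α) N)) ≤ C) : μ ≪ ν := by
  refine Measure.AbsolutelyContinuous.mk fun B hB hνB => ?_
  by_contra hμB
  set p := μ.real B / 2 with hp
  have hp0 : 0 < μ.real B := ENNReal.toReal_pos hμB (measure_ne_top _ _)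
  obtain ⟨w, hw⟩ : ∃ w : ℝ, C.toReal + Real.log 2 < w * p :=
    ⟨(C.toReal + Real.log 2 + 1) / p, by
      rw [div_mul_cancel₀ _ (by positivity)]; linarith⟩
  have hη : (0 : ℝ) < min p (Real.exp (-w)) := lt_min (by positivity) (Real.exp_pos _)
  obtain ⟨A, hA, hAB⟩ := exists_measure_symmDiff_lt_of_generateFrom_isSetRing (μ := μ + ν)
    (isSetRing_measurableCylinders (α := fun _ : ℕ => α))
    ⟨{Set.univ}, by simp, by
      simpa using univ_mem_measurableCylinders (fun _ : ℕ => α), by simp⟩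
    generateFrom_measurableCylinders.symm hB (ENNReal.ofReal_pos.2 hη)
  obtain ⟨s, T, hT, rfl⟩ := (mem_measurableCylinders _).1 hA
  set r := frestrictLe (π := fun _ : ℕ => α) (s.sup id) with hr
  have hrm : Measurable r := by fun_prop
  obtain ⟨T', hT', hTT'⟩ : ∃ T', MeasurableSet T' ∧ cylinder s T = r ⁻¹' T' :=
    ⟨Finset.restrict₂ (π := fun _ : ℕ => α) s.subset_Iic_sup_id ⁻¹' T,
      Finset.measurable_restrict₂ _ hT, rfl⟩
  rw [hTT'] at hAB
  have hAm : MeasurableSet (r ⁻¹' T') := hrm hT'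
  have hreal : (μ + ν).real (symmDiff (r ⁻¹' T') B) < min p (Real.exp (-w)) := by
    rw [measureReal_def]
    exact (ENNReal.lt_ofReal_iff_toReal_lt (measure_ne_top _ _)).1 hAB
  have hadd : (μ + ν).real (symmDiff (r ⁻¹' T') B) =
    μ.real (symmDiff (r ⁻¹' T') B) + ν.real (symmDiff (r ⁻¹' T') B) := by
    simp [measureReal_def, ENNReal.toReal_add]
  have hμA : p ≤ μ.real (r ⁻¹' T') := by
    have : μ.real B ≤ μ.real (r ⁻¹' T') + μ.real (symmDiff (r ⁻¹' T') B) := by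
      refine (measureReal_mono (fun x hx => ?_)).trans (measureReal_union_le _ _)
      by_cases hxA : x ∈ r ⁻¹' T'
      · exact Or.inl hxA
      · exact Or.inr (Or.inr ⟨hx, hxA⟩)
    have h2 := hreal.trans_le (min_le_left _ _)
    have h3 : 0 ≤ ν.real (symmDiff (r ⁻¹' T') B) := measureReal_nonneg
    linarith
  have hνA : ν.real (r ⁻¹' T') * Real.exp w ≤ 1 := by
    have h1 : ν.real (r ⁻¹' T') ≤ ν.real B + ν.real (symmDiff (r ⁻¹' T') B) := by
      refine (measureReal_mono (fun x hx => ?_)).trans (measureReal_union_le _ _)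
      by_cases hxB : x ∈ B
      · exact Or.inl hxB
      · exact Or.inr (Or.inl ⟨hx, hxB⟩)
    have h0 : ν.real B = 0 := by simp [measureReal_def, hνB]
    have h2 := hreal.trans_le (min_le_right _ _)
    have h3 : 0 ≤ μ.real (symmDiff (r ⁻¹' T') B) := measureReal_nonneg
    have h4 : ν.real (r ⁻¹' T') ≤ Real.exp (-w) := by linarith
    calc _ ≤ Real.exp (-w) * Real.exp w := by gcongr
      _ = 1 := by rw [← Real.exp_add]; simp
  have : IsProbabilityMeasure (μ.map r) := Measure.isProbabilityMeasure_map hrm.aemeasurable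
  have : IsProbabilityMeasure (ν.map r) := Measure.isProbabilityMeasure_map hrm.aemeasurable
  have hdv := mul_measureReal_sub_log_two_le_klDiv (μ := μ.map r) (ν := ν.map r)
    ((h _).trans_lt hC.lt_top).ne hT' (w := w) (by rwa [map_measureReal_apply hrm hT'])
  rw [map_measureReal_apply hrm hT'] at hdv
  have hle := ENNReal.toReal_mono hC (h (s.sup id))
  have hw0 : 0 < w := by
    by_contra hw0
    have : w * p ≤ 0 := mul_nonpos_of_nonpos_of_nonneg (not_lt.1 hw0) (by positivity)
    have := Real.log_pos one_lt_two
    have : 0 ≤ C.toReal := ENNReal.toReal_nonneg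
    linarith
  have := mul_le_mul_of_nonneg_left hμA hw0.le
  linarith

open InformationTheory Filter Topology Preorder in
/-- The Kullback-Leibler divergence of laws of sequences is the limit of the divergences of the
laws of the finite prefixes. -/
theorem klDiv_eq_iSup_frestrictLe {α : Type*} [MeasurableSpace α]
    (μ ν : Measure (ℕ → α)) [IsProbabilityMeasure μ] [IsProbabilityMeasure ν] :
    klDiv μ ν = ⨆ N, klDiv (μ.map (frestrictLe (π := fun _ => α) N))
      (ν.map (frestrictLe (π := fun _ => α) N)) := by
  refine le_antisymm ?_ (iSup_le fun N => klDiv_map_le μ ν (by fun_prop))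
  by_cases htop : (⨆ N, klDiv (μ.map (frestrictLe (π := fun _ => α) N))
      (ν.map (frestrictLe (π := fun _ => α) N))) = ∞
  · rw [htop]; exact le_top
  have hac := absolutelyContinuous_of_klDiv_frestrictLe_le htop
    (fun N => le_iSup (fun N => klDiv (μ.map (frestrictLe (π := fun _ => α) N))
      (ν.map (frestrictLe (π := fun _ => α) N))) N)
  rw [klDiv_eq_lintegral_klFun_of_ac hac]
  set f : (ℕ → α) → ℝ := fun x => (μ.rnDeriv ν x).toReal with hf
  have hfint : Integrable f ν := Measure.integrable_toReal_rnDeriv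
  have hfm : Measurable f := (Measure.measurable_rnDeriv μ ν).ennreal_toReal
  have hsup : (⨆ N, (Filtration.piLE (X := fun _ : ℕ => α)) N) = MeasurableSpace.pi := by
    refine le_antisymm (iSup_le fun N => Filtration.le _ N) ?_
    refine iSup_le fun i => ?_
    refine le_trans ?_ (le_iSup _ i)
    rw [Filtration.piLE_eq_comap_frestrictLe, MeasurableSpace.pi, MeasurableSpace.comap_iSup]
    refine le_trans ?_ (le_iSup _ (⟨i, Finset.mem_Iic.2 le_rfl⟩ : Finset.Iic i))
    rw [MeasurableSpace.comap_comp]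
    rfl
  -- The density of the prefix laws is the conditional expectation of the density `f`, so Lévy's
  -- upward theorem gives almost sure convergence to `f`. Fatou's lemma for the nonnegative
  -- integrands `klFun` then yields the inequality.
  have hlim := tendsto_ae_condExp (μ := ν) (ℱ := Filtration.piLE (X := fun _ : ℕ => α)) f
  rw [hsup, condExp_of_stronglyMeasurable le_rfl hfm.stronglyMeasurable hfint] at hlim
  have hbound : ∀ N, ∫⁻ x, ENNReal.ofReal
      (klFun ((ν[f | (Filtration.piLE (X := fun _ : ℕ => α)) N]) x)) ∂ν ≤
        ⨆ N, klDiv (μ.map (frestrictLe (π := fun _ => α) N))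
          (ν.map (frestrictLe (π := fun _ => α) N)) := by
    intro N
    refine le_trans ?_ (le_iSup _ N)
    have hm : Measurable (frestrictLe (π := fun _ : ℕ => α) N) := by fun_prop
    rw [klDiv_eq_lintegral_klFun_of_ac (hac.map hm), lintegral_map (by fun_prop) hm,
      Filtration.piLE_eq_comap_frestrictLe]
    refine (lintegral_congr_ae ?_).le
    have : IsProbabilityMeasure (ν.map (frestrictLe (π := fun _ : ℕ => α) N)) :=
      Measure.isProbabilityMeasure_map hm.aemeasurable
    filter_upwards [toReal_rnDeriv_map hac hm] with x hx
    rw [hx]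
  calc _ ≤ ∫⁻ x, liminf (fun N => ENNReal.ofReal
          (klFun ((ν[f | (Filtration.piLE (X := fun _ : ℕ => α)) N]) x))) atTop ∂ν := by
        refine (lintegral_congr_ae ?_).le
        filter_upwards [hlim] with x hx
        refine (Tendsto.liminf_eq ?_).symm
        exact (ENNReal.continuous_ofReal.tendsto _).comp ((continuous_klFun.tendsto _).comp hx)
    _ ≤ liminf (fun N => ∫⁻ x, ENNReal.ofReal
          (klFun ((ν[f | (Filtration.piLE (X := fun _ : ℕ => α)) N]) x)) ∂ν) atTop := by
        refine lintegral_liminf_le' fun N => ?_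
        exact ENNReal.measurable_ofReal.comp_aemeasurable (measurable_klFun.comp_aemeasurable
          ((stronglyMeasurable_condExp.mono (Filtration.le _ N)).measurable.aemeasurable))
    _ ≤ _ := liminf_le_of_le (by isBoundedDefault) fun b hb => by
        obtain ⟨N, hN⟩ := hb.exists
        exact hN.trans (hbound N)

end

/-! ### The KL objective as a sum of stage divergences -/

noncomputable section

namespace ICGame

variable {S A₁ A₂ : Type*} [Fintype S] [Fintype A₁] [Fintype A₂]

lemma sum_pmf_toReal {A : Type*} [Fintype A] (p : PMF A) : ∑ a, (p a).toReal = 1 := by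
  rw [← ENNReal.toReal_sum fun a _ => p.apply_ne_top a, sum_pmf, ENNReal.toReal_one]

/-- All available actions are permissible. -/
def FullSupport (G : ICGame S A₁ A₂) : Prop := ∀ s, ∀ a ∈ G.avail₁ s, G.average.dist s a ≠ 0

/-- The divergence of an action distribution from the average player's. -/
def stepCost (G : ICGame S A₁ A₂) (s : S) (p : PMF A₁) : ℝ :=
  ∑ a, (p a).toReal * Real.log ((p a).toReal / (G.average.dist s a).toReal)

/-- The expectation over the next step. -/
def expNext (G : ICGame S A₁ A₂) (s : S) (p : PMF A₁) (σ : PMF A₂) (F : A₁ → A₂ → S → ℝ) : ℝ :=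
  ∑ a, ∑ b, ∑ q, (p a).toReal * (σ b).toReal * (G.trans s a b q).toReal * F a b q

lemma expNext_add (G : ICGame S A₁ A₂) (s : S) (p : PMF A₁) (σ : PMF A₂)
    (F F' : A₁ → A₂ → S → ℝ) :
    G.expNext s p σ (fun a b q => F a b q + F' a b q) =
      G.expNext s p σ F + G.expNext s p σ F' := by
  simp only [expNext, mul_add, Finset.sum_add_distrib]

lemma expNext_fst (G : ICGame S A₁ A₂) (s : S) (p : PMF A₁) (σ : PMF A₂) (f : A₁ → ℝ) :
    G.expNext s p σ (fun a _ _ => f a) = ∑ a, (p a).toReal * f a := by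
  simp only [expNext, ← Finset.sum_mul, ← Finset.mul_sum, sum_pmf_toReal, mul_one]

lemma expNext_const (G : ICGame S A₁ A₂) (s : S) (p : PMF A₁) (σ : PMF A₂) (c : ℝ) :
    G.expNext s p σ (fun _ _ _ => c) = c := by
  rw [expNext_fst G s p σ (fun _ => c), ← Finset.sum_mul, sum_pmf_toReal, one_mul]

lemma expNext_mul_const (G : ICGame S A₁ A₂) (s : S) (p : PMF A₁) (σ : PMF A₂)
    (F : A₁ → A₂ → S → ℝ) (c : ℝ) :
    G.expNext s p σ (fun a b q => F a b q * c) = G.expNext s p σ F * c := by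
  simp only [expNext, Finset.sum_mul, mul_assoc]

lemma expNext_mono (G : ICGame S A₁ A₂) (s : S) (p : PMF A₁) (σ : PMF A₂)
    {F F' : A₁ → A₂ → S → ℝ}
    (h : ∀ a b q, p a ≠ 0 → σ b ≠ 0 → G.trans s a b q ≠ 0 → F a b q ≤ F' a b q) :
    G.expNext s p σ F ≤ G.expNext s p σ F' := by
  refine Finset.sum_le_sum fun a _ => Finset.sum_le_sum fun b _ => Finset.sum_le_sum fun q _ => ?_
  by_cases hp : p a = 0
  · simp [hp]
  by_cases hσ : σ b = 0
  · simp [hσ]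
  by_cases hq : G.trans s a b q = 0
  · simp [hq]
  exact mul_le_mul_of_nonneg_left (h a b q hp hσ hq) (by positivity)

lemma expNext_congr (G : ICGame S A₁ A₂) (s : S) (p : PMF A₁) (σ : PMF A₂)
    {F F' : A₁ → A₂ → S → ℝ}
    (h : ∀ a b q, p a ≠ 0 → σ b ≠ 0 → G.trans s a b q ≠ 0 → F a b q = F' a b q) :
    G.expNext s p σ F = G.expNext s p σ F' :=
  le_antisymm (G.expNext_mono s p σ fun a b q h1 h2 h3 => (h a b q h1 h2 h3).le)
    (G.expNext_mono s p σ fun a b q h1 h2 h3 => (h a b q h1 h2 h3).ge)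

lemma integral_runLaw_expNext (G : ICGame S A₁ A₂) (π₁ : G.Policy₁) (π₂ : G.Policy₂) (s : S)
    {F : (ℕ → Step S A₁ A₂) → ℝ} (hF : Measurable F) {c : ℝ} (hc : ∀ γ, |F γ| ≤ c) :
    ∫ γ, F γ ∂(G.runLaw π₁ π₂ s) = G.expNext s (π₁.act [] s) (π₂.act [] s) fun a b q =>
      ∫ γ, F (consRun ⟨s, a, b⟩ γ) ∂(G.runLaw (π₁.shift ⟨s, a, b⟩) (π₂.shift ⟨s, a, b⟩) q) :=
  integral_runLaw G π₁ π₂ s hF hc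

lemma measureReal_runLaw (G : ICGame S A₁ A₂) (π₁ : G.Policy₁) (π₂ : G.Policy₂) (s : S)
    {B : Set (ℕ → Step S A₁ A₂)} (hB : MeasurableSet B) :
    (G.runLaw π₁ π₂ s).real B = G.expNext s (π₁.act [] s) (π₂.act [] s) fun a b q =>
      (G.runLaw (π₁.shift ⟨s, a, b⟩) (π₂.shift ⟨s, a, b⟩) q).real (consRun ⟨s, a, b⟩ ⁻¹' B) := by
  have := integral_runLaw_expNext G π₁ π₂ s (F := B.indicator 1) (c := 1)
    (measurable_one.indicator hB) (fun γ => by by_cases h : γ ∈ B <;> simp [h])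
  rw [integral_indicator_one hB] at this
  rw [this]
  refine expNext_congr _ _ _ _ fun a b q _ _ _ => ?_
  rw [← integral_indicator_one (measurable_consRun _ hB)]
  rfl

/-- The expected sum of the first `N` stage divergences. -/
def klSum (G : ICGame S A₁ A₂) : ℕ → G.Policy₁ → G.Policy₂ → S → ℝ
  | 0, _, _, _ => 0
  | N + 1, π₁, π₂, s => G.stepCost s (π₁.act [] s) +
      G.expNext s (π₁.act [] s) (π₂.act [] s) fun a b q =>
        G.klSum N (π₁.shift ⟨s, a, b⟩) (π₂.shift ⟨s, a, b⟩) q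

/-- The likelihood ratio of a policy and the average player's policy. -/
def likelihoodRatio (G : ICGame S A₁ A₂) : G.Policy₁ → List (Step S A₁ A₂) → ℝ
  | _, [] => 1
  | π₁, x :: l => (π₁.act [] x.state x.act₁).toReal / (G.average.dist x.state x.act₁).toReal *
      G.likelihoodRatio (π₁.shift x) l

/-- The log-likelihood ratio of a policy and the average player's policy. -/
def logLikelihoodRatio (G : ICGame S A₁ A₂) : G.Policy₁ → List (Step S A₁ A₂) → ℝ
  | _, [] => 0
  | π₁, x :: l =>
    Real.log ((π₁.act [] x.state x.act₁).toReal / (G.average.dist x.state x.act₁).toReal) +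
      G.logLikelihoodRatio (π₁.shift x) l

omit [Fintype S] [Fintype A₁] [Fintype A₂] in
lemma likelihoodRatio_nonneg (G : ICGame S A₁ A₂) (l : List (Step S A₁ A₂)) :
    ∀ π₁ : G.Policy₁, 0 ≤ G.likelihoodRatio π₁ l := by
  induction l with
  | nil => intro; simp [likelihoodRatio]
  | cons x l ih => intro π₁; exact mul_nonneg (by positivity) (ih _)

omit [Fintype S] in
lemma stageLaw_apply (G : ICGame S A₁ A₂) (π₁ : G.Policy₁) (π₂ : G.Policy₂)
    (h : List (Step S A₁ A₂)) (s : S) (x : Step S A₁ A₂) [Decidable (x.state = s)] :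
    G.stageLaw π₁ π₂ h s x =
      if x.state = s then π₁.act h s x.act₁ * π₂.act h s x.act₂ else 0 := by
  classical
  obtain ⟨s', a, b⟩ := x
  simp only [stageLaw, PMF.bind_apply, tsum_fintype, PMF.pure_apply, Step.mk.injEq]
  split_ifs with hs
  · simp [hs, ite_and, Finset.sum_ite_eq]
  · simp [hs]

/-- The transition probabilities and the actions of Player 2 contribute the same factors on both
sides; only the factors of Player 1 differ. Where the average player has probability zero the action
is unavailable, so `π₁` has probability zero as well. -/
lemma pathWeight_eq_likelihoodRatio_mul {G : ICGame S A₁ A₂} (hG : G.FullSupport)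
    (l : List (Step S A₁ A₂)) : ∀ (π₁ : G.Policy₁) (π₂ : G.Policy₂) (s : S),
      G.pathWeight π₁ π₂ s l = ENNReal.ofReal (G.likelihoodRatio π₁ l) *
        G.pathWeight G.averagePolicy π₂ s l := by
  classical
  induction l with
  | nil => intro π₁ π₂ s; simp [pathWeight, likelihoodRatio]
  | cons x l ih =>
    intro π₁ π₂ s
    simp only [pathWeight, stageLaw_apply, likelihoodRatio, toPolicy_shift]
    split_ifs with hs
    · subst hs
      simp only [ih (π₁.shift x)]
      rw [ENNReal.ofReal_mul (by positivity)]
      have h1 : π₁.act [] x.state x.act₁ = ENNReal.ofReal ((π₁.act [] x.state x.act₁).toReal /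
          (G.average.dist x.state x.act₁).toReal) * G.average.dist x.state x.act₁ := by
        by_cases h : x.act₁ ∈ G.avail₁ x.state
        · have hne := hG _ _ h
          rw [ENNReal.ofReal_div_of_pos (ENNReal.toReal_pos hne (PMF.apply_ne_top _ _)),
            ENNReal.ofReal_toReal (PMF.apply_ne_top _ _),
            ENNReal.ofReal_toReal (PMF.apply_ne_top _ _),
            ENNReal.div_mul_cancel hne (PMF.apply_ne_top _ _)]
        · have hz : π₁.act [] x.state x.act₁ = 0 := by
            by_contra hne
            exact h (π₁.act_avail _ _ ((PMF.mem_support_iff _ _).2 hne))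
          rw [hz]
          simp
      generalize ENNReal.ofReal ((π₁.act [] x.state x.act₁).toReal /
          (G.average.dist x.state x.act₁).toReal) = c at h1 ⊢
      rw [h1, Finset.mul_sum, Finset.mul_sum, Finset.mul_sum]
      refine Finset.sum_congr rfl fun q _ => ?_
      simp only [StationaryPolicy.toPolicy]
      ring
    · simp

lemma likelihoodRatio_ne_zero {G : ICGame S A₁ A₂} (hG : G.FullSupport)
    (l : List (Step S A₁ A₂)) : ∀ (π₁ : G.Policy₁) (π₂ : G.Policy₂) (s : S),
      G.pathWeight π₁ π₂ s l ≠ 0 → G.likelihoodRatio π₁ l ≠ 0 := by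
  intro π₁ π₂ s h h0
  rw [pathWeight_eq_likelihoodRatio_mul hG, h0] at h
  simp at h

omit [Fintype S] [Fintype A₁] [Fintype A₂] in
lemma log_likelihoodRatio (G : ICGame S A₁ A₂) (l : List (Step S A₁ A₂)) :
    ∀ π₁ : G.Policy₁, G.likelihoodRatio π₁ l ≠ 0 →
      Real.log (G.likelihoodRatio π₁ l) = G.logLikelihoodRatio π₁ l := by
  induction l with
  | nil => intro; simp [likelihoodRatio, logLikelihoodRatio]
  | cons x l ih =>
    intro π₁ h
    rw [likelihoodRatio] at h ⊢
    rw [Real.log_mul (left_ne_zero_of_mul h) (right_ne_zero_of_mul h), logLikelihoodRatio,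
      ih _ (right_ne_zero_of_mul h)]

lemma measurable_runPrefix {β : Type*} [MeasurableSpace β] (N : ℕ)
    (F : List (Step S A₁ A₂) → β) : Measurable fun γ => F (runPrefix N γ) :=
  (measurable_of_finite (fun v : Fin N → Step S A₁ A₂ => F (List.ofFn v))).comp
    (measurable_runPrefix_fin N)

lemma exists_abs_runPrefix_le (N : ℕ) (F : List (Step S A₁ A₂) → ℝ) :
    ∃ c, ∀ γ, |F (runPrefix N γ)| ≤ c := by
  obtain ⟨c, hc⟩ := Finite.exists_le fun v : Fin N → Step S A₁ A₂ => |F (List.ofFn v)|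
  exact ⟨c, fun γ => hc _⟩

/-- The chain rule for relative entropy: condition on the first stage and recurse. -/
lemma integral_logLikelihoodRatio (G : ICGame S A₁ A₂) (N : ℕ) :
    ∀ (π₁ : G.Policy₁) (π₂ : G.Policy₂) (s : S),
      ∫ γ, G.logLikelihoodRatio π₁ (runPrefix N γ) ∂(G.runLaw π₁ π₂ s) = G.klSum N π₁ π₂ s := by
  induction N with
  | zero => intro π₁ π₂ s; simp [logLikelihoodRatio, klSum]
  | succ N ih =>
    intro π₁ π₂ s
    obtain ⟨c, hc⟩ := exists_abs_runPrefix_le (N + 1) (G.logLikelihoodRatio π₁)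
    rw [integral_runLaw_expNext G π₁ π₂ s (measurable_runPrefix (N + 1) _) hc]
    simp only [runPrefix_succ_consRun, logLikelihoodRatio]
    have hsplit : ∀ a b q, ∫ γ, (Real.log ((π₁.act [] s a).toReal / (G.average.dist s a).toReal) +
        G.logLikelihoodRatio (π₁.shift ⟨s, a, b⟩) (runPrefix N γ))
          ∂(G.runLaw (π₁.shift ⟨s, a, b⟩) (π₂.shift ⟨s, a, b⟩) q) =
        Real.log ((π₁.act [] s a).toReal / (G.average.dist s a).toReal) +
          G.klSum N (π₁.shift ⟨s, a, b⟩) (π₂.shift ⟨s, a, b⟩) q := by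
      intro a b q
      obtain ⟨c, hc⟩ := exists_abs_runPrefix_le N (G.logLikelihoodRatio (π₁.shift ⟨s, a, b⟩))
      rw [integral_add (integrable_const _) (Integrable.of_bound
        (measurable_runPrefix N _).aestronglyMeasurable c (ae_of_all _ hc)), ih]
      simp
    simp only [hsplit]
    rw [expNext_add G s _ _ (fun a _ _ => Real.log ((π₁.act [] s a).toReal /
      (G.average.dist s a).toReal)), expNext_fst]
    rfl

open InformationTheory Preorder in
-- The space of prefixes is finite, so the density is the likelihood ratio and its logarithm has a
-- finite integral. The index is `N + 1` because restriction to times at most `N` keeps `N + 1`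
-- stages.
lemma klDiv_map_frestrictLe {G : ICGame S A₁ A₂} (hG : G.FullSupport)
    (π₁ : G.Policy₁) (π₂ : G.Policy₂) (s : S) (N : ℕ) :
    klDiv ((G.runLaw π₁ π₂ s).map (frestrictLe (π := fun _ => Step S A₁ A₂) N))
      ((G.runLaw G.averagePolicy π₂ s).map (frestrictLe (π := fun _ => Step S A₁ A₂) N)) =
        ENNReal.ofReal (G.klSum (N + 1) π₁ π₂ s) := by
  set r := frestrictLe (π := fun _ : ℕ => Step S A₁ A₂) N with hr
  have hrm : Measurable r := by fun_prop
  set lst : ((i : Finset.Iic N) → Step S A₁ A₂) → List (Step S A₁ A₂) := fun v =>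
    List.ofFn fun i : Fin (N + 1) => v ⟨i, Finset.mem_Iic.2 (Nat.lt_succ_iff.1 i.2)⟩ with hlst
  have hlr : ∀ γ, lst (r γ) = runPrefix (N + 1) γ := fun γ => rfl
  have hinj : Function.Injective lst := by
    intro v w h
    have := List.ofFn_injective h
    funext i
    exact congrFun this ⟨i, Nat.lt_succ_iff.2 (Finset.mem_Iic.1 i.2)⟩
  have hsing : ∀ (π : G.Policy₁) v,
      (G.runLaw π π₂ s).map r {v} = G.pathWeight π π₂ s (lst v) := by
    intro π v
    rw [Measure.map_apply hrm (measurableSet_singleton _),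
      ← runLaw_runPrefix G π π₂ s N (lst v) (by simp [hlst])]
    congr 1
    ext γ
    change r γ = v ↔ runPrefix (N + 1) γ = lst v
    rw [← hlr, hinj.eq_iff]
  set μN := (G.runLaw π₁ π₂ s).map r with hμN
  set νN := (G.runLaw G.averagePolicy π₂ s).map r with hνN
  have : IsProbabilityMeasure μN := Measure.isProbabilityMeasure_map hrm.aemeasurable
  have : IsProbabilityMeasure νN := Measure.isProbabilityMeasure_map hrm.aemeasurable
  have hd : μN = νN.withDensity fun v => ENNReal.ofReal (G.likelihoodRatio π₁ (lst v)) := by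
    refine Measure.ext_of_singleton fun v => ?_
    rw [withDensity_apply _ (measurableSet_singleton _), lintegral_singleton, hsing, hsing,
      pathWeight_eq_likelihoodRatio_mul hG]
  have hac : μN ≪ νN := by rw [hd]; exact withDensity_absolutelyContinuous _ _
  have hllr : llr μN νN =ᵐ[μN] fun v => G.logLikelihoodRatio π₁ (lst v) := by
    have h1 : μN.rnDeriv νN =ᵐ[νN] fun v => ENNReal.ofReal (G.likelihoodRatio π₁ (lst v)) := by
      conv_lhs => rw [hd]
      exact Measure.rnDeriv_withDensity _ (measurable_of_finite _)
    have h2 : ∀ᵐ v ∂μN, G.pathWeight π₁ π₂ s (lst v) ≠ 0 := by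
      rw [ae_iff_of_countable]
      intro v hv
      rwa [hsing] at hv
    filter_upwards [hac.ae_le h1, h2] with v hv hv2
    rw [llr, hv, ENNReal.toReal_ofReal (likelihoodRatio_nonneg G _ _),
      log_likelihoodRatio G _ _ (likelihoodRatio_ne_zero hG _ _ _ _ hv2)]
  have hint : Integrable (llr μN νN) μN := (Integrable.of_finite).congr hllr.symm
  rw [klDiv_of_ac_of_integrable hac hint]
  simp only [probReal_univ, add_sub_cancel_right]
  rw [integral_congr_ae hllr, hμN, integral_map hrm.aemeasurable
    (measurable_of_finite _).aestronglyMeasurable]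
  simp only [hlr, integral_logLikelihoodRatio]

/-- Together with `klFrom_le_of_klSum_le`, this replaces the divergence of infinite runs by the
recursively defined `klSum`. -/
lemma ofReal_klSum_le_klFrom {G : ICGame S A₁ A₂} (hG : G.FullSupport)
    (π₁ : G.Policy₁) (π₂ : G.Policy₂) (s : S) (N : ℕ) :
    ENNReal.ofReal (G.klSum N π₁ π₂ s) ≤ G.klFrom s π₁ π₂ := by
  cases N with
  | zero => simp [klSum]
  | succ N =>
    rw [klFrom, klDiv_eq_iSup_frestrictLe, ← klDiv_map_frestrictLe hG]
    exact le_iSup (fun N => InformationTheory.klDiv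
      ((G.runLaw π₁ π₂ s).map (Preorder.frestrictLe (π := fun _ => Step S A₁ A₂) N))
      ((G.runLaw G.averagePolicy π₂ s).map
        (Preorder.frestrictLe (π := fun _ => Step S A₁ A₂) N))) N

lemma klFrom_le_of_klSum_le {G : ICGame S A₁ A₂} (hG : G.FullSupport)
    {π₁ : G.Policy₁} {π₂ : G.Policy₂} {s : S} {c : ℝ≥0∞}
    (h : ∀ N, ENNReal.ofReal (G.klSum N π₁ π₂ s) ≤ c) : G.klFrom s π₁ π₂ ≤ c := by
  rw [klFrom, klDiv_eq_iSup_frestrictLe]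
  exact iSup_le fun N => by rw [klDiv_map_frestrictLe hG]; exact h _

end ICGame
end

/-! ### Avoidance probabilities, the winning region and its attractors -/

noncomputable section

namespace ICGame

variable {S A₁ A₂ : Type*} [Fintype S] [Fintype A₁] [Fintype A₂]

/-- The probability of avoiding `E` up to time `N`. -/
def avoidProb (G : ICGame S A₁ A₂) (E : Set S) (N : ℕ) (π₁ : G.Policy₁) (π₂ : G.Policy₂)
    (s : S) : ℝ :=
  (G.runLaw π₁ π₂ s).real {γ | ∀ t ≤ N, (γ t).state ∉ E}

/-- The probability of avoiding `E` forever. -/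
def avoidForever (G : ICGame S A₁ A₂) (E : Set S) (π₁ : G.Policy₁) (π₂ : G.Policy₂)
    (s : S) : ℝ :=
  (G.runLaw π₁ π₂ s).real {γ | ∀ t, (γ t).state ∉ E}

omit [Fintype S] [Fintype A₁] [Fintype A₂] in
lemma measurableSet_state (t : ℕ) (E : Set S) :
    MeasurableSet {γ : ℕ → Step S A₁ A₂ | (γ t).state ∈ E} :=
  (measurable_pi_apply t : Measurable fun γ : ℕ → Step S A₁ A₂ => γ t)
    (MeasurableSet.of_discrete (s := {x : Step S A₁ A₂ | x.state ∈ E}))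

omit [Fintype S] [Fintype A₁] [Fintype A₂] in
lemma measurableSet_avoid (E : Set S) (N : ℕ) :
    MeasurableSet {γ : ℕ → Step S A₁ A₂ | ∀ t ≤ N, (γ t).state ∉ E} := by
  simp only [Set.ofPred_forall]
  exact MeasurableSet.iInter fun t => MeasurableSet.iInter fun _ =>
    (measurableSet_state t E).compl

omit [Fintype S] [Fintype A₁] [Fintype A₂] in
lemma measurableSet_avoidForever (E : Set S) :
    MeasurableSet {γ : ℕ → Step S A₁ A₂ | ∀ t, (γ t).state ∉ E} := by
  simp only [Set.ofPred_forall]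
  exact MeasurableSet.iInter fun t => (measurableSet_state t E).compl

omit [Fintype S] [Fintype A₁] [Fintype A₂] in
lemma measurableSet_reach (E : Set S) :
    MeasurableSet (reach E : Set (ℕ → Step S A₁ A₂)) := by
  convert (measurableSet_avoidForever (A₁ := A₁) (A₂ := A₂) E).compl using 1
  ext γ
  simp [reach]

lemma avoidProb_nonneg (G : ICGame S A₁ A₂) (E : Set S) (N : ℕ) (π₁ : G.Policy₁)
    (π₂ : G.Policy₂) (s : S) : 0 ≤ G.avoidProb E N π₁ π₂ s := measureReal_nonneg

lemma avoidProb_le_one (G : ICGame S A₁ A₂) (E : Set S) (N : ℕ) (π₁ : G.Policy₁)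
    (π₂ : G.Policy₂) (s : S) : G.avoidProb E N π₁ π₂ s ≤ 1 := measureReal_le_one

lemma avoidForever_nonneg (G : ICGame S A₁ A₂) (E : Set S) (π₁ : G.Policy₁)
    (π₂ : G.Policy₂) (s : S) : 0 ≤ G.avoidForever E π₁ π₂ s := measureReal_nonneg

lemma avoidForever_le_one (G : ICGame S A₁ A₂) (E : Set S) (π₁ : G.Policy₁)
    (π₂ : G.Policy₂) (s : S) : G.avoidForever E π₁ π₂ s ≤ 1 := measureReal_le_one

lemma avoidForever_le_avoidProb (G : ICGame S A₁ A₂) (E : Set S) (N : ℕ) (π₁ : G.Policy₁)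
    (π₂ : G.Policy₂) (s : S) : G.avoidForever E π₁ π₂ s ≤ G.avoidProb E N π₁ π₂ s :=
  measureReal_mono fun _ hγ t _ => hγ t

lemma avoidProb_antitone (G : ICGame S A₁ A₂) (E : Set S) (π₁ : G.Policy₁)
    (π₂ : G.Policy₂) (s : S) : Antitone fun N => G.avoidProb E N π₁ π₂ s :=
  fun _ _ h => measureReal_mono fun _ hγ t ht => hγ t (ht.trans h)

lemma avoidProb_mono_set (G : ICGame S A₁ A₂) {E E' : Set S} (h : E' ⊆ E) (N : ℕ)
    (π₁ : G.Policy₁) (π₂ : G.Policy₂) (s : S) :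
    G.avoidProb E N π₁ π₂ s ≤ G.avoidProb E' N π₁ π₂ s :=
  measureReal_mono fun _ hγ t ht hE => hγ t ht (h hE)

lemma avoidForever_mono_set (G : ICGame S A₁ A₂) {E E' : Set S} (h : E' ⊆ E)
    (π₁ : G.Policy₁) (π₂ : G.Policy₂) (s : S) :
    G.avoidForever E π₁ π₂ s ≤ G.avoidForever E' π₁ π₂ s :=
  measureReal_mono fun _ hγ t hE => hγ t (h hE)

open Filter Topology in
lemma tendsto_avoidProb (G : ICGame S A₁ A₂) (E : Set S) (π₁ : G.Policy₁)
    (π₂ : G.Policy₂) (s : S) :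
    Tendsto (fun N => G.avoidProb E N π₁ π₂ s) atTop (𝓝 (G.avoidForever E π₁ π₂ s)) := by
  have h : {γ : ℕ → Step S A₁ A₂ | ∀ t, (γ t).state ∉ E} =
      ⋂ N, {γ | ∀ t ≤ N, (γ t).state ∉ E} := by
    ext γ
    simp only [Set.mem_iInter]
    exact ⟨fun h N t _ => h t, fun h t => h t t le_rfl⟩
  rw [avoidForever, h]
  refine (ENNReal.tendsto_toReal (measure_ne_top _ _)).comp
    (tendsto_measure_iInter_atTop (fun N => (measurableSet_avoid E N).nullMeasurableSet) ?_
      ⟨0, measure_ne_top _ _⟩)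
  exact fun N M hNM γ hγ t ht => hγ t (ht.trans hNM)

lemma avoidProb_of_mem (G : ICGame S A₁ A₂) {E : Set S} (N : ℕ) (π₁ : G.Policy₁)
    (π₂ : G.Policy₂) {s : S} (hs : s ∈ E) : G.avoidProb E N π₁ π₂ s = 0 := by
  rw [avoidProb, measureReal_runLaw G π₁ π₂ s (measurableSet_avoid E N)]
  rw [← G.expNext_const s (π₁.act [] s) (π₂.act [] s) 0]
  refine expNext_congr _ _ _ _ fun a b q _ _ _ => ?_
  convert measureReal_empty
  ext γ
  simp only [Set.mem_preimage, Set.mem_empty_iff_false, iff_false]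
  exact fun h => h 0 (Nat.zero_le _) hs

lemma avoidForever_of_mem (G : ICGame S A₁ A₂) {E : Set S} (π₁ : G.Policy₁)
    (π₂ : G.Policy₂) {s : S} (hs : s ∈ E) : G.avoidForever E π₁ π₂ s = 0 :=
  le_antisymm ((G.avoidForever_le_avoidProb E 0 π₁ π₂ s).trans (G.avoidProb_of_mem 0 π₁ π₂ hs).le)
    (G.avoidForever_nonneg E π₁ π₂ s)

lemma avoidProb_zero (G : ICGame S A₁ A₂) {E : Set S} (π₁ : G.Policy₁)
    (π₂ : G.Policy₂) {s : S} (hs : s ∉ E) : G.avoidProb E 0 π₁ π₂ s = 1 := by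
  rw [avoidProb, measureReal_runLaw G π₁ π₂ s (measurableSet_avoid E 0)]
  rw [← G.expNext_const s (π₁.act [] s) (π₂.act [] s) 1]
  refine expNext_congr _ _ _ _ fun a b q _ _ _ => ?_
  rw [← probReal_univ (μ := G.runLaw (π₁.shift ⟨s, a, b⟩) (π₂.shift ⟨s, a, b⟩) q)]
  congr 1
  ext γ
  simp only [Set.mem_preimage, Set.mem_univ, iff_true]
  intro t ht
  obtain rfl : t = 0 := by omega
  exact hs

lemma avoidProb_succ (G : ICGame S A₁ A₂) {E : Set S} (N : ℕ) (π₁ : G.Policy₁)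
    (π₂ : G.Policy₂) {s : S} (hs : s ∉ E) : G.avoidProb E (N + 1) π₁ π₂ s =
      G.expNext s (π₁.act [] s) (π₂.act [] s) fun a b q =>
        G.avoidProb E N (π₁.shift ⟨s, a, b⟩) (π₂.shift ⟨s, a, b⟩) q := by
  rw [avoidProb, measureReal_runLaw G π₁ π₂ s (measurableSet_avoid E _)]
  refine expNext_congr _ _ _ _ fun a b q _ _ _ => ?_
  rw [avoidProb]
  congr 1
  ext γ
  constructor
  · exact fun h t ht => h (t + 1) (by omega)
  · rintro h (_ | t) ht
    · exact hs
    · exact h t (by omega)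

lemma avoidForever_succ (G : ICGame S A₁ A₂) {E : Set S} (π₁ : G.Policy₁)
    (π₂ : G.Policy₂) {s : S} (hs : s ∉ E) : G.avoidForever E π₁ π₂ s =
      G.expNext s (π₁.act [] s) (π₂.act [] s) fun a b q =>
        G.avoidForever E (π₁.shift ⟨s, a, b⟩) (π₂.shift ⟨s, a, b⟩) q := by
  rw [avoidForever, measureReal_runLaw G π₁ π₂ s (measurableSet_avoidForever E)]
  refine expNext_congr _ _ _ _ fun a b q _ _ _ => ?_
  rw [avoidForever]
  congr 1
  ext γ
  constructor
  · exact fun h t => h (t + 1)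
  · rintro h (_ | t)
    · exact hs
    · exact h t

lemma measureReal_reach (G : ICGame S A₁ A₂) (E : Set S) (π₁ : G.Policy₁) (π₂ : G.Policy₂)
    (s : S) : (G.runLaw π₁ π₂ s).real (reach E) = 1 - G.avoidForever E π₁ π₂ s := by
  rw [avoidForever, ← probReal_compl_eq_one_sub (measurableSet_avoidForever E)]
  congr 1
  ext γ
  simp [reach]

lemma runLaw_reach_eq_one_iff (G : ICGame S A₁ A₂) (E : Set S) (π₁ : G.Policy₁)
    (π₂ : G.Policy₂) (s : S) :
    G.runLaw π₁ π₂ s (reach E) = 1 ↔ G.avoidForever E π₁ π₂ s = 0 := by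
  rw [← ENNReal.toReal_eq_one_iff, ← measureReal_def, measureReal_reach]
  constructor <;> intro <;> linarith

lemma runLaw_reach_eq_zero_iff (G : ICGame S A₁ A₂) (E : Set S) (π₁ : G.Policy₁)
    (π₂ : G.Policy₂) (s : S) :
    G.runLaw π₁ π₂ s (reach E) = 0 ↔ G.avoidForever E π₁ π₂ s = 1 := by
  rw [← measureReal_eq_zero_iff, measureReal_reach]
  constructor <;> intro <;> linarith

lemma winsFrom_iff (G : ICGame S A₁ A₂) (s : S) (π₁ : G.Policy₁) :
    G.WinsFrom s π₁ ↔ ∀ π₂, G.avoidForever G.win π₁ π₂ s = 0 :=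
  forall_congr' fun _ => runLaw_reach_eq_one_iff _ _ _ _ _

lemma winsFrom_of_mem_win (G : ICGame S A₁ A₂) {s : S} (hs : s ∈ G.win) (π₁ : G.Policy₁) :
    G.WinsFrom s π₁ := (G.winsFrom_iff s π₁).2 fun _ => G.avoidForever_of_mem _ _ hs

/-- If the expectation of a function bounded below by `c` is `c`, the function is `c` on the
support. -/
lemma eq_of_expNext_eq (G : ICGame S A₁ A₂) {s : S} {p : PMF A₁} {σ : PMF A₂}
    {F : A₁ → A₂ → S → ℝ} {c : ℝ} (hF : ∀ a b q, c ≤ F a b q) (h : G.expNext s p σ F ≤ c)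
    {a : A₁} {b : A₂} {q : S} (ha : p a ≠ 0) (hb : σ b ≠ 0) (hq : G.trans s a b q ≠ 0) :
    F a b q = c := by
  refine le_antisymm ?_ (hF a b q)
  by_contra! hlt
  have hpos : ∀ a b q, 0 ≤ (p a).toReal * (σ b).toReal * (G.trans s a b q).toReal := by
    intros; positivity
  have : G.expNext s p σ (fun _ _ _ => c) < G.expNext s p σ F := by
    refine Finset.sum_lt_sum (fun a _ => Finset.sum_le_sum fun b _ => Finset.sum_le_sum fun q _ =>
      mul_le_mul_of_nonneg_left (hF a b q) (hpos a b q)) ⟨a, Finset.mem_univ _, ?_⟩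
    refine Finset.sum_lt_sum (fun b _ => Finset.sum_le_sum fun q _ =>
      mul_le_mul_of_nonneg_left (hF a b q) (hpos a b q)) ⟨b, Finset.mem_univ _, ?_⟩
    refine Finset.sum_lt_sum (fun q _ =>
      mul_le_mul_of_nonneg_left (hF a b q) (hpos a b q)) ⟨q, Finset.mem_univ _, ?_⟩
    refine mul_lt_mul_of_pos_left hlt ?_
    exact mul_pos (mul_pos (ENNReal.toReal_pos ha (PMF.apply_ne_top _ _))
      (ENNReal.toReal_pos hb (PMF.apply_ne_top _ _)))
      (ENNReal.toReal_pos hq (PMF.apply_ne_top _ _))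
  rw [expNext_const] at this
  linarith

end ICGame

/-- Use `σ` in the first stage and `π` afterwards. -/
def Policy.prepend {S A₁ A₂ A : Type*} {avail : S → Finset A} (σ : StationaryPolicy avail)
    (π : Policy S A₁ A₂ avail) : Policy S A₁ A₂ avail where
  act
    | [], s => σ.dist s
    | _ :: h, s => π.act h s
  act_avail
    | [], s => σ.dist_avail s
    | _ :: h, s => π.act_avail h s

/-- A stationary policy that plays a given available action. -/
def StationaryPolicy.ofFun {S A : Type*} {avail : S → Finset A} (f : S → A)
    (hf : ∀ s, f s ∈ avail s) : StationaryPolicy avail where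
  dist s := PMF.pure (f s)
  dist_avail s := by simpa using hf s

namespace ICGame

variable {S A₁ A₂ : Type*} [Fintype S] [Fintype A₁] [Fintype A₂]

omit [Fintype S] [Fintype A₁] [Fintype A₂] in
lemma exists_stationary_play (G : ICGame S A₁ A₂) {s : S} {b : A₂} (hb : b ∈ G.avail₂ s) :
    ∃ σ : StationaryPolicy G.avail₂, σ.dist s = PMF.pure b := by
  classical
  refine ⟨StationaryPolicy.ofFun (fun s' => if s' = s then b else (G.avail₂_nonempty s').choose)
    fun s' => ?_, by simp [StationaryPolicy.ofFun]⟩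
  split_ifs with h
  · exact h ▸ hb
  · exact (G.avail₂_nonempty s').choose_spec

omit [Fintype S] [Fintype A₁] [Fintype A₂] in
lemma act_mem_avail {A : Type*} {avail : S → Finset A} (π : Policy S A₁ A₂ avail)
    {h : List (Step S A₁ A₂)} {s : S} {a : A} (ha : π.act h s a ≠ 0) : a ∈ avail s :=
  π.act_avail h s ((PMF.mem_support_iff _ _).2 ha)

omit [Fintype S] [Fintype A₁] [Fintype A₂] in
lemma dist_mem_avail {A : Type*} {avail : S → Finset A} (μ : StationaryPolicy avail)
    {s : S} {a : A} (ha : μ.dist s a ≠ 0) : a ∈ avail s :=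
  μ.dist_avail s ((PMF.mem_support_iff _ _).2 ha)

/-- Player 2 may open with `b` and continue with an arbitrary policy. The avoidance probability is
then an average of nonnegative numbers that vanishes, so each term of positive weight vanishes. -/
lemma winsFrom_shift (G : ICGame S A₁ A₂) {s : S} {π₁ : G.Policy₁} (h : G.WinsFrom s π₁)
    {a : A₁} (ha : π₁.act [] s a ≠ 0) {b : A₂} (hb : b ∈ G.avail₂ s) {q : S}
    (hq : G.trans s a b q ≠ 0) : G.WinsFrom q (π₁.shift ⟨s, a, b⟩) := by
  by_cases hs : s ∈ G.win
  · rw [G.win_absorbing s hs a (act_mem_avail π₁ ha) b hb] at hq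
    obtain rfl : q = s := by simpa using hq
    exact G.winsFrom_of_mem_win hs _
  rw [winsFrom_iff] at h ⊢
  intro π₂
  obtain ⟨σ, hσ⟩ := G.exists_stationary_play hb
  have h0 := h (Policy.prepend σ π₂)
  rw [avoidForever_succ G _ _ hs] at h0
  exact G.eq_of_expNext_eq (F := fun a b q => G.avoidForever G.win (π₁.shift ⟨s, a, b⟩)
    ((Policy.prepend σ π₂).shift ⟨s, a, b⟩) q) (fun a b q => G.avoidForever_nonneg _ _ _ _)
    h0.le ha (b := b) (by simp [Policy.prepend, hσ]) hq

/-- The states from which some policy wins almost surely. -/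
def winSet (G : ICGame S A₁ A₂) : Set S := {s | ∃ π₁ : G.Policy₁, G.WinsFrom s π₁}

/-- The actions that cannot lead outside `Y`. -/
def Keeps (G : ICGame S A₁ A₂) (Y : Set S) (s : S) (a : A₁) : Prop :=
  a ∈ G.avail₁ s ∧ ∀ b ∈ G.avail₂ s, ∀ q, q ∉ Y → G.trans s a b q = 0

omit [Fintype S] [Fintype A₁] [Fintype A₂] in
lemma Keeps.mem {G : ICGame S A₁ A₂} {Y : Set S} {s : S} {a : A₁} (h : G.Keeps Y s a) {b : A₂}
    (hb : b ∈ G.avail₂ s) {q : S} (hq : G.trans s a b q ≠ 0) : q ∈ Y := by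
  by_contra hY
  exact hq (h.2 b hb q hY)

lemma keeps_winSet_of_winsFrom (G : ICGame S A₁ A₂) {s : S} {π₁ : G.Policy₁}
    (h : G.WinsFrom s π₁) {a : A₁} (ha : π₁.act [] s a ≠ 0) : G.Keeps G.winSet s a := by
  refine ⟨act_mem_avail π₁ ha, fun b hb q hq => ?_⟩
  by_contra hne
  exact hq ⟨_, G.winsFrom_shift h ha hb hne⟩

/-- The states from which Player 1 can force, with positive probability, to reach `C` in `i` steps
with actions that keep the state in `Y`. -/
def attractor (G : ICGame S A₁ A₂) (Y C : Set S) : ℕ → Set S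
  | 0 => C
  | i + 1 => G.attractor Y C i ∪ {s | s ∈ Y ∧ ∀ b ∈ G.avail₂ s, ∃ a, G.Keeps Y s a ∧
      ∃ q ∈ G.attractor Y C i, G.trans s a b q ≠ 0}

omit [Fintype S] [Fintype A₁] [Fintype A₂] in
lemma attractor_mono (G : ICGame S A₁ A₂) (Y C : Set S) : Monotone (G.attractor Y C) :=
  monotone_nat_of_le_succ fun _ => Set.subset_union_left

/-- To avoid `C` forever one must first avoid it up to time `N`. The play is still in `Y` then,
where the uniform bound `θ` applies to the rest of the run. Iterating this gives geometric decay. -/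
lemma avoidForever_le_avoidProb_mul (G : ICGame S A₁ A₂) {Y C : Set S}
    {μ : StationaryPolicy G.avail₁} (hμ : ∀ s ∈ Y, s ∉ C → ∀ a, μ.dist s a ≠ 0 → G.Keeps Y s a)
    {θ : ℝ} (hθ : ∀ s ∈ Y, ∀ π₂, G.avoidForever C (μ.toPolicy A₁ A₂) π₂ s ≤ θ) (N : ℕ) :
    ∀ s ∈ Y, ∀ π₂, G.avoidForever C (μ.toPolicy A₁ A₂) π₂ s ≤
      G.avoidProb C N (μ.toPolicy A₁ A₂) π₂ s * θ := by
  induction N with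
  | zero =>
    intro s hs π₂
    by_cases hC : s ∈ C
    · simp [avoidForever_of_mem G _ _ hC, avoidProb_of_mem G _ _ _ hC]
    · simpa [avoidProb_zero G _ _ hC] using hθ s hs π₂
  | succ N ih =>
    intro s hs π₂
    by_cases hC : s ∈ C
    · simp [avoidForever_of_mem G _ _ hC, avoidProb_of_mem G _ _ _ hC]
    · rw [avoidForever_succ G _ _ hC, avoidProb_succ G _ _ _ hC, ← expNext_mul_const]
      refine expNext_mono _ _ _ _ fun a b q ha hb hq => ?_
      exact ih q ((hμ s hs hC a ha).mem (act_mem_avail π₂ hb) hq) _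

lemma exists_pos_le_mul (G : ICGame S A₁ A₂) (μ : StationaryPolicy G.avail₁) :
    ∃ ρ : ℝ, 0 < ρ ∧ ρ ≤ 1 ∧ ∀ s a b q, μ.dist s a ≠ 0 → G.trans s a b q ≠ 0 →
      ρ ≤ (μ.dist s a).toReal * (G.trans s a b q).toReal := by
  have : ∀ᶠ ρ : ℝ in nhdsWithin 0 (Set.Ioi 0), 0 < ρ ∧ ρ ≤ 1 ∧
      ∀ s a b q, μ.dist s a ≠ 0 → G.trans s a b q ≠ 0 →
        ρ ≤ (μ.dist s a).toReal * (G.trans s a b q).toReal := by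
    refine (eventually_mem_nhdsWithin).and (.and ?_ ?_)
    · exact nhdsWithin_le_nhds (eventually_le_nhds one_pos)
    · simp only [Filter.eventually_all]
      intro s a b q ha hq
      exact nhdsWithin_le_nhds (eventually_le_nhds
        (mul_pos (ENNReal.toReal_pos ha (PMF.apply_ne_top _ _))
          (ENNReal.toReal_pos hq (PMF.apply_ne_top _ _))))
  exact this.exists

/-- A stationary policy that uses all actions that keep the state in `Y` reaches `C` almost surely
if every state of `Y` is in the attractor of `C`. -/
theorem avoidForever_eq_zero_of_subset_attractor (G : ICGame S A₁ A₂) {Y C : Set S}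
    (hY : ∀ s ∈ Y, ∃ i, s ∈ G.attractor Y C i) {μ : StationaryPolicy G.avail₁}
    (hμ : ∀ s ∈ Y, s ∉ C → ∀ a, μ.dist s a ≠ 0 ↔ G.Keeps Y s a) :
    ∀ s ∈ Y, ∀ π₂, G.avoidForever C (μ.toPolicy A₁ A₂) π₂ s = 0 := by
  obtain ⟨ρ, hρ0, hρ1, hρ⟩ := G.exists_pos_le_mul μ
  -- Whatever action Player 2 draws, some keeping action leads one attractor level down, and `μ`
  -- plays it. Action and transition together have probability at least `ρ`.
  have hattr : ∀ i, ∀ s ∈ Y, s ∈ G.attractor Y C i → ∀ π₂,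
      G.avoidProb C i (μ.toPolicy A₁ A₂) π₂ s ≤ 1 - ρ ^ i := by
    intro i
    induction i with
    | zero =>
      intro s hs hsC π₂
      simp [avoidProb_of_mem G 0 _ _ (show s ∈ C from hsC)]
    | succ i ih =>
      intro s hs hsi π₂
      have hpow : ρ ^ (i + 1) ≤ ρ ^ i := pow_le_pow_of_le_one hρ0.le hρ1 (Nat.le_succ i)
      by_cases hC : s ∈ C
      · rw [avoidProb_of_mem G _ _ _ hC]
        linarith [pow_le_one₀ (n := i + 1) hρ0.le hρ1]
      rcases hsi with hsi | ⟨-, hsi⟩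
      · have h1 := G.avoidProb_antitone C (μ.toPolicy A₁ A₂) π₂ s (Nat.le_succ i)
        have h2 := ih s hs hsi π₂
        simp only at h1
        linarith
      · rw [avoidProb_succ G _ _ _ hC]
        set F : A₁ → A₂ → S → ℝ := fun a b q => G.avoidProb C i
          ((μ.toPolicy A₁ A₂).shift ⟨s, a, b⟩) (π₂.shift ⟨s, a, b⟩) q with hF
        have hF1 : ∀ a b q, F a b q ≤ 1 := fun a b q => G.avoidProb_le_one _ _ _ _ _
        have key : ρ ^ (i + 1) ≤ G.expNext s (μ.dist s) (π₂.act [] s)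
            (fun a b q => 1 - F a b q) := by
          have hcomm : G.expNext s (μ.dist s) (π₂.act [] s) (fun a b q => 1 - F a b q) =
              ∑ b, (π₂.act [] s b).toReal * ∑ a, ∑ q, (μ.dist s a).toReal *
                (G.trans s a b q).toReal * (1 - F a b q) := by
            rw [expNext, Finset.sum_comm]
            refine Finset.sum_congr rfl fun b _ => ?_
            simp only [Finset.mul_sum]
            refine Finset.sum_congr rfl fun a _ => Finset.sum_congr rfl fun q _ => ?_
            ring
          rw [hcomm]
          calc ρ ^ (i + 1) = ∑ b, (π₂.act [] s b).toReal * ρ ^ (i + 1) := by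
                rw [← Finset.sum_mul, sum_pmf_toReal, one_mul]
            _ ≤ _ := by
                refine Finset.sum_le_sum fun b _ => ?_
                by_cases hb : π₂.act [] s b = 0
                · simp [hb]
                refine mul_le_mul_of_nonneg_left ?_ ENNReal.toReal_nonneg
                obtain ⟨a, hka, q, hqi, hq⟩ := hsi b (act_mem_avail π₂ hb)
                have ha := (hμ s hs hC a).2 hka
                have hqY := hka.mem (act_mem_avail π₂ hb) hq
                have hFq : F a b q ≤ 1 - ρ ^ i := ih q hqY hqi _
                have hnn : ∀ a q, 0 ≤ (μ.dist s a).toReal * (G.trans s a b q).toReal *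
                    (1 - F a b q) := fun a q =>
                  mul_nonneg (by positivity) (by linarith [hF1 a b q])
                calc ρ ^ (i + 1) = ρ * ρ ^ i := pow_succ' _ _
                  _ ≤ (μ.dist s a).toReal * (G.trans s a b q).toReal * (1 - F a b q) :=
                    mul_le_mul (hρ s a b q ha hq) (by linarith) (by positivity) (by positivity)
                  _ ≤ ∑ q, (μ.dist s a).toReal * (G.trans s a b q).toReal * (1 - F a b q) :=
                    Finset.single_le_sum (f := fun q => (μ.dist s a).toReal *
                      (G.trans s a b q).toReal * (1 - F a b q)) (fun q _ => hnn a q)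
                      (Finset.mem_univ q)
                  _ ≤ _ := Finset.single_le_sum (f := fun a => ∑ q, (μ.dist s a).toReal *
                      (G.trans s a b q).toReal * (1 - F a b q))
                      (fun a _ => Finset.sum_nonneg fun q _ => hnn a q) (Finset.mem_univ a)
        have hsum := G.expNext_add s (μ.dist s) (π₂.act [] s) (fun a b q => 1 - F a b q) F
        simp only [sub_add_cancel, expNext_const] at hsum
        change G.expNext s (μ.dist s) (π₂.act [] s) F ≤ _
        linarith
  obtain ⟨N, hN⟩ : ∃ N, ∀ s, s ∈ Y → s ∈ G.attractor Y C N := by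
    have : ∀ᶠ N in Filter.atTop, ∀ s, s ∈ Y → s ∈ G.attractor Y C N := by
      rw [Filter.eventually_all]
      intro s
      by_cases hs : s ∈ Y
      · obtain ⟨i, hi⟩ := hY s hs
        filter_upwards [Filter.eventually_ge_atTop i] with N hN _
        exact G.attractor_mono Y C hN hi
      · exact Filter.Eventually.of_forall fun N h => absurd h hs
    exact this.exists
  -- With a common level `N` for all of `Y`, every block of `N` steps reaches `C` with probability
  -- at least `ρ ^ N`, uniformly in the state and in the policy of Player 2.
  have hk : ∀ k : ℕ, ∀ s ∈ Y, ∀ π₂, G.avoidForever C (μ.toPolicy A₁ A₂) π₂ s ≤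
      (1 - ρ ^ N) ^ k := by
    intro k
    induction k with
    | zero => intro s _ π₂; simpa using G.avoidForever_le_one _ _ _ _
    | succ k ih =>
      intro s hs π₂
      refine (G.avoidForever_le_avoidProb_mul (fun s hs hC a ha => (hμ s hs hC a).1 ha) ih N
        s hs π₂).trans ?_
      rw [pow_succ']
      exact mul_le_mul_of_nonneg_right (hattr N s hs (hN s hs) π₂)
        (pow_nonneg (by linarith [pow_le_one₀ (n := N) hρ0.le hρ1]) _)
  intro s hs π₂
  refine le_antisymm ?_ (G.avoidForever_nonneg _ _ _ _)
  refine ge_of_tendsto' (tendsto_pow_atTop_nhds_zero_of_lt_one ?_ ?_) fun k => hk k s hs π₂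
  · linarith [pow_le_one₀ (n := N) hρ0.le hρ1]
  · linarith [pow_pos hρ0 N]

/-- The winning states are in the attractor of the target. -/
theorem winSet_subset_attractor (G : ICGame S A₁ A₂) :
    ∀ s ∈ G.winSet, ∃ i, s ∈ G.attractor G.winSet G.win i := by
  set X : Set S := {s | ∃ i, s ∈ G.attractor G.winSet G.win i} with hX
  -- At a winning state outside the attractor one action of Player 2 blocks all keeping actions from
  -- entering `X`. If every action admitted an entry, finitely many levels would have a common bound
  -- and the state would lie in the next level.
  have hout : ∀ s, ∃ b ∈ G.avail₂ s, s ∈ G.winSet → s ∉ X →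
      ∀ a, G.Keeps G.winSet s a → ∀ q ∈ X, G.trans s a b q = 0 := by
    intro s
    by_contra! hcon
    obtain ⟨b₀, hb₀⟩ := G.avail₂_nonempty s
    obtain ⟨hsW, hsX, -⟩ := hcon b₀ hb₀
    refine hsX ?_
    have : ∀ᶠ i in Filter.atTop, ∀ b, b ∈ G.avail₂ s → ∃ a, G.Keeps G.winSet s a ∧
        ∃ q ∈ G.attractor G.winSet G.win i, G.trans s a b q ≠ 0 := by
      rw [Filter.eventually_all]
      intro b
      by_cases hb : b ∈ G.avail₂ s
      · obtain ⟨-, -, a, ha, q, ⟨i, hi⟩, hq⟩ := hcon b hb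
        filter_upwards [Filter.eventually_ge_atTop i] with j hj _
        exact ⟨a, ha, q, G.attractor_mono _ _ hj hi, hq⟩
      · exact Filter.Eventually.of_forall fun _ h => absurd h hb
    obtain ⟨i, hi⟩ := this.exists
    exact ⟨i + 1, Or.inr ⟨hsW, hi⟩⟩
  choose f hf hfX using hout
  set σ : StationaryPolicy G.avail₂ := StationaryPolicy.ofFun f hf with hσ
  -- A winning policy uses keeping actions only, so against the blocking policy `σ` it never enters
  -- `X` and never wins, which is absurd.
  have hone : ∀ N, ∀ s ∈ G.winSet, s ∉ X → ∀ π₁, G.WinsFrom s π₁ →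
      G.avoidProb G.win N π₁ (σ.toPolicy A₁ A₂) s = 1 := by
    intro N
    induction N with
    | zero => exact fun s hs hsX π₁ _ => avoidProb_zero G _ _ fun hw => hsX ⟨0, hw⟩
    | succ N ih =>
      intro s hs hsX π₁ hπ₁
      have hsw : s ∉ G.win := fun hw => hsX ⟨0, hw⟩
      rw [avoidProb_succ G _ _ _ hsw, ← G.expNext_const s (π₁.act [] s)
        ((σ.toPolicy A₁ A₂).act [] s) 1]
      refine expNext_congr _ _ _ _ fun a b q ha hb hq => ?_
      obtain rfl : b = f s := by
        simpa [StationaryPolicy.toPolicy, hσ, StationaryPolicy.ofFun] using hb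
      have hw := G.winsFrom_shift hπ₁ ha (hf s) hq
      exact ih q ⟨_, hw⟩ (fun hqX => hq (hfX s hs hsX a
        (G.keeps_winSet_of_winsFrom hπ₁ ha) q hqX)) _ hw
  intro s hs
  by_contra hsX
  obtain ⟨π₁, hπ₁⟩ := hs
  have h1 := G.tendsto_avoidProb G.win π₁ (σ.toPolicy A₁ A₂) s
  simp only [hone _ s ⟨π₁, hπ₁⟩ hsX π₁ hπ₁] at h1
  have h2 := (G.winsFrom_iff s π₁).1 hπ₁ (σ.toPolicy A₁ A₂)
  rw [h2] at h1
  exact one_ne_zero (tendsto_nhds_unique tendsto_const_nhds h1)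

omit [Fintype S] [Fintype A₁] [Fintype A₂] in
lemma exists_mem_attractor_mono (G : ICGame S A₁ A₂) {Y Y' C : Set S} (h : Y ⊆ Y') {s : S} :
    ∀ i, s ∈ G.attractor Y C i → s ∈ G.attractor Y' C i := by
  intro i
  induction i generalizing s with
  | zero => exact id
  | succ i ih =>
    rintro (hs | ⟨hs, hs'⟩)
    · exact Or.inl (ih hs)
    · refine Or.inr ⟨h hs, fun b hb => ?_⟩
      obtain ⟨a, ⟨ha, ha'⟩, q, hq, hne⟩ := hs' b hb
      exact ⟨a, ⟨ha, fun b hb q hq => ha' b hb q fun hqY => hq (h hqY)⟩, q, ih hq, hne⟩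

/-- A stationary policy that uses exactly the actions that keep the state in the winning region
wins from the winning region. -/
theorem winsFrom_of_keeps (G : ICGame S A₁ A₂) {μ : StationaryPolicy G.avail₁}
    (hμ : ∀ s ∈ G.winSet, s ∉ G.win → ∀ a, μ.dist s a ≠ 0 ↔ G.Keeps G.winSet s a) {s : S}
    (hs : s ∈ G.winSet) : G.WinsFrom s (μ.toPolicy A₁ A₂) :=
  (G.winsFrom_iff _ _).2 fun π₂ =>
    G.avoidForever_eq_zero_of_subset_attractor G.winSet_subset_attractor hμ s hs π₂

/-- A set that is contained in the attractor of the target is contained in the winning region. -/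
theorem subset_winSet_of_subset_attractor (G : ICGame S A₁ A₂) {Y : Set S}
    (hY : ∀ s ∈ Y, ∃ i, s ∈ G.attractor Y G.win i) : Y ⊆ G.winSet := by
  classical
  have hne : ∀ s ∈ Y, s ∉ G.win → ∃ a, G.Keeps Y s a := by
    intro s hs hw
    obtain ⟨i, hi⟩ := hY s hs
    induction i with
    | zero => exact absurd hi hw
    | succ i ih =>
      rcases hi with hi | ⟨-, hi⟩
      · exact ih hi
      · obtain ⟨b, hb⟩ := G.avail₂_nonempty s
        obtain ⟨a, ha, -⟩ := hi b hb
        exact ⟨a, ha⟩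
  have hacts : ∀ s, ∃ p : PMF A₁, p.support ⊆ ↑(G.avail₁ s) ∧
      (s ∈ Y → s ∉ G.win → ∀ a, p a ≠ 0 ↔ G.Keeps Y s a) := by
    intro s
    by_cases hs : s ∈ Y ∧ s ∉ G.win
    · obtain ⟨a₀, ha₀⟩ := hne s hs.1 hs.2
      have hnonempty : (Finset.univ.filter fun a => G.Keeps Y s a).Nonempty :=
        ⟨a₀, Finset.mem_filter.2 ⟨Finset.mem_univ _, ha₀⟩⟩
      refine ⟨PMF.uniformOfFinset _ hnonempty, ?_, fun _ _ a => ?_⟩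
      · intro a ha
        rw [PMF.support_uniformOfFinset] at ha
        exact ((Finset.mem_filter.1 (Finset.mem_coe.1 ha)).2).1
      · rw [← PMF.mem_support_iff, PMF.mem_support_uniformOfFinset_iff]
        simp
    · exact ⟨G.average.dist s, G.average.dist_avail s, fun h1 h2 => absurd ⟨h1, h2⟩ hs⟩
  choose p hp hpY using hacts
  intro s hs
  exact ⟨(StationaryPolicy.mk p hp).toPolicy A₁ A₂, (G.winsFrom_iff _ _).2 fun π₂ =>
    G.avoidForever_eq_zero_of_subset_attractor hY (μ := StationaryPolicy.mk p hp)
      (fun s hs hw a => hpY s hs hw a) s hs π₂⟩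

omit [Fintype S] [Fintype A₁] [Fintype A₂] in
lemma average_ne_zero {G : ICGame S A₁ A₂} (hG : G.FullSupport) {π₁ : G.Policy₁}
    {h : List (Step S A₁ A₂)} {s : S} {a : A₁} (ha : π₁.act h s a ≠ 0) :
    G.average.dist s a ≠ 0 := hG s a (act_mem_avail π₁ ha)

/-- If the average player surely avoids `E` up to time `N`, every policy does. -/
lemma avoidProb_eq_one_of_average {G : ICGame S A₁ A₂} (hG : G.FullSupport) (E : Set S) (N : ℕ) :
    ∀ (π₁ : G.Policy₁) (π₂ : G.Policy₂) (s : S), G.avoidProb E N G.averagePolicy π₂ s = 1 →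
      G.avoidProb E N π₁ π₂ s = 1 := by
  induction N with
  | zero =>
    intro π₁ π₂ s h
    by_cases hs : s ∈ E
    · rw [avoidProb_of_mem G _ _ _ hs] at h
      exact absurd h zero_ne_one
    · exact avoidProb_zero G _ _ hs
  | succ N ih =>
    intro π₁ π₂ s h
    by_cases hs : s ∈ E
    · rw [avoidProb_of_mem G _ _ _ hs] at h
      exact absurd h zero_ne_one
    rw [avoidProb_succ G _ _ _ hs] at h ⊢
    rw [← G.expNext_const s (π₁.act [] s) (π₂.act [] s) 1]
    refine expNext_congr _ _ _ _ fun a b q ha hb hq => ih _ _ _ ?_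
    -- `eq_of_expNext_eq` is about functions bounded below; the sign change adapts it to the upper
    -- bound 1.
    have hneg := G.expNext_mul_const s (G.averagePolicy.act [] s) (π₂.act [] s)
      (fun a b q => G.avoidProb E N (G.averagePolicy.shift ⟨s, a, b⟩) (π₂.shift ⟨s, a, b⟩) q) (-1)
    rw [h] at hneg
    have := G.eq_of_expNext_eq (c := -1) (F := fun a b q => G.avoidProb E N
      (G.averagePolicy.shift ⟨s, a, b⟩) (π₂.shift ⟨s, a, b⟩) q * -1) (fun a b q => by
      have := G.avoidProb_le_one E N (G.averagePolicy.shift ⟨s, a, b⟩) (π₂.shift ⟨s, a, b⟩) q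
      linarith) (by
        rw [one_mul] at hneg
        exact hneg.le) (average_ne_zero hG ha) hb hq
    change G.avoidProb E N (G.averagePolicy.shift ⟨s, a, b⟩) (π₂.shift ⟨s, a, b⟩) q = 1
    linarith

/-- The average player has positive probability of taking every available action. If some policy of
Player 2 surely prevents that player from winning, it prevents every policy from winning. -/
lemma notMem_trap_of_mem_winSet {G : ICGame S A₁ A₂} (hG : G.FullSupport) {s : S}
    (hs : s ∈ G.winSet) : s ∉ G.trap := by
  rintro ⟨π₂, hπ₂⟩
  obtain ⟨π₁, hπ₁⟩ := hs
  rw [runLaw_reach_eq_zero_iff] at hπ₂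
  have h1 : ∀ N, G.avoidProb G.win N π₁ π₂ s = 1 := fun N =>
    avoidProb_eq_one_of_average hG _ _ _ _ _ (le_antisymm (G.avoidProb_le_one _ _ _ _ _)
      (hπ₂ ▸ G.avoidForever_le_avoidProb _ _ _ _ _))
  have h2 := G.tendsto_avoidProb G.win π₁ π₂ s
  simp only [h1, (G.winsFrom_iff s π₁).1 hπ₁ π₂] at h2
  exact one_ne_zero (tendsto_nhds_unique tendsto_const_nhds h2)

/-- When all available actions are permissible, a winning policy avoids the trap states, so that
all winning states are potentially winning. -/
theorem potential_eq_winSet {G : ICGame S A₁ A₂} (hG : G.FullSupport) :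
    G.potential = G.winSet := by
  refine Set.Subset.antisymm (fun s ⟨π₁, h, _⟩ => ⟨π₁, h⟩) ?_
  rintro s ⟨π₁, hπ₁⟩
  refine ⟨π₁, hπ₁, fun π₂ => ?_⟩
  have hone : ∀ N, ∀ s π₁ π₂, G.WinsFrom s π₁ → G.avoidProb G.trap N π₁ π₂ s = 1 := by
    intro N
    induction N with
    | zero => exact fun s π₁ π₂ h => avoidProb_zero G _ _ (notMem_trap_of_mem_winSet hG ⟨π₁, h⟩)
    | succ N ih =>
      intro s π₁ π₂ h
      rw [avoidProb_succ G _ _ _ (notMem_trap_of_mem_winSet hG ⟨π₁, h⟩),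
        ← G.expNext_const s (π₁.act [] s) (π₂.act [] s) 1]
      exact expNext_congr _ _ _ _ fun a b q ha hb hq =>
        ih _ _ _ (G.winsFrom_shift h ha (act_mem_avail π₂ hb) hq)
  rw [runLaw_reach_eq_zero_iff]
  have h2 := G.tendsto_avoidProb G.trap π₁ π₂ s
  simp only [hone _ s π₁ π₂ hπ₁] at h2
  exact (tendsto_nhds_unique tendsto_const_nhds h2).symm

/-! ### Ending the game early -/

lemma avoidProb_withEnd (G : ICGame S A₁ A₂) (E : Set S) (N : ℕ) :
    ∀ (π₁ : G.Policy₁) (π₂ : G.Policy₂) (s : S),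
      (G.withEnd E).avoidProb E N π₁ π₂ s = G.avoidProb E N π₁ π₂ s := by
  induction N with
  | zero =>
    intro π₁ π₂ s
    by_cases hs : s ∈ E
    · rw [avoidProb_of_mem _ _ _ _ hs, avoidProb_of_mem _ _ _ _ hs]
    · rw [avoidProb_zero _ _ _ hs, avoidProb_zero _ _ _ hs]
  | succ N ih =>
    intro π₁ π₂ s
    by_cases hs : s ∈ E
    · rw [avoidProb_of_mem _ _ _ _ hs, avoidProb_of_mem _ _ _ _ hs]
    · rw [avoidProb_succ _ _ _ _ hs, avoidProb_succ _ _ _ _ hs]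
      simp only [expNext, if_neg hs, ih]

lemma avoidForever_withEnd (G : ICGame S A₁ A₂) (E : Set S) (π₁ : G.Policy₁) (π₂ : G.Policy₂)
    (s : S) : (G.withEnd E).avoidForever E π₁ π₂ s = G.avoidForever E π₁ π₂ s := by
  have h1 := (G.withEnd E).tendsto_avoidProb E π₁ π₂ s
  simp only [avoidProb_withEnd] at h1
  exact tendsto_nhds_unique h1 (G.tendsto_avoidProb E π₁ π₂ s)

lemma winsFrom_withEnd_iff (G : ICGame S A₁ A₂) (E : Set S) (s : S) (π₁ : G.Policy₁) :
    (G.withEnd E).WinsFrom s π₁ ↔ ∀ π₂ : G.Policy₂, G.avoidForever E π₁ π₂ s = 0 := by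
  rw [winsFrom_iff]
  refine forall_congr' fun π₂ => ?_
  change (G.withEnd E).avoidForever E π₁ π₂ s = 0 ↔ _
  rw [avoidForever_withEnd]

omit [Fintype S] [Fintype A₁] [Fintype A₂] in
lemma FullSupport.withEnd {G : ICGame S A₁ A₂} (hG : G.FullSupport) (E : Set S) :
    (G.withEnd E).FullSupport := hG

/-- Ending the game at winning states does not change the winning region. -/
theorem winSet_withEnd (G : ICGame S A₁ A₂) {E : Set S} (hE : E ⊆ G.winSet) (hw : G.win ⊆ E) :
    (G.withEnd E).winSet = G.winSet := by
  have hsub : G.winSet ⊆ (G.withEnd E).winSet := by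
    rintro s ⟨π₁, hπ₁⟩
    refine ⟨π₁, (G.winsFrom_withEnd_iff E s π₁).2 fun π₂ => ?_⟩
    refine le_antisymm ?_ (G.avoidForever_nonneg _ _ _ _)
    rw [← (G.winsFrom_iff s π₁).1 hπ₁ π₂]
    exact G.avoidForever_mono_set hw _ _ _
  -- A state that wins the shortened game climbs down the attractor of `E`, where the attractor of
  -- the original target takes over since `E` is in the winning region. Hence the larger region lies
  -- in the attractor of `G.win` and is winning in `G`.
  refine Set.Subset.antisymm (G.subset_winSet_of_subset_attractor fun s hs => ?_) hsub
  have hwin : ∀ s ∈ G.winSet, ∃ i, s ∈ G.attractor (G.withEnd E).winSet G.win i := by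
    intro s hs
    obtain ⟨i, hi⟩ := G.winSet_subset_attractor s hs
    exact ⟨i, G.exists_mem_attractor_mono hsub i hi⟩
  obtain ⟨i, hi⟩ := (G.withEnd E).winSet_subset_attractor s hs
  induction i generalizing s with
  | zero => exact hwin s (hE hi)
  | succ i ih =>
    by_cases hsE : s ∈ E
    · exact hwin s (hE hsE)
    rcases hi with hi | ⟨-, hi⟩
    · exact ih s hs hi
    have : ∀ᶠ j in Filter.atTop, ∀ b, b ∈ G.avail₂ s → ∃ a,
        G.Keeps (G.withEnd E).winSet s a ∧
        ∃ q ∈ G.attractor (G.withEnd E).winSet G.win j, G.trans s a b q ≠ 0 := by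
      rw [Filter.eventually_all]
      intro b
      by_cases hb : b ∈ G.avail₂ s
      · obtain ⟨a, ha, q, hqi, hq⟩ := hi b hb
        obtain ⟨j, hj⟩ := ih q (ha.mem hb hq) hqi
        filter_upwards [Filter.eventually_ge_atTop j] with k hk _
        refine ⟨a, ⟨ha.1, fun b hb q hq => ?_⟩, q, G.attractor_mono _ _ hk hj, ?_⟩
        · simpa [if_neg hsE] using ha.2 b hb q hq
        · simpa [if_neg hsE] using hq
      · exact Filter.Eventually.of_forall fun _ h => absurd h hb
    obtain ⟨j, hj⟩ := this.exists
    exact ⟨j + 1, Or.inr ⟨hs, hj⟩⟩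

end ICGame
end

/-! ### Gibbs' inequality, expected times and stopped divergences -/

noncomputable section

/-- Gibbs' variational inequality. -/
lemma neg_log_sum_le_sum_mul_log {A : Type*} [Fintype A] (p : PMF A) {u : A → ℝ}
    (hu : ∀ a, 0 ≤ u a) (h : ∀ a, p a ≠ 0 → 0 < u a) :
    -Real.log (∑ a, u a) ≤ ∑ a, (p a).toReal * Real.log ((p a).toReal / u a) := by
  obtain ⟨a₀, ha₀⟩ := p.support_nonempty
  have hZ : 0 < ∑ a, u a := Finset.sum_pos' (fun a _ => hu a)
    ⟨a₀, Finset.mem_univ _, h a₀ ((PMF.mem_support_iff _ _).1 ha₀)⟩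
  -- This is log x ≤ x - 1 at the ratio of the normalized weight to `p a`; the correction terms sum
  -- to 1 - 1 = 0.
  have key : ∀ a, (p a).toReal * (-Real.log (∑ a, u a)) + ((p a).toReal - u a / ∑ a, u a) ≤
      (p a).toReal * Real.log ((p a).toReal / u a) := by
    intro a
    by_cases hp : p a = 0
    · simp only [hp, ENNReal.toReal_zero, zero_mul, zero_sub, zero_add]
      exact neg_nonpos.2 (div_nonneg (hu a) hZ.le)
    have hp' : 0 < (p a).toReal := ENNReal.toReal_pos hp (PMF.apply_ne_top _ _)
    have hu' := h a hp
    have h1 := Real.log_le_sub_one_of_pos (div_pos (div_pos hu' hZ) hp')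
    rw [Real.log_div (div_pos hu' hZ).ne' hp'.ne', Real.log_div hu'.ne' hZ.ne'] at h1
    rw [Real.log_div hp'.ne' hu'.ne']
    have h2 := mul_le_mul_of_nonneg_left h1 hp'.le
    rw [mul_sub, mul_sub, mul_sub, mul_div_cancel₀ _ hp'.ne'] at h2
    rw [mul_sub]
    linarith
  have hs := Finset.sum_le_sum fun a (_ : a ∈ Finset.univ) => key a
  rw [Finset.sum_add_distrib, Finset.sum_sub_distrib, ← Finset.sum_mul, ← Finset.sum_div,
    ICGame.sum_pmf_toReal, div_self hZ.ne'] at hs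
  linarith

/-- Equality in Gibbs' variational inequality is attained. -/
lemma exists_pmf_sum_mul_log_eq {A : Type*} [Fintype A] {u : A → ℝ}
    (hu : ∀ a, 0 ≤ u a) (hZ : 0 < ∑ a, u a) :
    ∃ p : PMF A, (∀ a, p a ≠ 0 ↔ 0 < u a) ∧
      ∑ a, (p a).toReal * Real.log ((p a).toReal / u a) = -Real.log (∑ a, u a) := by
  have hsum : ∑ a, ENNReal.ofReal (u a / ∑ a, u a) = 1 := by
    rw [← ENNReal.ofReal_sum_of_nonneg fun a _ => div_nonneg (hu a) hZ.le, ← Finset.sum_div,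
      div_self hZ.ne', ENNReal.ofReal_one]
  refine ⟨PMF.ofFintype _ hsum, fun a => ?_, ?_⟩
  · rw [PMF.ofFintype_apply, ← pos_iff_ne_zero, ENNReal.ofReal_pos]
    exact ⟨fun h => by
      by_contra h0
      rw [le_antisymm (not_lt.1 h0) (hu a), zero_div] at h
      exact lt_irrefl _ h, fun h => div_pos h hZ⟩
  · have : ∀ a, (PMF.ofFintype _ hsum a).toReal *
        Real.log ((PMF.ofFintype _ hsum a).toReal / u a) =
          u a / (∑ a, u a) * (-Real.log (∑ a, u a)) := by
      intro a
      rw [PMF.ofFintype_apply, ENNReal.toReal_ofReal (div_nonneg (hu a) hZ.le)]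
      rcases (hu a).eq_or_lt with h | h
      · simp [← h]
      · rw [div_div, mul_comm (∑ a, u a), ← div_div, div_self h.ne', one_div, Real.log_inv]
    rw [Finset.sum_congr rfl fun a _ => this a, ← Finset.sum_mul, ← Finset.sum_div,
      div_self hZ.ne', one_mul]

namespace ICGame

variable {S A₁ A₂ : Type*} [Fintype S] [Fintype A₁] [Fintype A₂]

omit [Fintype S] [Fintype A₂] in
lemma stepCost_nonneg {G : ICGame S A₁ A₂} (hG : G.FullSupport) {s : S} {p : PMF A₁}
    (hp : p.support ⊆ ↑(G.avail₁ s)) : 0 ≤ G.stepCost s p := by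
  have := neg_log_sum_le_sum_mul_log p (u := fun a => (G.average.dist s a).toReal)
    (fun a => ENNReal.toReal_nonneg) (fun a ha => ENNReal.toReal_pos
      (hG s a (hp ((PMF.mem_support_iff _ _).2 ha))) (PMF.apply_ne_top _ _))
  rw [sum_pmf_toReal, Real.log_one, neg_zero] at this
  exact this

omit [Fintype S] [Fintype A₂] in
@[simp] lemma stepCost_average (G : ICGame S A₁ A₂) (s : S) :
    G.stepCost s (G.average.dist s) = 0 := by
  refine Finset.sum_eq_zero fun a _ => ?_
  by_cases h : (G.average.dist s a).toReal = 0
  · simp [h]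
  · simp [div_self h]

lemma expNext_nonneg (G : ICGame S A₁ A₂) {s : S} {p : PMF A₁} {σ : PMF A₂}
    {F : A₁ → A₂ → S → ℝ}
    (h : ∀ a b q, p a ≠ 0 → σ b ≠ 0 → G.trans s a b q ≠ 0 → 0 ≤ F a b q) :
    0 ≤ G.expNext s p σ F := by
  rw [← G.expNext_const s p σ 0]
  exact G.expNext_mono s p σ h

lemma klSum_nonneg {G : ICGame S A₁ A₂} (hG : G.FullSupport) (N : ℕ) :
    ∀ (π₁ : G.Policy₁) (π₂ : G.Policy₂) (s : S), 0 ≤ G.klSum N π₁ π₂ s := by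
  induction N with
  | zero => intro π₁ π₂ s; exact le_rfl
  | succ N ih =>
    intro π₁ π₂ s
    exact add_nonneg (stepCost_nonneg hG (π₁.act_avail _ _))
      (G.expNext_nonneg fun a b q _ _ _ => ih _ _ _)

lemma klSum_mono {G : ICGame S A₁ A₂} (hG : G.FullSupport) (π₁ : G.Policy₁) (π₂ : G.Policy₂)
    (s : S) : Monotone fun N => G.klSum N π₁ π₂ s := by
  refine monotone_nat_of_le_succ fun N => ?_
  induction N generalizing π₁ π₂ s with
  | zero => exact klSum_nonneg hG _ _ _ _
  | succ N ih =>
    simp only [klSum] at ih ⊢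
    exact add_le_add le_rfl (G.expNext_mono _ _ _ fun a b q _ _ _ => ih _ _ _)

/-- The expected number of the first `N` stages before `E` is reached. -/
def timeSum (G : ICGame S A₁ A₂) (E : Set S) (N : ℕ) (π₁ : G.Policy₁) (π₂ : G.Policy₂)
    (s : S) : ℝ := ∑ k ∈ Finset.range N, G.avoidProb E k π₁ π₂ s

lemma timeSum_of_mem (G : ICGame S A₁ A₂) {E : Set S} (N : ℕ) (π₁ : G.Policy₁)
    (π₂ : G.Policy₂) {s : S} (hs : s ∈ E) : G.timeSum E N π₁ π₂ s = 0 :=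
  Finset.sum_eq_zero fun k _ => G.avoidProb_of_mem k π₁ π₂ hs

lemma expNext_sum (G : ICGame S A₁ A₂) (s : S) (p : PMF A₁) (σ : PMF A₂) {ι : Type*}
    (I : Finset ι) (F : ι → A₁ → A₂ → S → ℝ) :
    G.expNext s p σ (fun a b q => ∑ i ∈ I, F i a b q) = ∑ i ∈ I, G.expNext s p σ (F i) := by
  classical
  induction I using Finset.induction_on with
  | empty => simpa using G.expNext_const s p σ 0
  | insert i I hi ih =>
    simp only [Finset.sum_insert hi]
    rw [← ih, ← expNext_add]

lemma timeSum_succ (G : ICGame S A₁ A₂) {E : Set S} (N : ℕ) (π₁ : G.Policy₁)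
    (π₂ : G.Policy₂) {s : S} (hs : s ∉ E) : G.timeSum E (N + 1) π₁ π₂ s =
      1 + G.expNext s (π₁.act [] s) (π₂.act [] s) fun a b q =>
        G.timeSum E N (π₁.shift ⟨s, a, b⟩) (π₂.shift ⟨s, a, b⟩) q := by
  simp only [timeSum]
  rw [Finset.sum_range_succ', avoidProb_zero _ _ _ hs, expNext_sum, add_comm]
  simp only [avoidProb_succ _ _ _ _ hs]

lemma timeSum_mono (G : ICGame S A₁ A₂) (E : Set S) (π₁ : G.Policy₁) (π₂ : G.Policy₂) (s : S) :
    Monotone fun N => G.timeSum E N π₁ π₂ s := fun _ _ h =>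
  Finset.sum_le_sum_of_subset_of_nonneg (Finset.range_mono h)
    fun _ _ _ => G.avoidProb_nonneg _ _ _ _ _

lemma timeSum_nonneg (G : ICGame S A₁ A₂) (E : Set S) (N : ℕ) (π₁ : G.Policy₁) (π₂ : G.Policy₂)
    (s : S) : 0 ≤ G.timeSum E N π₁ π₂ s :=
  Finset.sum_nonneg fun _ _ => G.avoidProb_nonneg _ _ _ _ _

/-- A set that the stationary policies `μ`, `σ` do not leave before reaching `E`. -/
def ClosedUntil (G : ICGame S A₁ A₂) (Y E : Set S) (μ : StationaryPolicy G.avail₁)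
    (σ : StationaryPolicy G.avail₂) : Prop :=
  ∀ s ∈ Y, s ∉ E → ∀ a b q, μ.dist s a ≠ 0 → σ.dist s b ≠ 0 → G.trans s a b q ≠ 0 → q ∈ Y

/-- A contraction bounds the expected time. -/
theorem timeSum_le_of_avoidProb_le (G : ICGame S A₁ A₂) {Y E : Set S}
    {μ : StationaryPolicy G.avail₁} {σ : StationaryPolicy G.avail₂} (hY : G.ClosedUntil Y E μ σ)
    {L : ℕ} {β : ℝ} (hβ : β < 1)
    (h : ∀ s ∈ Y, G.avoidProb E L (μ.toPolicy A₁ A₂) (σ.toPolicy A₁ A₂) s ≤ β)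
    (M : ℕ) : ∀ s ∈ Y, G.timeSum E M (μ.toPolicy A₁ A₂) (σ.toPolicy A₁ A₂) s ≤ L / (1 - β) := by
  intro s₁ hs₁
  obtain ⟨s₀, hs₀, hmax⟩ := Set.exists_max_image Y
    (fun s => G.timeSum E M (μ.toPolicy A₁ A₂) (σ.toPolicy A₁ A₂) s) (Set.toFinite Y) ⟨s₁, hs₁⟩
  set Θ := G.timeSum E M (μ.toPolicy A₁ A₂) (σ.toPolicy A₁ A₂) s₀ with hΘ
  have hΘ0 : 0 ≤ Θ := G.timeSum_nonneg _ _ _ _ _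
  -- Spend at most `j` stages, and if `E` has not been reached by then, at most the maximal expected
  -- time `Θ` afterwards. At the maximizing state, `j = L` gives Θ ≤ L + β Θ.
  have key : ∀ j N, N ≤ M → ∀ s ∈ Y, G.timeSum E N (μ.toPolicy A₁ A₂) (σ.toPolicy A₁ A₂) s ≤
      j + G.avoidProb E j (μ.toPolicy A₁ A₂) (σ.toPolicy A₁ A₂) s * Θ := by
    intro j
    induction j with
    | zero =>
      intro N hN s hs
      by_cases hE : s ∈ E
      · simp [timeSum_of_mem G _ _ _ hE, avoidProb_of_mem G _ _ _ hE]
      · rw [avoidProb_zero G _ _ hE]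
        simpa using (G.timeSum_mono E _ _ s hN).trans (hmax s hs)
    | succ j ih =>
      intro N hN s hs
      by_cases hE : s ∈ E
      · rw [timeSum_of_mem G _ _ _ hE, avoidProb_of_mem G _ _ _ hE]
        positivity
      cases N with
      | zero =>
        simp only [timeSum, Finset.range_zero, Finset.sum_empty]
        have := G.avoidProb_nonneg E (j + 1) (μ.toPolicy A₁ A₂) (σ.toPolicy A₁ A₂) s
        positivity
      | succ N =>
        rw [timeSum_succ G _ _ _ hE, avoidProb_succ G _ _ _ hE, ← expNext_mul_const]
        have h1 := G.expNext_add s ((μ.toPolicy A₁ A₂).act [] s) ((σ.toPolicy A₁ A₂).act [] s)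
          (fun _ _ _ => (j : ℝ)) (fun a b q => G.avoidProb E j ((μ.toPolicy A₁ A₂).shift ⟨s, a, b⟩)
            ((σ.toPolicy A₁ A₂).shift ⟨s, a, b⟩) q * Θ)
        rw [expNext_const] at h1
        push_cast
        rw [add_comm (j : ℝ) 1, add_assoc, ← h1]
        refine add_le_add le_rfl (G.expNext_mono _ _ _ fun a b q ha hb hq => ?_)
        exact ih N (by omega) q (hY s hs hE a b q ha hb hq)
  have h1 := key L M le_rfl s₀ hs₀
  have h2 := mul_le_mul_of_nonneg_right (h s₀ hs₀) hΘ0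
  refine (hmax s₁ hs₁).trans ?_
  rw [le_div_iff₀ (by linarith)]
  change Θ ≤ _ at h1
  linarith

/-- The expected sum of the first `N` stage divergences before `E` is reached. -/
def stopKl (G : ICGame S A₁ A₂) (E : Set S) (μ : StationaryPolicy G.avail₁)
    (σ : StationaryPolicy G.avail₂) : ℕ → S → ℝ
  | 0, _ => 0
  | N + 1, s => E.indicator 0 s + Eᶜ.indicator (fun s => G.stepCost s (μ.dist s) +
      G.expNext s (μ.dist s) (σ.dist s) fun _ _ q => G.stopKl E μ σ N q) s

lemma stopKl_of_mem (G : ICGame S A₁ A₂) {E : Set S} (μ : StationaryPolicy G.avail₁)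
    (σ : StationaryPolicy G.avail₂) (N : ℕ) {s : S} (hs : s ∈ E) : G.stopKl E μ σ N s = 0 := by
  cases N <;> simp [stopKl, hs]

lemma stopKl_succ (G : ICGame S A₁ A₂) {E : Set S} (μ : StationaryPolicy G.avail₁)
    (σ : StationaryPolicy G.avail₂) (N : ℕ) {s : S} (hs : s ∉ E) :
    G.stopKl E μ σ (N + 1) s = G.stepCost s (μ.dist s) +
      G.expNext s (μ.dist s) (σ.dist s) fun _ _ q => G.stopKl E μ σ N q := by
  simp [stopKl, hs]

lemma stopKl_nonneg {G : ICGame S A₁ A₂} (hG : G.FullSupport) (E : Set S)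
    (μ : StationaryPolicy G.avail₁) (σ : StationaryPolicy G.avail₂) (N : ℕ) (s : S) :
    0 ≤ G.stopKl E μ σ N s := by
  induction N generalizing s with
  | zero => exact le_rfl
  | succ N ih =>
    by_cases hs : s ∈ E
    · rw [stopKl_of_mem G _ _ _ hs]
    · rw [stopKl_succ G _ _ _ hs]
      exact add_nonneg (stepCost_nonneg hG (μ.dist_avail _)) (G.expNext_nonneg fun a b q _ _ _ => ih _)

lemma stopKl_mono {G : ICGame S A₁ A₂} (hG : G.FullSupport) (E : Set S)
    (μ : StationaryPolicy G.avail₁) (σ : StationaryPolicy G.avail₂) (s : S) :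
    Monotone fun N => G.stopKl E μ σ N s := by
  refine monotone_nat_of_le_succ fun N => ?_
  induction N generalizing s with
  | zero => exact stopKl_nonneg hG _ _ _ _ _
  | succ N ih =>
    by_cases hs : s ∈ E
    · rw [stopKl_of_mem G _ _ _ hs, stopKl_of_mem G _ _ _ hs]
    · rw [stopKl_succ G _ _ _ hs, stopKl_succ G _ _ _ hs]
      exact add_le_add le_rfl (G.expNext_mono _ _ _ fun a b q _ _ _ => ih _)

lemma stopKl_le_klSum {G : ICGame S A₁ A₂} (hG : G.FullSupport) (E : Set S)
    (μ : StationaryPolicy G.avail₁) (σ : StationaryPolicy G.avail₂) (N : ℕ) (s : S) :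
    G.stopKl E μ σ N s ≤ G.klSum N (μ.toPolicy A₁ A₂) (σ.toPolicy A₁ A₂) s := by
  induction N generalizing s with
  | zero => exact le_rfl
  | succ N ih =>
    by_cases hs : s ∈ E
    · rw [stopKl_of_mem G _ _ _ hs]
      exact klSum_nonneg hG _ _ _ _
    · rw [stopKl_succ G _ _ _ hs, klSum]
      exact add_le_add le_rfl (G.expNext_mono _ _ _ fun a b q _ _ _ => ih _)

/-- Nonnegative supersolutions, up to an error per stage, bound the divergence. -/
theorem stopKl_le_of_supersolution (G : ICGame S A₁ A₂) {Y E : Set S}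
    {μ : StationaryPolicy G.avail₁} {σ : StationaryPolicy G.avail₂} (hY : G.ClosedUntil Y E μ σ)
    {v : S → ℝ} {η : ℝ} (hv0 : ∀ s ∈ Y, 0 ≤ v s)
    (hv : ∀ s ∈ Y, s ∉ E → G.stepCost s (μ.dist s) +
      G.expNext s (μ.dist s) (σ.dist s) (fun _ _ q => v q) ≤ v s + η) (N : ℕ) :
    ∀ s ∈ Y, G.stopKl E μ σ N s ≤
      v s + η * G.timeSum E N (μ.toPolicy A₁ A₂) (σ.toPolicy A₁ A₂) s := by
  induction N with
  | zero => intro s hs; simpa [stopKl, timeSum] using hv0 s hs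
  | succ N ih =>
    intro s hs
    by_cases hE : s ∈ E
    · rw [stopKl_of_mem G _ _ _ hE, timeSum_of_mem G _ _ _ hE]
      simpa using hv0 s hs
    · rw [stopKl_succ G _ _ _ hE, timeSum_succ G _ _ _ hE]
      have h1 : G.expNext s (μ.dist s) (σ.dist s) (fun _ _ q => G.stopKl E μ σ N q) ≤
          G.expNext s (μ.dist s) (σ.dist s) (fun _ _ q => v q + G.timeSum E N (μ.toPolicy A₁ A₂)
            (σ.toPolicy A₁ A₂) q * η) :=
        G.expNext_mono _ _ _ fun a b q ha hb hq => by
          rw [mul_comm _ η]; exact ih q (hY s hs hE a b q ha hb hq)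
      rw [expNext_add G s _ _ (fun _ _ q => v q), expNext_mul_const] at h1
      have h2 := hv s hs hE
      change _ ≤ v s + η * (1 + G.expNext s (μ.dist s) (σ.dist s) fun a b q =>
        G.timeSum E N (μ.toPolicy A₁ A₂) (σ.toPolicy A₁ A₂) q)
      linarith

lemma stopKl_le_mul_timeSum (G : ICGame S A₁ A₂) {Y E : Set S}
    {μ : StationaryPolicy G.avail₁} {σ : StationaryPolicy G.avail₂} (hY : G.ClosedUntil Y E μ σ)
    {c : ℝ} (hc : ∀ s ∈ Y, s ∉ E → G.stepCost s (μ.dist s) ≤ c) (N : ℕ) :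
    ∀ s ∈ Y, G.stopKl E μ σ N s ≤
      c * G.timeSum E N (μ.toPolicy A₁ A₂) (σ.toPolicy A₁ A₂) s := by
  intro s hs
  simpa using G.stopKl_le_of_supersolution hY (v := 0) (fun _ _ => le_rfl)
    (fun s hs hE => by simpa [expNext] using hc s hs hE) N s hs

/-- If `μ` has no cost in the winning states, the divergence is the stopped one. -/
lemma klSum_eq_stopKl_win (G : ICGame S A₁ A₂) {μ : StationaryPolicy G.avail₁}
    (σ : StationaryPolicy G.avail₂) (hμ : ∀ s ∈ G.win, G.stepCost s (μ.dist s) = 0) (N : ℕ) :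
    ∀ s, G.klSum N (μ.toPolicy A₁ A₂) (σ.toPolicy A₁ A₂) s = G.stopKl G.win μ σ N s := by
  induction N with
  | zero => intro s; rfl
  | succ N ih =>
    intro s
    by_cases hs : s ∈ G.win
    · rw [stopKl_of_mem G _ _ _ hs, klSum]
      have h1 : G.stepCost s ((μ.toPolicy A₁ A₂).act [] s) = 0 := hμ s hs
      rw [h1, zero_add, ← G.expNext_const s ((μ.toPolicy A₁ A₂).act [] s)
        ((σ.toPolicy A₁ A₂).act [] s) 0]
      refine expNext_congr _ _ _ _ fun a b q ha hb hq => ?_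
      rw [G.win_absorbing s hs a (dist_mem_avail μ ha) b (dist_mem_avail σ hb)] at hq
      obtain rfl : q = s := by simpa using hq
      exact (ih q).trans (G.stopKl_of_mem _ _ _ hs)
    · rw [stopKl_succ G _ _ _ hs, klSum]
      congr 1
      exact expNext_congr _ _ _ _ fun a b q _ _ _ => ih q

lemma stopKl_empty (G : ICGame S A₁ A₂) (μ : StationaryPolicy G.avail₁)
    (σ : StationaryPolicy G.avail₂) (N : ℕ) :
    ∀ s, G.stopKl ∅ μ σ N s = G.klSum N (μ.toPolicy A₁ A₂) (σ.toPolicy A₁ A₂) s := by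
  induction N with
  | zero => intro s; rfl
  | succ N ih =>
    intro s
    rw [stopKl_succ G _ _ _ (Set.notMem_empty s), klSum]
    simp only [ih]
    rfl

lemma stopKl_withEnd (G : ICGame S A₁ A₂) (E : Set S) (μ : StationaryPolicy G.avail₁)
    (σ : StationaryPolicy G.avail₂) (N : ℕ) (s : S) :
    (G.withEnd E).stopKl E μ σ N s = G.stopKl E μ σ N s := by
  induction N generalizing s with
  | zero => rfl
  | succ N ih =>
    by_cases hs : s ∈ E
    · rw [stopKl_of_mem _ _ _ _ hs, stopKl_of_mem _ _ _ _ hs]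
    · rw [stopKl_succ _ _ _ _ hs, stopKl_succ _ _ _ _ hs]
      simp only [expNext, if_neg hs, ih]
      rfl

end ICGame
end

/-! ### Optimal stationary policies by dynamic programming -/

noncomputable section

namespace ICGame

variable {S A₁ A₂ : Type*} [Fintype S] [Fintype A₁] [Fintype A₂]

lemma exists_keeps_winSet (G : ICGame S A₁ A₂) {s : S} (hs : s ∈ G.winSet) :
    ∃ a, G.Keeps G.winSet s a := by
  obtain ⟨π₁, hπ₁⟩ := hs
  obtain ⟨a, ha⟩ := (π₁.act [] s).support_nonempty
  exact ⟨a, G.keeps_winSet_of_winsFrom hπ₁ ((PMF.mem_support_iff _ _).1 ha)⟩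

lemma mem_winSet_of_mem_win (G : ICGame S A₁ A₂) {s : S} (hs : s ∈ G.win) : s ∈ G.winSet :=
  ⟨G.averagePolicy, G.winsFrom_of_mem_win hs _⟩

lemma keeps_of_mem_win (G : ICGame S A₁ A₂) {s : S} (hs : s ∈ G.win) {a : A₁}
    (ha : a ∈ G.avail₁ s) : G.Keeps G.winSet s a := by
  refine ⟨ha, fun b hb q hq => ?_⟩
  rw [G.win_absorbing s hs a ha b hb, PMF.pure_apply, if_neg]
  rintro rfl
  exact hq (G.mem_winSet_of_mem_win hs)

/-- The policy that minimizes the divergence of the next stage plus the expectation of `v`, among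
the distributions on the actions that keep the state in the winning region. -/
lemma exists_softmin {G : ICGame S A₁ A₂} (hG : G.FullSupport) (σ : StationaryPolicy G.avail₂)
    (v : S → ℝ) : ∃ μ : StationaryPolicy G.avail₁, ∀ s ∈ G.winSet,
      (∀ a, μ.dist s a ≠ 0 ↔ G.Keeps G.winSet s a) ∧
      ∀ p : PMF A₁, (∀ a, p a ≠ 0 → G.Keeps G.winSet s a) →
        G.stepCost s (μ.dist s) + G.expNext s (μ.dist s) (σ.dist s) (fun _ _ q => v q) ≤
          G.stepCost s p + G.expNext s p (σ.dist s) (fun _ _ q => v q) := by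
  classical
  set Q : S → A₁ → ℝ := fun s a => ∑ b, ∑ q, (σ.dist s b).toReal * (G.trans s a b q).toReal * v q
    with hQ
  -- Tilting the average player's weights by `exp (-Q)` absorbs the expected next value into the
  -- reference measure, so the quantity to be minimized becomes a divergence from `u`. The minimizer
  -- is `u` normalized; it charges every keeping action and no other.
  set u : S → A₁ → ℝ := fun s a => if G.Keeps G.winSet s a then
    (G.average.dist s a).toReal * Real.exp (-Q s a) else 0 with hu
  have hu0 : ∀ s a, 0 ≤ u s a := by
    intro s a
    simp only [hu]
    split_ifs
    · positivity
    · exact le_rfl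
  have hupos : ∀ s a, 0 < u s a ↔ G.Keeps G.winSet s a := by
    intro s a
    simp only [hu]
    split_ifs with h
    · exact iff_of_true (mul_pos (ENNReal.toReal_pos (hG s a h.1) (PMF.apply_ne_top _ _))
        (Real.exp_pos _)) h
    · simp [h]
  have hcost : ∀ s (p : PMF A₁), (∀ a, p a ≠ 0 → G.Keeps G.winSet s a) →
      G.stepCost s p + G.expNext s p (σ.dist s) (fun _ _ q => v q) =
        ∑ a, (p a).toReal * Real.log ((p a).toReal / u s a) := by
    intro s p hp
    have h1 : G.expNext s p (σ.dist s) (fun _ _ q => v q) = ∑ a, (p a).toReal * Q s a := by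
      simp only [expNext, hQ, Finset.mul_sum, mul_assoc]
    rw [h1, stepCost, ← Finset.sum_add_distrib]
    refine Finset.sum_congr rfl fun a _ => ?_
    by_cases ha : p a = 0
    · simp [ha]
    have hk := hp a ha
    have hpa := ENNReal.toReal_pos ha (PMF.apply_ne_top _ _)
    have hav := ENNReal.toReal_pos (hG s a hk.1) (PMF.apply_ne_top _ _)
    simp only [hu, if_pos hk]
    rw [← mul_add, Real.log_div hpa.ne' hav.ne', Real.log_div hpa.ne' (by positivity),
      Real.log_mul hav.ne' (Real.exp_ne_zero _), Real.log_exp]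
    ring
  have hex : ∀ s, ∃ p : PMF A₁, p.support ⊆ ↑(G.avail₁ s) ∧ (s ∈ G.winSet →
      (∀ a, p a ≠ 0 ↔ G.Keeps G.winSet s a) ∧
      ∑ a, (p a).toReal * Real.log ((p a).toReal / u s a) = -Real.log (∑ a, u s a)) := by
    intro s
    by_cases hs : s ∈ G.winSet
    · obtain ⟨a₀, ha₀⟩ := G.exists_keeps_winSet hs
      obtain ⟨p, hp, hp'⟩ := exists_pmf_sum_mul_log_eq (hu0 s) (Finset.sum_pos'
        (fun a _ => hu0 s a) ⟨a₀, Finset.mem_univ _, (hupos s a₀).2 ha₀⟩)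
      refine ⟨p, fun a ha => ((hupos s a).1 ((hp a).1 ((PMF.mem_support_iff _ _).1 ha))).1,
        fun _ => ⟨fun a => (hp a).trans (hupos s a), hp'⟩⟩
    · exact ⟨G.average.dist s, G.average.dist_avail s, fun h => absurd h hs⟩
  choose p hp hp' using hex
  refine ⟨⟨p, hp⟩, fun s hs => ⟨(hp' s hs).1, fun p' hp'' => ?_⟩⟩
  change G.stepCost s (p s) + G.expNext s (p s) (σ.dist s) (fun _ _ q => v q) ≤ _
  rw [hcost s (p s) fun a => ((hp' s hs).1 a).1, (hp' s hs).2, hcost s p' hp'']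
  exact neg_log_sum_le_sum_mul_log p' (hu0 s) fun a ha => (hupos s a).2 (hp'' a ha)

omit [Fintype S] [Fintype A₁] [Fintype A₂] in
lemma closedUntil_of_keeps (G : ICGame S A₁ A₂) {Y E : Set S} {μ : StationaryPolicy G.avail₁}
    (σ : StationaryPolicy G.avail₂)
    (h : ∀ s ∈ Y, s ∉ E → ∀ a, μ.dist s a ≠ 0 → G.Keeps Y s a) : G.ClosedUntil Y E μ σ :=
  fun s hs hE a _ _ ha hb hq => (h s hs hE a ha).mem (dist_mem_avail σ hb) hq

/-- Stationary policies that reach `E` almost surely do so in finite expected time. -/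
lemma exists_timeSum_le (G : ICGame S A₁ A₂) {Y E : Set S}
    {μ : StationaryPolicy G.avail₁} {σ : StationaryPolicy G.avail₂} (hY : G.ClosedUntil Y E μ σ)
    (h : ∀ s ∈ Y, G.avoidForever E (μ.toPolicy A₁ A₂) (σ.toPolicy A₁ A₂) s = 0) :
    ∃ c : ℝ, ∀ N, ∀ s ∈ Y, G.timeSum E N (μ.toPolicy A₁ A₂) (σ.toPolicy A₁ A₂) s ≤ c := by
  have : ∀ᶠ L in Filter.atTop, ∀ s, s ∈ Y →
      G.avoidProb E L (μ.toPolicy A₁ A₂) (σ.toPolicy A₁ A₂) s ≤ 1 / 2 := by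
    rw [Filter.eventually_all]
    intro s
    by_cases hs : s ∈ Y
    · have := G.tendsto_avoidProb E (μ.toPolicy A₁ A₂) (σ.toPolicy A₁ A₂) s
      rw [h s hs] at this
      filter_upwards [this.eventually (eventually_le_nhds (by norm_num : (0 : ℝ) < 1 / 2))]
        with L hL _ using hL
    · exact Filter.Eventually.of_forall fun _ h => absurd h hs
  obtain ⟨L, hL⟩ := this.exists
  exact ⟨_, fun N s hs => G.timeSum_le_of_avoidProb_le hY (by norm_num) hL N s hs⟩

/-- The policy charges all keeping actions, so it wins, and against a stationary policy it does so
in finite expected time. Its stage costs are bounded and vanish in the winning states. This makes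
`optValue` finite on the winning region. -/
lemma exists_stationary_klFrom_ne_top {G : ICGame S A₁ A₂} (hG : G.FullSupport)
    (σ : StationaryPolicy G.avail₂) : ∃ μ : StationaryPolicy G.avail₁, ∀ s ∈ G.winSet,
      G.WinsFrom s (μ.toPolicy A₁ A₂) ∧
        G.klFrom s (μ.toPolicy A₁ A₂) (σ.toPolicy A₁ A₂) ≠ ∞ := by
  obtain ⟨μ, hμ⟩ := exists_softmin hG σ 0
  have hwins : ∀ s ∈ G.winSet, G.WinsFrom s (μ.toPolicy A₁ A₂) := fun s hs =>
    G.winsFrom_of_keeps (fun s hs _ => (hμ s hs).1) hs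
  refine ⟨μ, fun s hs => ⟨hwins s hs, ?_⟩⟩
  have hwin : ∀ s ∈ G.win, G.stepCost s (μ.dist s) = 0 := by
    intro s hs
    refine le_antisymm ?_ (stepCost_nonneg hG (μ.dist_avail s))
    have := (hμ s (G.mem_winSet_of_mem_win hs)).2 (G.average.dist s) fun a ha =>
      G.keeps_of_mem_win hs (dist_mem_avail _ ha)
    simpa [expNext_const] using this
  have hcl : G.ClosedUntil G.winSet G.win μ σ :=
    G.closedUntil_of_keeps σ fun s hs _ a => ((hμ s hs).1 a).1
  obtain ⟨c, hc⟩ := G.exists_timeSum_le hcl fun s hs => (G.winsFrom_iff _ _).1 (hwins s hs) _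
  obtain ⟨C, hC⟩ := Finite.exists_le fun s => |G.stepCost s (μ.dist s)|
  have hC0 : 0 ≤ C := (abs_nonneg _).trans (hC s)
  refine ne_top_of_le_ne_top (b := ENNReal.ofReal (C * c)) ENNReal.ofReal_ne_top
    (klFrom_le_of_klSum_le hG fun N => ENNReal.ofReal_le_ofReal ?_)
  rw [klSum_eq_stopKl_win G σ hwin]
  refine (G.stopKl_le_mul_timeSum hcl (fun s _ _ => (le_abs_self _).trans (hC s)) N s hs).trans ?_
  exact mul_le_mul_of_nonneg_left (hc N s hs) hC0

/-- The infimum of the KL objective over the policies that win from `s`. -/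
def optValue (G : ICGame S A₁ A₂) (π₂ : G.Policy₂) (s : S) : ℝ≥0∞ :=
  ⨅ π₁ : G.Policy₁, ⨅ _ : G.WinsFrom s π₁, G.klFrom s π₁ π₂

lemma optValue_le (G : ICGame S A₁ A₂) (π₂ : G.Policy₂) {s : S} {π₁ : G.Policy₁}
    (h : G.WinsFrom s π₁) : G.optValue π₂ s ≤ G.klFrom s π₁ π₂ := iInf₂_le π₁ h

/-- One step of the dynamic programming inequality for the optimal value. -/
lemma stepCost_add_expNext_optValue_le {G : ICGame S A₁ A₂} (hG : G.FullSupport)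
    (σ : StationaryPolicy G.avail₂) {s : S} {π₁ : G.Policy₁} (hπ₁ : G.WinsFrom s π₁)
    (hfin : G.klFrom s π₁ (σ.toPolicy A₁ A₂) ≠ ∞) :
    G.stepCost s (π₁.act [] s) + G.expNext s (π₁.act [] s) (σ.dist s)
      (fun _ _ q => (G.optValue (σ.toPolicy A₁ A₂) q).toReal) ≤
        (G.klFrom s π₁ (σ.toPolicy A₁ A₂)).toReal := by
  refine le_of_forall_pos_le_add fun ε hε => ?_
  set v : S → ℝ := fun q => (G.optValue (σ.toPolicy A₁ A₂) q).toReal with hv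
  -- The divergence of each continuation is the limit of its `klSum` and is at least the optimal
  -- value there. There are finitely many successors, so one horizon serves them all.
  have hev : ∀ᶠ N in Filter.atTop, ∀ a b q, π₁.act [] s a ≠ 0 → σ.dist s b ≠ 0 →
      G.trans s a b q ≠ 0 → v q - ε ≤ G.klSum N (π₁.shift ⟨s, a, b⟩) (σ.toPolicy A₁ A₂) q := by
    simp only [Filter.eventually_all]
    intro a b q ha hb hq
    have hw := G.winsFrom_shift hπ₁ ha (dist_mem_avail σ hb) hq
    obtain ⟨N, hN⟩ : ∃ N, v q - ε ≤ G.klSum N (π₁.shift ⟨s, a, b⟩) (σ.toPolicy A₁ A₂) q := by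
      by_contra! hcon
      have h1 : G.klFrom q (π₁.shift ⟨s, a, b⟩) (σ.toPolicy A₁ A₂) ≤ ENNReal.ofReal (v q - ε) :=
        klFrom_le_of_klSum_le hG fun N => ENNReal.ofReal_le_ofReal (hcon N).le
      have h2 := ENNReal.toReal_mono ENNReal.ofReal_ne_top ((G.optValue_le _ hw).trans h1)
      have h3 : 0 ≤ v q - ε := (klSum_nonneg hG 0 _ _ _).trans (hcon 0).le
      rw [ENNReal.toReal_ofReal h3] at h2
      change v q ≤ _ at h2
      linarith
    filter_upwards [Filter.eventually_ge_atTop N] with M hM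
    exact hN.trans (klSum_mono hG _ _ _ hM)
  obtain ⟨N, hN⟩ := hev.exists
  have h1 := ENNReal.toReal_mono hfin
    (ofReal_klSum_le_klFrom hG π₁ (σ.toPolicy A₁ A₂) s (N + 1))
  rw [ENNReal.toReal_ofReal (klSum_nonneg hG _ _ _ _), klSum] at h1
  have h2 : G.expNext s (π₁.act [] s) (σ.dist s) (fun _ _ q => v q + -ε) ≤
      G.expNext s (π₁.act [] s) (σ.dist s) fun a b q =>
        G.klSum N (π₁.shift ⟨s, a, b⟩) (σ.toPolicy A₁ A₂) q :=
    G.expNext_mono _ _ _ fun a b q ha hb hq => by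
      have := hN a b q ha hb hq
      linarith
  rw [expNext_add G s _ _ (fun _ _ q => v q) (fun _ _ _ => -ε), expNext_const] at h2
  change G.stepCost s (π₁.act [] s) + G.expNext s (π₁.act [] s) (σ.dist s) (fun a b q =>
        G.klSum N (π₁.shift ⟨s, a, b⟩) (σ.toPolicy A₁ A₂) q) ≤ _ at h1
  linarith

/-- There is an optimal stationary policy against a stationary policy of Player 2, with a finite
value. -/
theorem exists_isOptimalAgainst {G : ICGame S A₁ A₂} (hG : G.FullSupport)
    (σ : StationaryPolicy G.avail₂) : ∃ μ : StationaryPolicy G.avail₁,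
      G.IsOptimalAgainst (σ.toPolicy A₁ A₂) μ ∧ ∃ v : S → ℝ, ∀ s ∈ G.winSet, 0 ≤ v s ∧
        (∀ a, μ.dist s a ≠ 0 → G.Keeps G.winSet s a) ∧
        G.stepCost s (μ.dist s) +
          G.expNext s (μ.dist s) (σ.dist s) (fun _ _ q => v q) ≤ v s ∧
        ∀ π₁, G.WinsFrom s π₁ → ENNReal.ofReal (v s) ≤ G.klFrom s π₁ (σ.toPolicy A₁ A₂) := by
  set v : S → ℝ := fun q => (G.optValue (σ.toPolicy A₁ A₂) q).toReal with hv
  obtain ⟨μ₀, hμ₀⟩ := exists_stationary_klFrom_ne_top hG σ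
  have hne : ∀ s ∈ G.winSet, G.optValue (σ.toPolicy A₁ A₂) s ≠ ∞ := fun s hs =>
    ne_top_of_le_ne_top (hμ₀ s hs).2 (G.optValue_le _ (hμ₀ s hs).1)
  obtain ⟨μ, hμ⟩ := exists_softmin hG σ v
  -- The first action of any winning policy is supported on keeping actions, so the softmin `μ` has
  -- no larger one-step cost. Taking the infimum over winning policies gives one half of Bellman's
  -- equation, which suffices.
  have hsuper : ∀ s ∈ G.winSet, G.stepCost s (μ.dist s) +
      G.expNext s (μ.dist s) (σ.dist s) (fun _ _ q => v q) ≤ v s := by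
    intro s hs
    rw [← ENNReal.ofReal_le_iff_le_toReal (hne s hs)]
    refine le_iInf₂ fun π₁ hπ₁ => ?_
    by_cases hfin : G.klFrom s π₁ (σ.toPolicy A₁ A₂) = ∞
    · rw [hfin]; exact le_top
    rw [ENNReal.ofReal_le_iff_le_toReal hfin]
    exact ((hμ s hs).2 (π₁.act [] s) fun a ha => G.keeps_winSet_of_winsFrom hπ₁ ha).trans
      (stepCost_add_expNext_optValue_le hG σ hπ₁ hfin)
  have hcl : G.ClosedUntil G.winSet ∅ μ σ :=
    G.closedUntil_of_keeps σ fun s hs _ a => ((hμ s hs).1 a).1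
  have hle : ∀ s ∈ G.winSet, ∀ π₁, G.WinsFrom s π₁ →
      ENNReal.ofReal (v s) ≤ G.klFrom s π₁ (σ.toPolicy A₁ A₂) := fun s hs π₁ hπ₁ => by
    rw [hv, ENNReal.ofReal_toReal (hne s hs)]
    exact G.optValue_le _ hπ₁
  refine ⟨μ, fun s hs => ?_, v, fun s hs => ⟨ENNReal.toReal_nonneg, fun a => ((hμ s hs).1 a).1,
    hsuper s hs, hle s hs⟩⟩
  rw [potential_eq_winSet hG] at hs
  -- A greedy policy need not win in general; this one does because it charges every keeping action.
  refine ⟨G.winsFrom_of_keeps (fun s hs _ => (hμ s hs).1) hs, fun π₁ hπ₁ => ?_⟩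
  refine le_trans (klFrom_le_of_klSum_le hG fun N => ENNReal.ofReal_le_ofReal ?_) (hle s hs π₁ hπ₁)
  rw [← stopKl_empty]
  simpa using G.stopKl_le_of_supersolution hcl (η := 0) (fun s _ => ENNReal.toReal_nonneg)
    (fun s hs _ => by simpa using hsuper s hs) N s hs

/-! ### Optimal policies in games that end early -/

lemma avoidProb_congr (G : ICGame S A₁ A₂) {E : Set S} {μ μ' : StationaryPolicy G.avail₁}
    (h : ∀ s ∉ E, μ.dist s = μ'.dist s) (N : ℕ) : ∀ (π₂ : G.Policy₂) (s : S),
      G.avoidProb E N (μ.toPolicy A₁ A₂) π₂ s = G.avoidProb E N (μ'.toPolicy A₁ A₂) π₂ s := by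
  induction N with
  | zero =>
    intro π₂ s
    by_cases hs : s ∈ E
    · rw [avoidProb_of_mem _ _ _ _ hs, avoidProb_of_mem _ _ _ _ hs]
    · rw [avoidProb_zero _ _ _ hs, avoidProb_zero _ _ _ hs]
  | succ N ih =>
    intro π₂ s
    by_cases hs : s ∈ E
    · rw [avoidProb_of_mem _ _ _ _ hs, avoidProb_of_mem _ _ _ _ hs]
    · rw [avoidProb_succ _ _ _ _ hs, avoidProb_succ _ _ _ _ hs]
      change G.expNext s (μ.dist s) _ _ = G.expNext s (μ'.dist s) _ _
      rw [h s hs]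
      exact expNext_congr _ _ _ _ fun a b q _ _ _ => ih _ _

lemma stopKl_congr (G : ICGame S A₁ A₂) {E : Set S} {μ μ' : StationaryPolicy G.avail₁}
    (h : ∀ s ∉ E, μ.dist s = μ'.dist s) (σ : StationaryPolicy G.avail₂) (N : ℕ) (s : S) :
    G.stopKl E μ σ N s = G.stopKl E μ' σ N s := by
  induction N generalizing s with
  | zero => rfl
  | succ N ih =>
    by_cases hs : s ∈ E
    · rw [stopKl_of_mem _ _ _ _ hs, stopKl_of_mem _ _ _ _ hs]
    · rw [stopKl_succ _ _ _ _ hs, stopKl_succ _ _ _ _ hs, h s hs]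
      exact congrArg _ (expNext_congr _ _ _ _ fun a b q _ _ _ => ih q)

variable {G : ICGame S A₁ A₂} {E : Set S} {σ : StationaryPolicy G.avail₂}
  {μ : StationaryPolicy G.avail₁}

lemma potential_withEnd (hG : G.FullSupport) (hE : E ⊆ G.winSet) (hw : G.win ⊆ E) :
    (G.withEnd E).potential = G.winSet := by
  rw [potential_eq_winSet (hG.withEnd E), winSet_withEnd G hE hw]

lemma keeps_of_isOptimalAgainst_withEnd (hG : G.FullSupport) (hE : E ⊆ G.winSet)
    (hw : G.win ⊆ E) (hμ : (G.withEnd E).IsOptimalAgainst (σ.toPolicy A₁ A₂) μ) {s : S}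
    (hs : s ∈ G.winSet) (hsE : s ∉ E) {a : A₁} (ha : μ.dist s a ≠ 0) : G.Keeps G.winSet s a := by
  have h := (hμ s (by rwa [potential_withEnd hG hE hw])).1
  have hk := (G.withEnd E).keeps_winSet_of_winsFrom h ha
  rw [winSet_withEnd G hE hw] at hk
  exact ⟨hk.1, fun b hb q hq => by simpa [if_neg hsE] using hk.2 b hb q hq⟩

lemma avoidForever_of_isOptimalAgainst_withEnd (hG : G.FullSupport) (hE : E ⊆ G.winSet)
    (hw : G.win ⊆ E) (hμ : (G.withEnd E).IsOptimalAgainst (σ.toPolicy A₁ A₂) μ) {s : S}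
    (hs : s ∈ G.winSet) (π₂ : G.Policy₂) : G.avoidForever E (μ.toPolicy A₁ A₂) π₂ s = 0 :=
  (G.winsFrom_withEnd_iff E s _).1 (hμ s (by rwa [potential_withEnd hG hE hw])).1 π₂

/-- An optimal policy of a game that ends early has the least stopped divergence. -/
lemma stopKl_le_of_isOptimalAgainst_withEnd (hG : G.FullSupport) (hE : E ⊆ G.winSet)
    (hw : G.win ⊆ E) (hμ : (G.withEnd E).IsOptimalAgainst (σ.toPolicy A₁ A₂) μ) {s : S}
    (hs : s ∈ G.winSet) {μ' : StationaryPolicy G.avail₁}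
    (hμ' : ∀ π₂, G.avoidForever E (μ'.toPolicy A₁ A₂) π₂ s = 0) {c : ℝ}
    (hc : ∀ N, G.stopKl E μ' σ N s ≤ c) (N : ℕ) : G.stopKl E μ σ N s ≤ c := by
  classical
  -- On `E` the competitor is replaced by the average player, which costs nothing. Its divergence in
  -- the shortened game is then bounded by the stopped divergence of `μ'`.
  set μ'' : StationaryPolicy G.avail₁ :=
    { dist := fun s => if s ∈ E then G.average.dist s else μ'.dist s
      dist_avail := fun s => by
        split_ifs
        · exact G.average.dist_avail s
        · exact μ'.dist_avail s } with hμ''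
  have hcongr : ∀ s ∉ E, μ''.dist s = μ'.dist s := fun s hs => if_neg hs
  have hwins : (G.withEnd E).WinsFrom s (μ''.toPolicy A₁ A₂) := by
    refine (G.winsFrom_withEnd_iff E s _).2 fun π₂ => ?_
    have h1 := G.tendsto_avoidProb E (μ''.toPolicy A₁ A₂) π₂ s
    simp only [G.avoidProb_congr hcongr] at h1
    exact tendsto_nhds_unique h1 (hμ' π₂ ▸ G.tendsto_avoidProb E (μ'.toPolicy A₁ A₂) π₂ s)
  have hle := (hμ s (by rwa [potential_withEnd hG hE hw])).2 _ hwins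
  have hc0 : 0 ≤ c := hc 0
  have h1 : (G.withEnd E).klFrom s (μ''.toPolicy A₁ A₂) (σ.toPolicy A₁ A₂) ≤ ENNReal.ofReal c := by
    refine klFrom_le_of_klSum_le (hG.withEnd E) fun N => ENNReal.ofReal_le_ofReal ?_
    rw [klSum_eq_stopKl_win (G.withEnd E) σ fun s hs => ?_]
    · change (G.withEnd E).stopKl E μ'' σ N s ≤ c
      rw [stopKl_withEnd, stopKl_congr G hcongr]
      exact hc N
    · have : μ''.dist s = G.average.dist s := if_pos hs
      rw [this]
      exact stepCost_average _ s
  have h2 := (ofReal_klSum_le_klFrom (hG.withEnd E) (μ.toPolicy A₁ A₂) (σ.toPolicy A₁ A₂) s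
    N).trans (hle.trans h1)
  rw [ENNReal.ofReal_le_ofReal_iff hc0] at h2
  refine le_trans ?_ h2
  rw [← stopKl_withEnd]
  exact stopKl_le_klSum (hG.withEnd E) E μ σ N s

/-- The game is already won on `E`, so the average player is a winning competitor of divergence zero
there, and the first stage of an optimal policy cannot cost anything. This matters for the output,
which still plays the synthesized policy on first arriving at an unknown state. -/
lemma stepCost_of_isOptimalAgainst_withEnd (hG : G.FullSupport) (hE : E ⊆ G.winSet)
    (hw : G.win ⊆ E) (hμ : (G.withEnd E).IsOptimalAgainst (σ.toPolicy A₁ A₂) μ) {s : S}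
    (hs : s ∈ E) : G.stepCost s (μ.dist s) = 0 := by
  refine le_antisymm ?_ (stepCost_nonneg hG (μ.dist_avail s))
  have hle := (hμ s (by rw [potential_withEnd hG hE hw]; exact hE hs)).2
    (G.withEnd E).averagePolicy ((G.withEnd E).winsFrom_of_mem_win hs _)
  have h0 : (G.withEnd E).klFrom s (G.withEnd E).averagePolicy (σ.toPolicy A₁ A₂) = 0 :=
    InformationTheory.klDiv_self _
  rw [h0] at hle
  have h1 := (ofReal_klSum_le_klFrom (hG.withEnd E) (μ.toPolicy A₁ A₂) (σ.toPolicy A₁ A₂) s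
    1).trans hle
  rw [nonpos_iff_eq_zero, ENNReal.ofReal_eq_zero] at h1
  have h2 : (G.withEnd E).klSum 1 (μ.toPolicy A₁ A₂) (σ.toPolicy A₁ A₂) s =
      G.stepCost s (μ.dist s) := by
    simp only [klSum, expNext_const, add_zero]
    rfl
  linarith

end ICGame
end

/-! ### Perturbing the policy of Player 2 -/

noncomputable section

/-- The total variation distance of `p` and `q` is at most `t`. -/
def TvLe {A : Type*} [Fintype A] (p q : PMF A) (t : ℝ) : Prop :=
  ∀ B : Finset A, ∑ b ∈ B, ((p b).toReal - (q b).toReal) ≤ t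

/-- The differences sum to zero, so the excess of `q` on a set is the excess of `p` on the
complement. -/
lemma TvLe.symm {A : Type*} [Fintype A] {p q : PMF A} {t : ℝ} (h : TvLe p q t) : TvLe q p t := by
  classical
  intro B
  have h1 := h Bᶜ
  have h2 := Finset.sum_add_sum_compl B fun b => (p b).toReal - (q b).toReal
  rw [Finset.sum_sub_distrib, Finset.sum_sub_distrib, Finset.sum_sub_distrib,
    ICGame.sum_pmf_toReal, ICGame.sum_pmf_toReal] at h2
  rw [Finset.sum_sub_distrib] at h1 ⊢
  linarith

lemma TvLe.trans {A : Type*} [Fintype A] {p q r : PMF A} {t t' : ℝ} (h : TvLe p q t)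
    (h' : TvLe q r t') : TvLe p r (t + t') := by
  intro B
  have := add_le_add (h B) (h' B)
  rw [← Finset.sum_add_distrib] at this
  simpa using this

/-- Only the outcomes where `p` exceeds `q` can increase the mean; their total excess is at most `t`
and the function is at most `M` there. -/
lemma TvLe.sum_mul_le {A : Type*} [Fintype A] {p q : PMF A} {t : ℝ} (h : TvLe p q t) {f : A → ℝ}
    {M : ℝ} (hf : ∀ b, 0 ≤ f b) (hf' : ∀ b, f b ≤ M) (hM : 0 ≤ M) :
    ∑ b, (p b).toReal * f b ≤ ∑ b, (q b).toReal * f b + t * M := by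
  classical
  have h1 : ∑ b, ((p b).toReal - (q b).toReal) * f b ≤
      ∑ b, if (q b).toReal ≤ (p b).toReal then ((p b).toReal - (q b).toReal) * M else 0 := by
    refine Finset.sum_le_sum fun b _ => ?_
    split_ifs with hb
    · exact mul_le_mul_of_nonneg_left (hf' b) (by linarith)
    · exact mul_nonpos_of_nonpos_of_nonneg (by linarith) (hf b)
  rw [← Finset.sum_filter, ← Finset.sum_mul] at h1
  have h2 := mul_le_mul_of_nonneg_right
    (h (Finset.univ.filter fun b => (q b).toReal ≤ (p b).toReal)) hM
  simp only [sub_mul, Finset.sum_sub_distrib] at h1 h2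
  linarith

namespace ICGame

variable {S A₁ A₂ : Type*} [Fintype S] [Fintype A₁] [Fintype A₂]

lemma expNext_eq_sum (G : ICGame S A₁ A₂) (s : S) (p : PMF A₁) (σ : PMF A₂)
    (F : A₁ → A₂ → S → ℝ) : G.expNext s p σ F =
      ∑ b, (σ b).toReal * ∑ a, ∑ q, (p a).toReal * (G.trans s a b q).toReal * F a b q := by
  rw [expNext, Finset.sum_comm]
  refine Finset.sum_congr rfl fun b _ => ?_
  simp only [Finset.mul_sum]
  refine Finset.sum_congr rfl fun a _ => Finset.sum_congr rfl fun q _ => ?_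
  ring

lemma expNext_le_of_tvLe (G : ICGame S A₁ A₂) {s : S} {p : PMF A₁} {σ σ' : PMF A₂}
    (hσ : σ.support ⊆ ↑(G.avail₂ s)) (hσ' : σ'.support ⊆ ↑(G.avail₂ s)) {t : ℝ}
    (h : TvLe σ σ' t) {v : S → ℝ} {M : ℝ} (hM : 0 ≤ M)
    (hv : ∀ a b q, p a ≠ 0 → b ∈ G.avail₂ s → G.trans s a b q ≠ 0 → 0 ≤ v q ∧ v q ≤ M) :
    G.expNext s p σ (fun _ _ q => v q) ≤ G.expNext s p σ' (fun _ _ q => v q) + t * M := by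
  classical
  -- The bounds on `v` are known only along transitions that can occur. Setting the mean next value
  -- to 0 at unavailable actions makes it bounded everywhere, without changing either expectation.
  set f : A₂ → ℝ := fun b => if b ∈ G.avail₂ s then
    ∑ a, ∑ q, (p a).toReal * (G.trans s a b q).toReal * v q else 0 with hf
  have hE : ∀ ρ : PMF A₂, ρ.support ⊆ ↑(G.avail₂ s) →
      G.expNext s p ρ (fun _ _ q => v q) = ∑ b, (ρ b).toReal * f b := by
    intro ρ hρ
    rw [expNext_eq_sum]
    refine Finset.sum_congr rfl fun b _ => ?_
    by_cases hb : b ∈ G.avail₂ s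
    · simp only [hf, if_pos hb]
    · have : ρ b = 0 := by
        by_contra h0
        exact hb (hρ ((PMF.mem_support_iff _ _).2 h0))
      simp [this]
  have hterm : ∀ b ∈ G.avail₂ s, ∀ a q, 0 ≤ (p a).toReal * (G.trans s a b q).toReal * v q ∧
      (p a).toReal * (G.trans s a b q).toReal * v q ≤
        (p a).toReal * (G.trans s a b q).toReal * M := by
    intro b hb a q
    by_cases ha : p a = 0
    · simp [ha]
    by_cases hq : G.trans s a b q = 0
    · simp [hq]
    obtain ⟨h1, h2⟩ := hv a b q ha hb hq
    exact ⟨by positivity, mul_le_mul_of_nonneg_left h2 (by positivity)⟩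
  rw [hE _ hσ, hE _ hσ']
  refine h.sum_mul_le (fun b => ?_) (fun b => ?_) hM
  · simp only [hf]
    split_ifs with hb
    · exact Finset.sum_nonneg fun a _ => Finset.sum_nonneg fun q _ => (hterm b hb a q).1
    · exact le_rfl
  · simp only [hf]
    split_ifs with hb
    · refine (Finset.sum_le_sum fun a _ => Finset.sum_le_sum fun q _ => (hterm b hb a q).2).trans ?_
      simp only [← Finset.sum_mul, ← Finset.mul_sum, sum_pmf_toReal, mul_one, one_mul, le_refl]
    · exact hM

/-- Each step adds an error of at most `t`, since an avoidance probability lies between 0 and 1.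
Over `L` steps a contraction thus weakens by at most `L t`. -/
lemma avoidProb_le_of_tvLe (G : ICGame S A₁ A₂) {Y E : Set S} {μ : StationaryPolicy G.avail₁}
    {σ σ' : StationaryPolicy G.avail₂}
    (hY : ∀ s ∈ Y, s ∉ E → ∀ a, μ.dist s a ≠ 0 → G.Keeps Y s a) {t : ℝ} (ht : 0 ≤ t)
    (h : ∀ s ∈ Y, s ∉ E → TvLe (σ.dist s) (σ'.dist s) t) (N : ℕ) : ∀ s ∈ Y,
      G.avoidProb E N (μ.toPolicy A₁ A₂) (σ.toPolicy A₁ A₂) s ≤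
        G.avoidProb E N (μ.toPolicy A₁ A₂) (σ'.toPolicy A₁ A₂) s + N * t := by
  induction N with
  | zero =>
    intro s _
    by_cases hE : s ∈ E
    · simp [avoidProb_of_mem G _ _ _ hE]
    · simp [avoidProb_zero G _ _ hE]
  | succ N ih =>
    intro s hs
    by_cases hE : s ∈ E
    · rw [avoidProb_of_mem G _ _ _ hE, avoidProb_of_mem G _ _ _ hE]
      positivity
    rw [avoidProb_succ G _ _ _ hE, avoidProb_succ G _ _ _ hE]
    have h1 : G.expNext s (μ.dist s) (σ.dist s) (fun _ _ q =>
        G.avoidProb E N (μ.toPolicy A₁ A₂) (σ.toPolicy A₁ A₂) q) ≤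
          G.expNext s (μ.dist s) (σ.dist s) (fun _ _ q =>
        G.avoidProb E N (μ.toPolicy A₁ A₂) (σ'.toPolicy A₁ A₂) q + N * t) :=
      G.expNext_mono _ _ _ fun a b q ha hb hq =>
        ih q ((hY s hs hE a ha).mem (dist_mem_avail σ hb) hq)
    rw [expNext_add G s _ _ (fun _ _ q =>
        G.avoidProb E N (μ.toPolicy A₁ A₂) (σ'.toPolicy A₁ A₂) q), expNext_const] at h1
    have h2 := G.expNext_le_of_tvLe (p := μ.dist s) (σ.dist_avail s) (σ'.dist_avail s) (h s hs hE)
      zero_le_one (v := fun q => G.avoidProb E N (μ.toPolicy A₁ A₂) (σ'.toPolicy A₁ A₂) q)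
      fun a b q _ _ _ => ⟨G.avoidProb_nonneg _ _ _ _ _, G.avoidProb_le_one _ _ _ _ _⟩
    change G.expNext s (μ.dist s) (σ.dist s) (fun _ _ q =>
        G.avoidProb E N (μ.toPolicy A₁ A₂) (σ.toPolicy A₁ A₂) q) ≤
        G.expNext s (μ.dist s) (σ'.dist s) (fun _ _ q =>
        G.avoidProb E N (μ.toPolicy A₁ A₂) (σ'.toPolicy A₁ A₂) q) + _
    push_cast
    linarith

omit [Fintype S] [Fintype A₂] in
lemma stepCost_le_sum {G : ICGame S A₁ A₂} (hG : G.FullSupport) {s : S} {p : PMF A₁}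
    (hp : p.support ⊆ ↑(G.avail₁ s)) :
    G.stepCost s p ≤ ∑ a, |Real.log (G.average.dist s a).toReal| := by
  refine Finset.sum_le_sum fun a _ => ?_
  by_cases ha : p a = 0
  · simp [ha]
  have hpa := ENNReal.toReal_pos ha (PMF.apply_ne_top _ _)
  have hp1 : (p a).toReal ≤ 1 := ENNReal.toReal_le_of_le_ofReal zero_le_one (by
    simpa using p.coe_le_one a)
  have hav := ENNReal.toReal_pos (hG s a (hp ((PMF.mem_support_iff _ _).2 ha)))
    (PMF.apply_ne_top _ _)
  rw [Real.log_div hpa.ne' hav.ne']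
  have h1 := Real.log_nonpos hpa.le hp1
  have h2 := neg_abs_le (Real.log (G.average.dist s a).toReal)
  have h3 := abs_nonneg (Real.log (G.average.dist s a).toReal)
  nlinarith

lemma stepCost_le_cMax {G : ICGame S A₁ A₂} (hG : G.FullSupport) {s : S} (hs : s ∈ G.winSet)
    {p : PMF A₁} (hp : ∀ a, p a ≠ 0 → G.Keeps G.winSet s a) : G.stepCost s p ≤ G.cMax := by
  have hpot := potential_eq_winSet hG
  obtain ⟨c, hc⟩ := Finite.exists_le fun s => ∑ a, |Real.log (G.average.dist s a).toReal|
  refine le_csSup ⟨c, ?_⟩ ⟨s, hpot ▸ hs, p, fun a ha => ?_, rfl⟩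
  · rintro _ ⟨s, _, p, hp, rfl⟩
    exact (stepCost_le_sum hG fun a ha => (hp a ha).1).trans (hc s)
  · have := hp a ((PMF.mem_support_iff _ _).1 ha)
    rw [← hpot] at this
    exact this

/-- The limit of a bounded stopped divergence is a supersolution. -/
lemma exists_stopKl_limit {G : ICGame S A₁ A₂} (hG : G.FullSupport) {Y E : Set S}
    {μ : StationaryPolicy G.avail₁} {σ : StationaryPolicy G.avail₂} (hY : G.ClosedUntil Y E μ σ)
    {B : ℝ} (hB : ∀ N, ∀ s ∈ Y, G.stopKl E μ σ N s ≤ B) : ∃ v : S → ℝ, ∀ s ∈ Y,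
      0 ≤ v s ∧ v s ≤ B ∧ (∀ N, G.stopKl E μ σ N s ≤ v s) ∧
      (∀ c, (∀ N, G.stopKl E μ σ N s ≤ c) → v s ≤ c) ∧
      (s ∉ E → G.stepCost s (μ.dist s) +
        G.expNext s (μ.dist s) (σ.dist s) (fun _ _ q => v q) ≤ v s) := by
  set v : S → ℝ := fun s => ⨆ N, G.stopKl E μ σ N s with hv
  have hbdd : ∀ s ∈ Y, BddAbove (Set.range fun N => G.stopKl E μ σ N s) := fun s hs =>
    ⟨B, by rintro _ ⟨N, rfl⟩; exact hB N s hs⟩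
  have hle : ∀ s ∈ Y, ∀ N, G.stopKl E μ σ N s ≤ v s := fun s hs N => le_ciSup (hbdd s hs) N
  refine ⟨v, fun s hs => ⟨hle s hs 0, ciSup_le fun N => hB N s hs, hle s hs,
    fun c hc => ciSup_le hc, fun hE => ?_⟩⟩
  refine le_of_forall_pos_le_add fun η hη => ?_
  have hev : ∀ᶠ N in Filter.atTop, ∀ q, q ∈ Y → v q - η ≤ G.stopKl E μ σ N q := by
    rw [Filter.eventually_all]
    intro q
    by_cases hq : q ∈ Y
    · obtain ⟨N, hN⟩ := exists_lt_of_lt_ciSup (show v q - η < ⨆ N, G.stopKl E μ σ N q by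
        change v q - η < v q; linarith)
      filter_upwards [Filter.eventually_ge_atTop N] with M hM _
      exact hN.le.trans (stopKl_mono hG E μ σ q hM)
    · exact Filter.Eventually.of_forall fun _ h => absurd h hq
  obtain ⟨N, hN⟩ := hev.exists
  have h1 := hle s hs (N + 1)
  rw [stopKl_succ G _ _ _ hE] at h1
  have h2 : G.expNext s (μ.dist s) (σ.dist s) (fun _ _ q => v q + -η) ≤
      G.expNext s (μ.dist s) (σ.dist s) fun _ _ q => G.stopKl E μ σ N q :=
    G.expNext_mono _ _ _ fun a b q ha hb hq => by
      have := hN q (hY s hs hE a b q ha hb hq)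
      linarith
  rw [expNext_add G s _ _ (fun _ _ q => v q) (fun _ _ _ => -η), expNext_const] at h2
  linarith

/-- Comparison of the stopped divergences against nearby policies of Player 2. -/
lemma stopKl_le_of_tvLe {G : ICGame S A₁ A₂} (hG : G.FullSupport) {E E' : Set S} (hE : E' ⊆ E)
    {μ : StationaryPolicy G.avail₁} {σ σ' : StationaryPolicy G.avail₂}
    (hY : ∀ s ∈ G.winSet, s ∉ E' → ∀ a, μ.dist s a ≠ 0 → G.Keeps G.winSet s a)
    {L : ℕ} {β β' t : ℝ} (hβ : β < 1) (hββ' : β' + L * t ≤ β) (ht : 0 ≤ t)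
    (hcon : ∀ s ∈ G.winSet, G.avoidProb E' L (μ.toPolicy A₁ A₂) (σ'.toPolicy A₁ A₂) s ≤ β')
    (htv : ∀ s ∈ G.winSet, s ∉ E → TvLe (σ.dist s) (σ'.dist s) t)
    (hC : 0 < G.cMax) {c : ℝ} {s : S} (hs : s ∈ G.winSet)
    (hc : ∀ N, G.stopKl E' μ σ' N s ≤ c) (N : ℕ) :
    G.stopKl E μ σ N s ≤ c + t * G.cMax * L ^ 2 / (1 - β) ^ 2 := by
  have hLt : 0 ≤ L * t := by positivity
  have hcl' : G.ClosedUntil G.winSet E' μ σ' := G.closedUntil_of_keeps σ' hY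
  have hY' : ∀ s ∈ G.winSet, s ∉ E → ∀ a, μ.dist s a ≠ 0 → G.Keeps G.winSet s a :=
    fun s hs h => hY s hs fun h' => h (hE h')
  have hcl : G.ClosedUntil G.winSet E μ σ := G.closedUntil_of_keeps σ hY'
  have h1β : 0 < 1 - β := by linarith
  -- The stage cost is at most `cMax` and the expected time at most L/(1-β); this is the oscillation
  -- bound for the value function in the perturbation step.
  set B := G.cMax * (L / (1 - β)) with hBdef
  have hB0 : 0 ≤ B := by positivity
  have hB : ∀ N, ∀ s ∈ G.winSet, G.stopKl E' μ σ' N s ≤ B := by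
    intro N s hs
    refine (G.stopKl_le_mul_timeSum hcl'
      (fun s hs h => stepCost_le_cMax hG hs (hY s hs h)) N s hs).trans ?_
    refine mul_le_mul_of_nonneg_left ?_ hC.le
    exact G.timeSum_le_of_avoidProb_le hcl' hβ (fun s hs => (hcon s hs).trans (by linarith)) N s hs
  obtain ⟨v, hv⟩ := exists_stopKl_limit hG hcl' hB
  have hcon' : ∀ s ∈ G.winSet,
      G.avoidProb E L (μ.toPolicy A₁ A₂) (σ.toPolicy A₁ A₂) s ≤ β := by
    intro s hs
    have h1 := G.avoidProb_le_of_tvLe hY' ht htv L s hs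
    have h2 := G.avoidProb_mono_set hE L (μ.toPolicy A₁ A₂) (σ'.toPolicy A₁ A₂) s
    have h3 := hcon s hs
    linarith
  -- The value `v` against `σ'` is a supersolution against `σ` up to `t * B` per stage, and the
  -- weakened contraction bounds the expected number of stages against `σ` by L/(1-β) again.
  have hsup := G.stopKl_le_of_supersolution hcl (v := v) (η := t * B) (fun s hs => (hv s hs).1)
    (fun s hs h => by
      have h1 := G.expNext_le_of_tvLe (p := μ.dist s) (σ.dist_avail s) (σ'.dist_avail s)
        (htv s hs h) hB0 (v := v) fun a b q ha hb hq => by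
          have := hv q ((hY' s hs h a ha).mem hb hq)
          exact ⟨this.1, this.2.1⟩
      have h2 := (hv s hs).2.2.2.2 fun h' => h (hE h')
      linarith) N s hs
  have htime := G.timeSum_le_of_avoidProb_le hcl hβ hcon' N s hs
  have h3 := mul_le_mul_of_nonneg_left htime (mul_nonneg ht hB0)
  have h4 : t * B * (L / (1 - β)) = t * G.cMax * L ^ 2 / (1 - β) ^ 2 := by
    rw [hBdef]
    field_simp
  have h5 := (hv s hs).2.2.2.1 c hc
  linarith

/-- The divergence of a policy synthesized against an estimate, compared with the value of the
game against a reference policy `ρ` for which the synthesis contracts, too. -/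
theorem stopKl_le_of_isOptimalAgainst {G : ICGame S A₁ A₂} (hG : G.FullSupport)
    {E E' : Set S} (hE : E ⊆ G.winSet) (hE' : E' ⊆ E) (hw : G.win ⊆ E')
    {μ μ' ν : StationaryPolicy G.avail₁} {σ σ' ρ : StationaryPolicy G.avail₂}
    (hμ : (G.withEnd E).IsOptimalAgainst (σ'.toPolicy A₁ A₂) μ)
    (hμ' : (G.withEnd E').IsOptimalAgainst (ρ.toPolicy A₁ A₂) μ')
    {L : ℕ} {β κ ε : ℝ} (hβ : β < 1) (hκ : 0 ≤ κ) (hL : 1 ≤ L) (hC : 0 < G.cMax)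
    (hκε : κ * (G.cMax * L) = ε * (1 - β) ^ 2)
    (hcon : ∀ s ∈ G.winSet, G.avoidProb E L (μ.toPolicy A₁ A₂) (σ'.toPolicy A₁ A₂) s ≤ β - κ)
    (hcon' : ∀ s ∈ G.winSet, G.avoidProb E' L (μ'.toPolicy A₁ A₂) (ρ.toPolicy A₁ A₂) s ≤ β - κ)
    (htv : ∀ s ∈ G.winSet, s ∉ E → TvLe (σ'.dist s) (σ.dist s) (3 * κ / (8 * L)))
    (htv' : ∀ s ∈ G.winSet, s ∉ E' → TvLe (σ.dist s) (ρ.dist s) (κ / (4 * L)))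
    {v : S → ℝ} (hv0 : ∀ s ∈ G.winSet, 0 ≤ v s)
    (hν : ∀ s ∈ G.winSet, ∀ a, ν.dist s a ≠ 0 → G.Keeps G.winSet s a)
    (hνw : ∀ s ∈ G.winSet, G.WinsFrom s (ν.toPolicy A₁ A₂))
    (hv : ∀ s ∈ G.winSet, s ∉ E' → G.stepCost s (ν.dist s) +
      G.expNext s (ν.dist s) (ρ.dist s) (fun _ _ q => v q) ≤ v s)
    {s : S} (hs : s ∈ G.winSet) (N : ℕ) : G.stopKl E μ σ N s ≤ v s + ε := by
  have hL0 : (0 : ℝ) < L := by exact_mod_cast hL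
  have hwE := hw.trans hE'
  have hEW' := hE'.trans hE
  have h1β : 0 < 1 - β := by linarith
  -- The calibration of `κ`: a total variation distance of r κ / L costs r ε.
  have hkey : ∀ r : ℝ, r * κ / L * G.cMax * L ^ 2 / (1 - β) ^ 2 = r * ε := by
    intro r
    rw [div_eq_iff (by positivity)]
    have : r * κ / L * G.cMax * (L : ℝ) ^ 2 = r * (κ * (G.cMax * L)) := by
      field_simp
    rw [this, hκε]
    ring
  have e1 : 3 * κ / (8 * (L : ℝ)) = 3 / 8 * κ / L := by field_simp
  have e2 : κ / (4 * (L : ℝ)) = 1 / 4 * κ / L := by field_simp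
  have e3 : 3 * κ / (8 * (L : ℝ)) + κ / (4 * L) = 5 / 8 * κ / L := by field_simp; ring
  have hm : ∀ r : ℝ, (L : ℝ) * (r * κ / L) = r * κ := fun r => by field_simp
  have hkeepE : ∀ s ∈ G.winSet, s ∉ E → ∀ a, μ.dist s a ≠ 0 → G.Keeps G.winSet s a :=
    fun s hs h a ha => keeps_of_isOptimalAgainst_withEnd hG hE hwE hμ hs h ha
  have hkeepE' : ∀ s ∈ G.winSet, s ∉ E' → ∀ a, μ'.dist s a ≠ 0 → G.Keeps G.winSet s a :=
    fun s hs h a ha => keeps_of_isOptimalAgainst_withEnd hG hEW' hw hμ' hs h ha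
  -- Optimality of `μ'` against `ρ`, with `ν` as the competitor; `v` is a supersolution for `ν`
  -- against `ρ`.
  have hstep4 : ∀ N, G.stopKl E' μ' ρ N s ≤ v s := by
    refine stopKl_le_of_isOptimalAgainst_withEnd hG hEW' hw hμ' hs (μ' := ν) (fun π₂ => ?_)
      fun N => ?_
    · refine le_antisymm ?_ (G.avoidForever_nonneg _ _ _ _)
      exact (G.avoidForever_mono_set hw _ _ _).trans ((G.winsFrom_iff _ _).1 (hνw s hs) π₂).le
    · have := G.stopKl_le_of_supersolution (G.closedUntil_of_keeps ρ fun s hs _ => hν s hs)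
        (E := E') (v := v) (η := 0) hv0 (fun s hs h => by simpa using hv s hs h) N s hs
      simpa using this
  -- From `ρ` to `σ'` through `σ`: the distances add up to 3κ/(8L) + κ/(4L) = 5κ/(8L). The
  -- contraction of `μ'` against `ρ` is what makes this transfer possible.
  have hstep3 : ∀ N, G.stopKl E μ' σ' N s ≤ v s + 5 / 8 * ε := by
    intro N
    rw [← hkey]
    refine stopKl_le_of_tvLe hG hE' hkeepE' hβ ?_ (by positivity) hcon' (fun s hs h => ?_) hC hs
      hstep4 N
    · rw [hm]
      linarith
    · rw [← e3]
      exact (htv s hs h).trans (htv' s hs fun h' => h (hE' h'))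
  -- Optimality of `μ` against `σ'`; the competitor `μ'` almost surely reaches the smaller set `E'`,
  -- hence `E`.
  have hstep2 : ∀ N, G.stopKl E μ σ' N s ≤ v s + 5 / 8 * ε :=
    stopKl_le_of_isOptimalAgainst_withEnd hG hE hwE hμ hs (fun π₂ =>
      le_antisymm ((G.avoidForever_mono_set hE' _ _ _).trans
        (avoidForever_of_isOptimalAgainst_withEnd hG hEW' hw hμ' hs π₂).le)
        (G.avoidForever_nonneg _ _ _ _)) hstep3
  -- From `σ'` to `σ`, with the contraction of `μ` against `σ'`, for the remaining 3ε/8.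
  have := stopKl_le_of_tvLe hG subset_rfl hkeepE hβ (t := 3 / 8 * κ / L) (by rw [hm]; linarith)
    (by positivity) hcon (fun s hs h => by rw [← e1]; exact (htv s hs h).symm) hC hs hstep2 N
  rw [hkey] at this
  linarith

/-! ### The output policy -/

lemma Policy.ext_act {S A₁ A₂ A : Type*} {avail : S → Finset A} {π π' : Policy S A₁ A₂ avail}
    (h : ∀ l s, π.act l s = π'.act l s) : π = π' := by
  obtain ⟨f, hf⟩ := π
  obtain ⟨g, hg⟩ := π'
  obtain rfl : f = g := funext fun l => funext fun s => h l s
  rfl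

omit [Fintype S] [Fintype A₁] [Fintype A₂] in
lemma switchPolicy_act_nil (G : ICGame S A₁ A₂) (K : Set S) (μ : StationaryPolicy G.avail₁)
    (s : S) : (G.switchPolicy K μ).act [] s = μ.dist s := by
  simp [switchPolicy]

omit [Fintype S] [Fintype A₁] [Fintype A₂] in
lemma switchPolicy_shift_of_mem (G : ICGame S A₁ A₂) {K : Set S} (μ : StationaryPolicy G.avail₁)
    {x : Step S A₁ A₂} (hx : x.state ∈ K) :
    (G.switchPolicy K μ).shift x = G.switchPolicy K μ :=
  Policy.ext_act fun l s => by
    classical exact if_congr (by simp [hx]) rfl rfl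

omit [Fintype S] [Fintype A₁] [Fintype A₂] in
lemma switchPolicy_shift_of_notMem (G : ICGame S A₁ A₂) {K : Set S}
    (μ : StationaryPolicy G.avail₁) {x : Step S A₁ A₂} (hx : x.state ∉ K) :
    (G.switchPolicy K μ).shift x = G.averagePolicy :=
  Policy.ext_act fun l s => by
    simp [switchPolicy, Policy.shift, hx, StationaryPolicy.toPolicy]

lemma klSum_averagePolicy (G : ICGame S A₁ A₂) (N : ℕ) : ∀ (π₂ : G.Policy₂) (s : S),
    G.klSum N G.averagePolicy π₂ s = 0 := by
  induction N with
  | zero => intro π₂ s; rfl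
  | succ N ih =>
    intro π₂ s
    have h1 : G.stepCost s (G.averagePolicy.act [] s) = 0 := G.stepCost_average s
    simp only [klSum, h1, toPolicy_shift, ih, expNext_const, add_zero]

/-- The policies agree before the stopping set. An unknown state itself is played with `μ`, because
the switch looks at previous states only, but this costs nothing by `h0`; afterwards the average
player is imitated at no cost. A known winning state is absorbing and free. -/
lemma klSum_switchPolicy_le (G : ICGame S A₁ A₂) {K : Set S}
    {μ : StationaryPolicy G.avail₁} (σ : StationaryPolicy G.avail₂)
    (h0 : ∀ s ∈ (G.winSet \ K) ∪ G.win, G.stepCost s (μ.dist s) = 0)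
    (hkeep : ∀ s ∈ G.winSet, s ∉ (G.winSet \ K) ∪ G.win → ∀ a, μ.dist s a ≠ 0 →
      G.Keeps G.winSet s a) (N : ℕ) : ∀ s ∈ G.winSet,
      G.klSum N (G.switchPolicy K μ) (σ.toPolicy A₁ A₂) s ≤
        G.stopKl ((G.winSet \ K) ∪ G.win) μ σ N s := by
  induction N with
  | zero => intro s _; exact le_rfl
  | succ N ih =>
    intro s hs
    by_cases hE : s ∈ (G.winSet \ K) ∪ G.win
    · rw [stopKl_of_mem G _ _ _ hE, klSum, switchPolicy_act_nil, h0 s hE, zero_add,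
        ← G.expNext_const s (μ.dist s) (σ.dist s) 0]
      refine G.expNext_mono _ _ _ fun a b q ha hb hq => ?_
      by_cases hsK : s ∈ K
      · have hsw : s ∈ G.win := hE.resolve_left fun h => h.2 hsK
        rw [switchPolicy_shift_of_mem G μ (x := ⟨s, a, b⟩) hsK]
        rw [G.win_absorbing s hsw a (dist_mem_avail μ ha) b (dist_mem_avail σ hb)] at hq
        obtain rfl : q = s := by simpa using hq
        exact (ih q hs).trans (G.stopKl_of_mem _ _ _ hE).le
      · rw [switchPolicy_shift_of_notMem G μ (x := ⟨s, a, b⟩) hsK]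
        exact (G.klSum_averagePolicy N _ q).le
    · rw [stopKl_succ G _ _ _ hE, klSum, switchPolicy_act_nil]
      refine add_le_add le_rfl (G.expNext_mono _ _ _ fun a b q ha hb hq => ?_)
      have hsK : s ∈ K := by
        by_contra h
        exact hE (Or.inl ⟨hs, h⟩)
      rw [switchPolicy_shift_of_mem G μ (x := ⟨s, a, b⟩) hsK]
      exact ih q ((hkeep s hs hE a ha).mem (dist_mem_avail σ hb) hq)

/-- The play stays in the winning region before the stopping set, so all states seen so far are
known and no switch has happened. -/
lemma avoidProb_switchPolicy (G : ICGame S A₁ A₂) {K : Set S}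
    {μ : StationaryPolicy G.avail₁}
    (hkeep : ∀ s ∈ G.winSet, s ∉ (G.winSet \ K) ∪ G.win → ∀ a, μ.dist s a ≠ 0 →
      G.Keeps G.winSet s a) (N : ℕ) : ∀ (π₂ : G.Policy₂), ∀ s ∈ G.winSet,
      G.avoidProb ((G.winSet \ K) ∪ G.win) N (G.switchPolicy K μ) π₂ s =
        G.avoidProb ((G.winSet \ K) ∪ G.win) N (μ.toPolicy A₁ A₂) π₂ s := by
  induction N with
  | zero =>
    intro π₂ s _
    by_cases hE : s ∈ (G.winSet \ K) ∪ G.win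
    · rw [avoidProb_of_mem G _ _ _ hE, avoidProb_of_mem G _ _ _ hE]
    · rw [avoidProb_zero G _ _ hE, avoidProb_zero G _ _ hE]
  | succ N ih =>
    intro π₂ s hs
    by_cases hE : s ∈ (G.winSet \ K) ∪ G.win
    · rw [avoidProb_of_mem G _ _ _ hE, avoidProb_of_mem G _ _ _ hE]
    · rw [avoidProb_succ G _ _ _ hE, avoidProb_succ G _ _ _ hE, switchPolicy_act_nil]
      refine expNext_congr _ _ _ _ fun a b q ha hb hq => ?_
      have hsK : s ∈ K := by
        by_contra h
        exact hE (Or.inl ⟨hs, h⟩)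
      rw [switchPolicy_shift_of_mem G μ (x := ⟨s, a, b⟩) hsK]
      exact ih _ q ((hkeep s hs hE a ha).mem (act_mem_avail π₂ hb) hq)

lemma measureReal_reachWithin (G : ICGame S A₁ A₂) (L : ℕ) (E : Set S) (π₁ : G.Policy₁)
    (π₂ : G.Policy₂) (s : S) :
    (G.runLaw π₁ π₂ s).real (reachWithin L E) = 1 - G.avoidProb E L π₁ π₂ s := by
  have : (reachWithin L E : Set (ℕ → Step S A₁ A₂)) = {γ | ∀ t ≤ L, (γ t).state ∉ E}ᶜ := by
    ext γ
    change (∃ t ≤ L, (γ t).state ∈ E) ↔ ¬ ∀ t ≤ L, (γ t).state ∉ E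
    push Not
    rfl
  rw [this, probReal_compl_eq_one_sub (measurableSet_avoid E L)]
  rfl

/-- A policy with a small divergence from the average player's seldom reaches states that the
average player hardly ever reaches. -/
lemma one_sub_le_measureReal_reach_win {G : ICGame S A₁ A₂} {π₁ : G.Policy₁} {π₂ : G.Policy₂}
    {s : S} {U : Set S} (h : G.avoidForever (U ∪ G.win) π₁ π₂ s = 0)
    {c w lam : ℝ} (hc : G.klFrom s π₁ π₂ ≤ ENNReal.ofReal c) (hc0 : 0 ≤ c) (hw : 0 < w)
    (hU : (G.runLaw G.averagePolicy π₂ s).real (reach U) ≤ Real.exp (-w))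
    (hcw : c + Real.log 2 ≤ lam * w) : 1 - lam ≤ (G.runLaw π₁ π₂ s).real (reach G.win) := by
  -- The bound e^{-w} is exactly the condition of the Donsker-Varadhan inequality with weight `w`,
  -- which yields w P(reach U) ≤ c + log 2 ≤ λ w.
  have h1 := mul_measureReal_sub_log_two_le_klDiv (ne_top_of_le_ne_top ENNReal.ofReal_ne_top hc)
    (measurableSet_reach U) (w := w) (by
      calc _ ≤ Real.exp (-w) * Real.exp w := mul_le_mul_of_nonneg_right hU (Real.exp_pos _).le
        _ = 1 := by rw [← Real.exp_add]; simp)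
  have h2 := ENNReal.toReal_mono ENNReal.ofReal_ne_top hc
  rw [ENNReal.toReal_ofReal hc0] at h2
  have h3 : (G.runLaw π₁ π₂ s).real (reach U) ≤ lam := by
    have : w * (G.runLaw π₁ π₂ s).real (reach U) ≤ w * lam := by
      have h2' : (InformationTheory.klDiv (G.runLaw π₁ π₂ s)
        (G.runLaw G.averagePolicy π₂ s)).toReal ≤ c := h2
      linarith
    exact le_of_mul_le_mul_left this hw
  have h4 : (G.runLaw π₁ π₂ s).real (reach (U ∪ G.win)) = 1 := by
    rw [measureReal_reach, h, sub_zero]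
  have h5 : (reach (U ∪ G.win) : Set (ℕ → Step S A₁ A₂)) ⊆ reach U ∪ reach G.win := by
    rintro γ ⟨t, ht | ht⟩
    · exact Or.inl ⟨t, ht⟩
    · exact Or.inr ⟨t, ht⟩
  have h6 := (measureReal_mono (μ := G.runLaw π₁ π₂ s) h5).trans (measureReal_union_le _ _)
  linarith

end ICGame
end

/-! ### Exponential supermartingales and the order of the visits -/

noncomputable section

/-- Hoeffding's lemma for a Bernoulli variable. -/
lemma mul_exp_add_mul_exp_le {p : ℝ} (hp0 : 0 ≤ p) (hp1 : p ≤ 1) (θ : ℝ) :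
    p * Real.exp (θ * (1 - p)) + (1 - p) * Real.exp (θ * (0 - p)) ≤ Real.exp (θ ^ 2 / 8) := by
  set μ : Measure ℝ := ENNReal.ofReal p • Measure.dirac 1 + ENNReal.ofReal (1 - p) •
    Measure.dirac 0 with hμ
  have : IsProbabilityMeasure μ := ⟨by
    simp only [hμ, Measure.add_apply, Measure.smul_apply, measure_univ, smul_eq_mul, mul_one]
    rw [← ENNReal.ofReal_add hp0 (by linarith)]
    simp⟩
  have hint : ∀ f : ℝ → ℝ, ∫ x, f x ∂μ = p * f 1 + (1 - p) * f 0 := by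
    intro f
    rw [hμ, integral_add_measure, integral_smul_measure, integral_smul_measure, integral_dirac,
      integral_dirac, ENNReal.toReal_ofReal hp0, ENNReal.toReal_ofReal (by linarith)]
    · simp
    · exact (integrable_dirac enorm_lt_top).smul_measure ENNReal.ofReal_ne_top
    · exact (integrable_dirac enorm_lt_top).smul_measure ENNReal.ofReal_ne_top
  have hmem : ∀ᵐ x ∂μ, id x ∈ Set.Icc (0 : ℝ) 1 := by
    rw [hμ, ae_add_measure_iff]
    constructor
    · exact Measure.ae_smul_measure (by simp [ae_dirac_eq]) _
    · exact Measure.ae_smul_measure (by simp [ae_dirac_eq]) _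
  have h := (hasSubgaussianMGF_of_mem_Icc (X := id) aemeasurable_id hmem).mgf_le θ
  have hmean : ∫ x, id x ∂μ = p := by rw [hint]; simp
  rw [hmean, mgf, hint] at h
  refine h.trans (Real.exp_le_exp.2 (le_of_eq ?_))
  simp
  ring

/-- Fatou's lemma for sets. It carries bounds for runs truncated at a horizon over to the infinite
runs of a sample. -/
lemma measure_eventually_le {α : Type*} [MeasurableSpace α] {μ : Measure α} {A : ℕ → Set α}
    {c : ℝ≥0∞} (h : ∀ T, μ (A T) ≤ c) : μ {x | ∀ᶠ T in Filter.atTop, x ∈ A T} ≤ c := by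
  have : {x | ∀ᶠ T in Filter.atTop, x ∈ A T} = ⋃ N, ⋂ T ≥ N, A T := by
    ext x
    simp only [Set.mem_iUnion, Set.mem_iInter]
    exact Filter.eventually_atTop
  rw [this, Monotone.measure_iUnion]
  · exact iSup_le fun N => (measure_mono (Set.biInter_subset_of_mem (le_refl N))).trans (h N)
  · intro N M hNM x hx
    simp only [Set.mem_iInter] at hx ⊢
    exact fun T hT => hx T (hNM.trans hT)

/-- The product of the factors `g h (x i)`, where the parameter `h` evolves with `x`. -/
def seqProd {κ V : Type*} (g : κ → V → ℝ≥0∞) (u : κ → V → κ) :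
    (n : ℕ) → κ → (Fin n → V) → ℝ≥0∞
  | 0, _, _ => 1
  | n + 1, h, x => g h (x 0) * seqProd g u n (u h (x 0)) (Fin.tail x)

/-- Fix the first coordinate: the remaining product has mean at most one for every value of the
updated parameter, and then so does the first factor. The parameter may thus depend on the past in
any way. -/
lemma sum_prod_mul_seqProd_le_one {κ V : Type*} [Fintype V] {ρ : V → ℝ≥0∞}
    {g : κ → V → ℝ≥0∞} (u : κ → V → κ) (hg : ∀ h, ∑ v, ρ v * g h v ≤ 1) (n : ℕ) :
    ∀ h, ∑ x : Fin n → V, (∏ i, ρ (x i)) * seqProd g u n h x ≤ 1 := by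
  induction n with
  | zero => intro h; simp [seqProd]
  | succ n ih =>
    intro h
    rw [← (Fin.consEquiv fun _ : Fin (n + 1) => V).sum_comp, Fintype.sum_prod_type]
    refine le_trans (Finset.sum_le_sum fun v _ => ?_) (hg h)
    have : ∀ x : Fin n → V, (∏ i, ρ ((Fin.consEquiv fun _ : Fin (n + 1) => V) (v, x) i)) *
        seqProd g u (n + 1) h ((Fin.consEquiv fun _ : Fin (n + 1) => V) (v, x)) =
          (ρ v * g h v) * ((∏ i, ρ (x i)) * seqProd g u n (u h v) x) := by
      intro x
      have ht : Fin.tail ((Fin.consEquiv fun _ : Fin (n + 1) => V) (v, x)) = x := rfl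
      rw [Fin.prod_univ_succ, seqProd, ht]
      simp only [Fin.consEquiv_apply, Fin.cons_zero, Fin.cons_succ]
      ring
    simp only [this, ← Finset.mul_sum]
    exact mul_le_of_le_one_right' (ih _)

lemma lintegral_seqProd_le_one {κ V Ω : Type*} [MeasurableSpace Ω] {P : Measure Ω}
    [IsProbabilityMeasure P] [Finite V] [MeasurableSpace V] [DiscreteMeasurableSpace V]
    {r : Ω → V} (hr : Measurable r) {g : κ → V → ℝ≥0∞} (u : κ → V → κ)
    (hg : ∀ h, ∫⁻ ω, g h (r ω) ∂P ≤ 1) (n : ℕ) (h : κ) :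
    ∫⁻ D, seqProd g u n h (fun i => r (D i)) ∂(Measure.pi fun _ : Fin n => P) ≤ 1 := by
  classical
  have := Fintype.ofFinite V
  have : IsProbabilityMeasure (P.map r) := Measure.isProbabilityMeasure_map hr.aemeasurable
  have h1 := Measure.pi_map_pi (μ := fun _ : Fin n => P) (f := fun _ => r)
    (hμ := fun _ => inferInstance) fun _ => hr.aemeasurable
  have hm : Measurable fun (D : Fin n → Ω) i => r (D i) :=
    measurable_pi_lambda _ fun i => hr.comp (measurable_pi_apply i)
  rw [← lintegral_map (f := seqProd g u n h) (measurable_of_finite _) hm, h1, lintegral_fintype]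
  refine le_trans (le_of_eq (Finset.sum_congr rfl fun x _ => ?_))
    (sum_prod_mul_seqProd_le_one (ρ := fun v => P.map r {v}) (g := g) u (fun h => ?_) n h)
  · rw [Measure.pi_singleton, mul_comm]
  · refine le_trans (le_of_eq ?_) (hg h)
    rw [← lintegral_map (f := g h) (measurable_of_finite _) hr, lintegral_fintype]
    exact Finset.sum_congr rfl fun v _ => mul_comm _ _

namespace ICGame

variable {S A₁ A₂ : Type*}

open scoped Classical in
/-- The actions of Player 2 at the visits to `s`. -/
def visitActs (s : S) (l : List (Step S A₁ A₂)) : List A₂ :=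
  (l.filter fun x => x.state = s).map Step.act₂

@[simp] lemma visitActs_nil (s : S) : visitActs s ([] : List (Step S A₁ A₂)) = [] := rfl

lemma visitActs_append (s : S) (l l' : List (Step S A₁ A₂)) :
    visitActs s (l ++ l') = visitActs s l ++ visitActs s l' := by
  simp [visitActs]

lemma visitActs_cons_of_eq {s : S} {x : Step S A₁ A₂} (h : x.state = s)
    (l : List (Step S A₁ A₂)) : visitActs s (x :: l) = x.act₂ :: visitActs s l := by
  simp [visitActs, h]

lemma visitActs_cons_of_ne {s : S} {x : Step S A₁ A₂} (h : x.state ≠ s)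
    (l : List (Step S A₁ A₂)) : visitActs s (x :: l) = visitActs s l := by
  simp [visitActs, h]

/-- The first `T` stages of the runs of a sample, one run after the other. -/
def allSteps (T : ℕ) {n : ℕ} (D : Fin n → ℕ → Step S A₁ A₂) : List (Step S A₁ A₂) :=
  (List.ofFn fun i => runPrefix T (D i)).flatten

/-- The first `T` times of `n` runs, in order. -/
def allTimes (n T : ℕ) : List (Fin n ×ₗ ℕ) :=
  (List.ofFn fun i : Fin n => (List.range T).map fun t => toLex (i, t)).flatten

lemma mem_allTimes {n T : ℕ} (v : Fin n ×ₗ ℕ) : v ∈ allTimes n T ↔ (ofLex v).2 < T := by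
  simp only [allTimes, List.mem_flatten, List.mem_ofFn]
  constructor
  · rintro ⟨_, ⟨i, rfl⟩, h⟩
    obtain ⟨t, ht, rfl⟩ := List.mem_map.1 h
    exact List.mem_range.1 ht
  · intro h
    exact ⟨_, ⟨(ofLex v).1, rfl⟩, List.mem_map.2 ⟨(ofLex v).2, List.mem_range.2 h, rfl⟩⟩

lemma pairwise_allTimes (n T : ℕ) : (allTimes n T).Pairwise (· < ·) := by
  rw [allTimes, List.pairwise_flatten]
  refine ⟨fun l hl => ?_, ?_⟩
  · obtain ⟨i, rfl⟩ := List.mem_ofFn.1 hl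
    rw [List.pairwise_map]
    refine List.pairwise_lt_range.imp fun {t t'} h => ?_
    rw [Prod.Lex.lt_iff]
    exact Or.inr ⟨rfl, h⟩
  · rw [List.pairwise_ofFn]
    intro i j hij x hx y hy
    obtain ⟨t, _, rfl⟩ := List.mem_map.1 hx
    obtain ⟨t', _, rfl⟩ := List.mem_map.1 hy
    rw [Prod.Lex.lt_iff]
    exact Or.inl hij

lemma allSteps_eq_map (T : ℕ) {n : ℕ} (D : Fin n → ℕ → Step S A₁ A₂) :
    allSteps T D = (allTimes n T).map fun v => D (ofLex v).1 (ofLex v).2 := by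
  rw [allSteps, allTimes, List.map_flatten, List.map_ofFn]
  congr 2
  funext i
  simp only [runPrefix, Function.comp, List.map_map]
  apply List.ext_getElem <;> simp

/-- The visits to `s` in the first `T` stages of the runs. -/
lemma visitActs_allSteps_eq_map [DecidableEq S] (s : S) (T : ℕ) {n : ℕ}
    (D : Fin n → ℕ → Step S A₁ A₂) : visitActs s (allSteps T D) =
      ((allTimes n T).filter fun v => (D (ofLex v).1 (ofLex v).2).state = s).map
        fun v => (D (ofLex v).1 (ofLex v).2).act₂ := by
  rw [visitActs, allSteps_eq_map, List.filter_map, List.map_map]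
  congr 2
  funext v
  simp [Function.comp]

/-- A longer horizon inserts stages in the middle of the concatenated list, at the end of each run.
Once the horizon exceeds the times of the first `m` visits this is harmless, since every other visit
comes after these. -/
lemma IsFirstVisits.eventually_take_visitActs {n m : ℕ} {D : Fin n → ℕ → Step S A₁ A₂} {s : S}
    {v : Fin m → Fin n ×ₗ ℕ} (hv : IsFirstVisits D s v) : ∀ᶠ T in Filter.atTop,
      (visitActs s (allSteps T D)).take m =
        List.ofFn fun k => (D (ofLex (v k)).1 (ofLex (v k)).2).act₂ := by
  classical
  obtain ⟨T₀, hT₀⟩ := Finite.exists_le fun k => (ofLex (v k)).2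
  filter_upwards [Filter.eventually_gt_atTop T₀] with T hT
  have hmem : ∀ k, v k ∈ allTimes n T := fun k => (mem_allTimes _).2 ((hT₀ k).trans_lt hT)
  set l := (allTimes n T).filter fun v => (D (ofLex v).1 (ofLex v).2).state = s with hl
  have hlp : l.Pairwise (· < ·) := (pairwise_allTimes n T).filter _
  have hln : l.Nodup := hlp.imp fun h => h.ne
  have hvl : ∀ k, v k ∈ l := fun k => List.mem_filter.2 ⟨hmem k, decide_eq_true (hv.2.1 k)⟩
  have hvp : (List.ofFn v).Pairwise (· < ·) := List.pairwise_ofFn.2 fun i j hij => hv.1 hij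
  set l₂ := l.filter fun u => u ∉ Set.range v with hl₂
  have hl₂p : l₂.Pairwise (· < ·) := hlp.filter _
  have happ : (List.ofFn v ++ l₂).Pairwise (· < ·) := by
    rw [List.pairwise_append]
    refine ⟨hvp, hl₂p, fun a ha b hb => ?_⟩
    obtain ⟨k, rfl⟩ := List.mem_ofFn.1 ha
    obtain ⟨hb1, hb2⟩ := List.mem_filter.1 hb
    have hbs : b ∈ visits D s := of_decide_eq_true (List.mem_filter.1 hb1).2
    exact (hv.2.2 b hbs).resolve_left (by simpa using hb2) k
  have heq : l = List.ofFn v ++ l₂ := by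
    refine List.Perm.eq_of_pairwise' hlp happ ?_
    rw [List.perm_ext_iff_of_nodup hln (happ.imp fun h => h.ne)]
    intro u
    rw [List.mem_append, hl₂, List.mem_filter (as := l), List.mem_ofFn]
    constructor
    · intro hu
      by_cases h : u ∈ Set.range v
      · exact Or.inl h
      · exact Or.inr ⟨hu, by simpa using h⟩
    · rintro (⟨k, rfl⟩ | h)
      · exact hvl k
      · exact h.1
  rw [visitActs_allSteps_eq_map, ← hl, heq, List.map_append, List.map_ofFn,
    List.take_left' (by simp)]
  rfl

/-- The lexicographic order on pairs (run, time) is a well-order, so there is always a least visit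
not yet listed. A run with infinitely many visits can exhaust the list before later runs are looked
at. -/
lemma exists_isFirstVisits {n : ℕ} {D : Fin n → ℕ → Step S A₁ A₂} {s : S} (m : ℕ)
    (h : (m : ℕ∞) ≤ (visits D s).encard) : ∃ v : Fin m → Fin n ×ₗ ℕ, IsFirstVisits D s v := by
  induction m with
  | zero => exact ⟨Fin.elim0, fun k => k.elim0, fun k => k.elim0, fun u _ => Or.inr fun k => k.elim0⟩
  | succ m ih =>
    obtain ⟨v, hv⟩ := ih ((by exact_mod_cast Nat.le_succ m : (m : ℕ∞) ≤ (m + 1 : ℕ)).trans h)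
    have hne : (visits D s \ Set.range v).Nonempty := by
      by_contra hcon
      have hsub := Set.sdiff_eq_empty.1 (Set.not_nonempty_iff_eq_empty.1 hcon)
      have h1 := h.trans (Set.encard_le_encard hsub)
      have h2 : (Set.range v).encard ≤ m := by
        rw [← Set.image_univ]
        refine (Set.encard_image_le _ _).trans ?_
        simp
      exact absurd (h1.trans h2) (by exact_mod_cast Nat.not_succ_le_self m)
    have hwf : WellFounded ((· < ·) : Fin n ×ₗ ℕ → Fin n ×ₗ ℕ → Prop) := wellFounded_lt
    set u₀ := hwf.min _ hne with hu₀
    have hu₀m : u₀ ∈ visits D s \ Set.range v := hwf.min_mem _ hne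
    have hlt : ∀ k, v k < u₀ := (hv.2.2 u₀ hu₀m.1).resolve_left hu₀m.2
    refine ⟨Fin.snoc v u₀, ?_, ?_, ?_⟩
    · intro i j hij
      induction j using Fin.lastCases with
      | last =>
        induction i using Fin.lastCases with
        | last => exact absurd hij (lt_irrefl _)
        | cast i => simpa using hlt i
      | cast j =>
        induction i using Fin.lastCases with
        | last => exact absurd hij (not_lt.2 (Fin.le_last _))
        | cast i => simpa using hv.1 (by simpa using hij)
    · intro k
      induction k using Fin.lastCases with
      | last => simpa using hu₀m.1
      | cast k => simpa using hv.2.1 k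
    · intro u hu
      by_cases hur : u ∈ Set.range (Fin.snoc (α := fun _ => Fin n ×ₗ ℕ) v u₀)
      · exact Or.inl hur
      right
      have hne' : u ≠ u₀ := fun h => hur ⟨Fin.last m, by simp [h]⟩
      have hnv : u ∉ Set.range v := by
        rintro ⟨k, rfl⟩
        exact hur ⟨k.castSucc, by simp⟩
      have hlt' : u₀ < u := lt_of_le_of_ne (not_lt.1 (hwf.not_lt_min (x := u) _ (show u ∈ visits D s \ Set.range v from ⟨hu, hnv⟩))) hne'.symm
      intro k
      induction k using Fin.lastCases with
      | last => simpa using hlt'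
      | cast k => simpa using (hlt k).trans hlt'

/-- Up to a long horizon, a state has `m` visits if and only if it has `m` visits in the runs. -/
lemma eventually_le_length_visitActs_iff {n : ℕ} (D : Fin n → ℕ → Step S A₁ A₂) (s : S) (m : ℕ) :
    ∀ᶠ T in Filter.atTop,
      ((m : ℕ∞) ≤ (visits D s).encard ↔ m ≤ (visitActs s (allSteps T D)).length) := by
  classical
  have hle : ∀ T, ((visitActs s (allSteps T D)).length : ℕ∞) ≤ (visits D s).encard := by
    intro T
    rw [visitActs_allSteps_eq_map, List.length_map]
    have hn : ((allTimes n T).filter fun v => (D (ofLex v).1 (ofLex v).2).state = s).Nodup :=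
      ((pairwise_allTimes n T).filter _).imp fun h => h.ne
    rw [← List.toFinset_card_of_nodup hn, ← Set.encard_coe_eq_coe_finsetCard]
    refine Set.encard_le_encard fun v hv => ?_
    simp only [List.coe_toFinset] at hv
    exact of_decide_eq_true (List.mem_filter.1 hv).2
  by_cases h : (m : ℕ∞) ≤ (visits D s).encard
  · obtain ⟨v, hv⟩ := exists_isFirstVisits m h
    filter_upwards [hv.eventually_take_visitActs] with T hT
    refine ⟨fun _ => ?_, fun _ => h⟩
    have := congrArg List.length hT
    rw [List.length_take, List.length_ofFn] at this
    omega
  · exact Filter.Eventually.of_forall fun T =>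
      ⟨fun h' => absurd h' h, fun h' => (Nat.cast_le.2 h').trans (hle T)⟩

end ICGame
end

/-! ### Concentration of the empirical action distributions -/

noncomputable section

namespace ICGame

variable {S A₁ A₂ : Type*} [Fintype S] [Fintype A₁] [Fintype A₂]

lemma sum_weights (G : ICGame S A₁ A₂) (s : S) (p : PMF A₁) (σ : PMF A₂) (f : A₂ → ℝ≥0∞) :
    ∑ a, ∑ b, ∑ q, p a * σ b * G.trans s a b q * f b = ∑ b, σ b * f b := by
  have h : ∀ a b, ∑ q, p a * σ b * G.trans s a b q * f b = p a * (σ b * f b) := by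
    intro a b
    rw [← Finset.sum_mul, ← Finset.mul_sum, sum_pmf, mul_one, mul_assoc]
  simp only [h, ← Finset.mul_sum, ← Finset.sum_mul, sum_pmf, one_mul]

/-- A product over the first visits to `s` is a supermartingale if its factors have mean at most
one. -/
lemma lintegral_prod_take_visitActs_le (G : ICGame S A₁ A₂) (σ : StationaryPolicy G.avail₂) (s : S)
    {φ : A₂ → ℝ≥0∞} (hφ : ∑ b, σ.dist s b * φ b ≤ 1) (T : ℕ) :
    ∀ (r : ℕ) (π₁ : G.Policy₁) (q : S),
      ∫⁻ γ, (((visitActs s (runPrefix T γ)).take r).map φ).prod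
        ∂(G.runLaw π₁ (σ.toPolicy A₁ A₂) q) ≤ 1 := by
  induction T with
  | zero => intro r π₁ q; simp
  | succ T ih =>
    intro r π₁ q
    rw [lintegral_runLaw _ _ _ _ (measurable_runPrefix (T + 1) fun l =>
      (((visitActs s l).take r).map φ).prod)]
    simp only [runPrefix_succ_consRun]
    -- A new factor appears only at a visit to `s` while some of the `r` factors are left. Its mean
    -- is at most one because Player 2's action at `s` has law `σ.dist s` independently of the past.
    by_cases hq : q = s ∧ r ≠ 0
    · obtain ⟨rfl, hr⟩ := hq
      obtain ⟨r, rfl⟩ := Nat.exists_eq_succ_of_ne_zero hr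
      refine le_trans (Finset.sum_le_sum fun a _ => Finset.sum_le_sum fun b _ =>
        Finset.sum_le_sum fun q' _ => ?_) ((sum_weights G q (π₁.act [] q)
          ((σ.toPolicy A₁ A₂).act [] q) φ).trans_le hφ)
      refine mul_le_mul_right ?_ _
      have : ∀ γ : ℕ → Step S A₁ A₂,
          (((visitActs q (⟨q, a, b⟩ :: runPrefix T γ)).take (r + 1)).map φ).prod =
          φ b * (((visitActs q (runPrefix T γ)).take r).map φ).prod := by
        intro γ
        rw [visitActs_cons_of_eq (x := ⟨q, a, b⟩) rfl]
        simp
      simp only [Nat.succ_eq_add_one, this]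
      rw [lintegral_const_mul _ (measurable_runPrefix T fun l =>
        (((visitActs q l).take r).map φ).prod)]
      exact mul_le_of_le_one_right' (ih r _ q')
    · refine le_trans (Finset.sum_le_sum fun a _ => Finset.sum_le_sum fun b _ =>
        Finset.sum_le_sum fun q' _ => ?_) (((sum_weights G q (π₁.act [] q)
          ((σ.toPolicy A₁ A₂).act [] q) fun _ => 1).trans (by simp [sum_pmf])).le)
      refine mul_le_mul_right ?_ _
      have : ∀ γ : ℕ → Step S A₁ A₂,
          (((visitActs s (⟨q, a, b⟩ :: runPrefix T γ)).take r).map φ).prod =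
          (((visitActs s (runPrefix T γ)).take r).map φ).prod := by
        intro γ
        by_cases hr : r = 0
        · simp [hr]
        · rw [visitActs_cons_of_ne (by simpa using fun h => hq ⟨h, hr⟩)]
      simp only [this]
      exact ih r _ q'

omit [Fintype S] [Fintype A₁] [Fintype A₂] in
-- The parameter handed from run to run is the number of factors still to be used; truncated
-- subtraction stops the product after `m` visits.
lemma seqProd_take_visitActs (s : S) (φ : A₂ → ℝ≥0∞) (T n : ℕ) : ∀ (r : ℕ)
    (x : Fin n → Fin T → Step S A₁ A₂),
    seqProd (fun r v => (((visitActs s (List.ofFn v)).take r).map φ).prod)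
      (fun r v => r - (visitActs s (List.ofFn v)).length) n r x =
        (((visitActs s (List.ofFn fun i => List.ofFn (x i)).flatten).take r).map φ).prod := by
  induction n with
  | zero => intro r x; simp [seqProd]
  | succ n ih =>
    intro r x
    rw [seqProd, ih, List.ofFn_succ, List.flatten_cons, visitActs_append, List.take_append,
      List.map_append, List.prod_append]
    rfl

lemma lintegral_prod_take_visitActs_allSteps_le (G : ICGame S A₁ A₂)
    (σ : StationaryPolicy G.avail₂) (s : S) {φ : A₂ → ℝ≥0∞} (hφ : ∑ b, σ.dist s b * φ b ≤ 1)
    (T m n : ℕ) : ∫⁻ D, (((visitActs s (allSteps T D)).take m).map φ).prod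
      ∂(G.sampleLaw (σ.toPolicy A₁ A₂) n) ≤ 1 := by
  have := lintegral_seqProd_le_one (P := G.runLaw G.averagePolicy (σ.toPolicy A₁ A₂) G.init)
    (r := fun γ (i : Fin T) => γ i) (measurable_runPrefix_fin T)
    (g := fun r v => (((visitActs s (List.ofFn v)).take r).map φ).prod)
    (fun r v => r - (visitActs s (List.ofFn v)).length)
    (fun r => lintegral_prod_take_visitActs_le G σ s hφ T r _ _) n m
  simp only [seqProd_take_visitActs] at this
  exact this

/-- The distribution of a uniformly random term of a finite sequence. -/
def empirical {A : Type*} {m : ℕ} [NeZero m] (f : Fin m → A) : PMF A :=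
  (PMF.uniformOfFintype (Fin m)).map f

lemma empirical_apply {A : Type*} [DecidableEq A] {m : ℕ} [NeZero m] (f : Fin m → A) (b : A) :
    (empirical f b).toReal = (Finset.univ.filter fun k => f k = b).card / m := by
  rw [empirical, PMF.map_apply, tsum_fintype]
  simp only [PMF.uniformOfFintype_apply, Fintype.card_fin]
  rw [ENNReal.toReal_sum (by intro k _; split_ifs <;> simp [NeZero.ne m])]
  rw [Finset.card_filter, Nat.cast_sum, Finset.sum_div]
  refine Finset.sum_congr rfl fun k _ => ?_
  by_cases h : f k = b
  · simp [h]
  · simp [h, Ne.symm h]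

lemma sum_empirical_mul {A : Type*} [Fintype A] {m : ℕ} [NeZero m] (f : Fin m → A) (g : A → ℝ) :
    ∑ b, (empirical f b).toReal * g b = (∑ k, g (f k)) / m := by
  classical
  simp only [empirical_apply, div_mul_eq_mul_div, ← Finset.sum_div]
  congr 1
  rw [← Finset.sum_fiberwise Finset.univ f]
  refine Finset.sum_congr rfl fun b _ => ?_
  rw [Finset.sum_congr rfl fun k hk => by rw [(Finset.mem_filter.1 hk).2], Finset.sum_const,
    nsmul_eq_mul]

/-- The empirical distribution of the first `m` actions at `s` seldom puts much more weight on `B`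
than the policy of Player 2. -/
lemma sampleLaw_empirical_gt_le (G : ICGame S A₁ A₂) (σ : StationaryPolicy G.avail₂) (s : S)
    (B : Finset A₂) (m n : ℕ) [NeZero m] {t : ℝ} (ht : 0 ≤ t) :
    G.sampleLaw (σ.toPolicy A₁ A₂) n {D | ∃ v : Fin m → Fin n ×ₗ ℕ, IsFirstVisits D s v ∧
      t < ∑ b ∈ B, ((empirical (fun k => (D (ofLex (v k)).1 (ofLex (v k)).2).act₂) b).toReal -
        (σ.dist s b).toReal)} ≤ ENNReal.ofReal (Real.exp (-(2 * m * t ^ 2))) := by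
  classical
  have hm0 : (0 : ℝ) < m := by exact_mod_cast Nat.pos_of_ne_zero (NeZero.ne m)
  set p := ∑ b ∈ B, (σ.dist s b).toReal with hp
  have hp0 : 0 ≤ p := Finset.sum_nonneg fun _ _ => ENNReal.toReal_nonneg
  have hp1 : p ≤ 1 := by
    rw [← sum_pmf_toReal (σ.dist s)]
    exact Finset.sum_le_univ_sum_of_nonneg fun _ => ENNReal.toReal_nonneg
  -- This choice maximizes θ t - θ²/8, with value 2 t².
  set θ := 4 * t with hθ
  set e : A₂ → ℝ := fun b => (if b ∈ B then 1 else 0) with he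
  set φ : A₂ → ℝ≥0∞ := fun b => ENNReal.ofReal (Real.exp (θ * (e b - p) - θ ^ 2 / 8)) with hφdef
  have hφ : ∑ b, σ.dist s b * φ b ≤ 1 := by
    have h1 : ∀ b, σ.dist s b * φ b =
        ENNReal.ofReal ((σ.dist s b).toReal * Real.exp (θ * (e b - p) - θ ^ 2 / 8)) := by
      intro b
      rw [ENNReal.ofReal_mul ENNReal.toReal_nonneg, ENNReal.ofReal_toReal (PMF.apply_ne_top _ _)]
    simp only [h1]
    rw [← ENNReal.ofReal_sum_of_nonneg fun b _ => by positivity, ← ENNReal.ofReal_one]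
    refine ENNReal.ofReal_le_ofReal ?_
    have h2 : ∀ b, (σ.dist s b).toReal * Real.exp (θ * (e b - p) - θ ^ 2 / 8) =
        Real.exp (-(θ ^ 2 / 8)) * ((σ.dist s b).toReal * (e b * Real.exp (θ * (1 - p)) +
          (1 - e b) * Real.exp (θ * (0 - p)))) := by
      intro b
      rw [sub_eq_add_neg, Real.exp_add]
      by_cases hb : b ∈ B
      · simp only [he, if_pos hb]; ring
      · simp only [he, if_neg hb]; ring
    have h3 : ∑ b, (σ.dist s b).toReal * e b = p := by
      simp [he, hp, Finset.sum_ite_mem]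
    have h4 : ∑ b, (σ.dist s b).toReal * (e b * Real.exp (θ * (1 - p)) +
          (1 - e b) * Real.exp (θ * (0 - p))) =
        p * Real.exp (θ * (1 - p)) + (1 - p) * Real.exp (θ * (0 - p)) := by
      simp only [mul_add, ← mul_assoc, Finset.sum_add_distrib, ← Finset.sum_mul, mul_sub,
        Finset.sum_sub_distrib, h3, mul_one, sum_pmf_toReal]
    simp only [h2, ← Finset.mul_sum, h4]
    calc _ ≤ Real.exp (-(θ ^ 2 / 8)) * Real.exp (θ ^ 2 / 8) :=
          mul_le_mul_of_nonneg_left (mul_exp_add_mul_exp_le hp0 hp1 θ) (Real.exp_pos _).le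
      _ = 1 := by rw [← Real.exp_add]; simp
  have hT : ∀ T, G.sampleLaw (σ.toPolicy A₁ A₂) n {D | ENNReal.ofReal (Real.exp (2 * m * t ^ 2)) ≤
      (((visitActs s (allSteps T D)).take m).map φ).prod} ≤
        ENNReal.ofReal (Real.exp (-(2 * m * t ^ 2))) := by
    intro T
    have hmeas : Measurable fun D : Fin n → ℕ → Step S A₁ A₂ =>
        (((visitActs s (allSteps T D)).take m).map φ).prod := by
      have h1 : Measurable fun (D : Fin n → ℕ → Step S A₁ A₂) (i : Fin n) (j : Fin T) => D i j :=
        measurable_pi_lambda _ fun i => (measurable_runPrefix_fin T).comp (measurable_pi_apply i)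
      exact (measurable_of_finite fun x : Fin n → Fin T → Step S A₁ A₂ => (((visitActs s
        (List.ofFn fun i => List.ofFn (x i)).flatten).take m).map φ).prod).comp h1
    have h1 := mul_meas_ge_le_lintegral (μ := G.sampleLaw (σ.toPolicy A₁ A₂) n) hmeas
      (ENNReal.ofReal (Real.exp (2 * m * t ^ 2)))
    have h2 := h1.trans (lintegral_prod_take_visitActs_allSteps_le G σ s hφ T m n)
    rw [Real.exp_neg, ENNReal.ofReal_inv_of_pos (Real.exp_pos _)]
    rw [mul_comm] at h2
    exact (ENNReal.le_inv_iff_mul_le).2 h2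
  refine le_trans (measure_mono ?_) (measure_eventually_le hT)
  rintro D ⟨v, hv, hlt⟩
  change ∀ᶠ T in Filter.atTop, _
  -- For a large horizon the product runs over exactly the first `m` visits. An excess above `t`
  -- makes its exponent at least m (θ t - θ²/8) = 2 m t².
  filter_upwards [hv.eventually_take_visitActs] with T hT
  rw [hT, List.map_ofFn, List.prod_ofFn]
  simp only [Function.comp, hφdef]
  rw [← ENNReal.ofReal_prod_of_nonneg fun _ _ => (Real.exp_pos _).le, ← Real.exp_sum]
  refine ENNReal.ofReal_le_ofReal (Real.exp_le_exp.2 ?_)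
  rw [Finset.sum_sub_distrib, ← hp] at hlt
  have h5 : ∑ b ∈ B, (empirical (fun k => (D (ofLex (v k)).1 (ofLex (v k)).2).act₂) b).toReal =
      (∑ k, e (D (ofLex (v k)).1 (ofLex (v k)).2).act₂) / m := by
    rw [← sum_empirical_mul]
    simp [he, Finset.sum_ite_mem]
  rw [h5, lt_sub_iff_add_lt, lt_div_iff₀ hm0] at hlt
  rw [Finset.sum_sub_distrib, ← Finset.mul_sum, Finset.sum_sub_distrib]
  simp only [Finset.sum_const, Finset.card_univ, Fintype.card_fin, nsmul_eq_mul]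
  have h6 := mul_le_mul_of_nonneg_left hlt.le (by positivity : 0 ≤ θ)
  rw [hθ] at h6 ⊢
  nlinarith

end ICGame
end

/-! ### The average player seldom reaches insufficiently visited states -/

noncomputable section

namespace ICGame

variable {S A₁ A₂ : Type*} [Fintype S] [Fintype A₁] [Fintype A₂]

/-- The states of `W` with less than `m` visits. -/
def deficient (W : Set S) (m : ℕ) (l : List (Step S A₁ A₂)) : Set S :=
  {s | s ∈ W ∧ (visitActs s l).length < m}

/-- The number of visits that are missing for `m` visits to each state. -/
def deficit (m : ℕ) (l : List (Step S A₁ A₂)) : ℕ := ∑ s, (m - (visitActs s l).length)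

omit [Fintype S] [Fintype A₁] [Fintype A₂] in
lemma deficient_append_subset (W : Set S) (m : ℕ) (l l' : List (Step S A₁ A₂)) :
    deficient W m (l ++ l') ⊆ deficient W m l := by
  rintro s ⟨hs, h⟩
  rw [visitActs_append, List.length_append] at h
  exact ⟨hs, by omega⟩

omit [Fintype A₁] [Fintype A₂] in
lemma deficit_append_le (m : ℕ) (l l' : List (Step S A₁ A₂)) :
    deficit m (l ++ l') ≤ deficit m l := by
  refine Finset.sum_le_sum fun s _ => ?_
  rw [visitActs_append, List.length_append]
  omega

omit [Fintype A₁] [Fintype A₂] in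
lemma deficit_append_lt {W : Set S} {m : ℕ} {l l' : List (Step S A₁ A₂)}
    (h : ∃ x ∈ l', x.state ∈ deficient W m l) : deficit m (l ++ l') < deficit m l := by
  obtain ⟨x, hx, hxs, hxl⟩ := h
  refine Finset.sum_lt_sum (fun s _ => ?_) ⟨x.state, Finset.mem_univ _, ?_⟩
  · rw [visitActs_append, List.length_append]
    omega
  · have : 0 < (visitActs x.state l').length := by
      rw [visitActs, List.length_map, List.length_pos_iff_exists_mem]
      exact ⟨x, List.mem_filter.2 ⟨hx, by simp⟩⟩
    rw [visitActs_append, List.length_append]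
    omega

/-- The probability that a run of the average player hits `U` before the horizon. -/
def hitProb (G : ICGame S A₁ A₂) (π₂ : G.Policy₂) (T : ℕ) (U : Set S) : ℝ :=
  (G.runLaw G.averagePolicy π₂ G.init).real {γ | ∃ x ∈ runPrefix T γ, x.state ∈ U}

lemma hitProb_mono (G : ICGame S A₁ A₂) (π₂ : G.Policy₂) (T : ℕ) {U U' : Set S} (h : U ⊆ U') :
    G.hitProb π₂ T U ≤ G.hitProb π₂ T U' :=
  measureReal_mono fun _ ⟨x, hx, hU⟩ => ⟨x, hx, h hU⟩

omit [Fintype S] [Fintype A₁] [Fintype A₂] in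
lemma exists_mem_runPrefix_iff {T : ℕ} {γ : ℕ → Step S A₁ A₂} {U : Set S} :
    (∃ x ∈ runPrefix T γ, x.state ∈ U) ↔ ∃ t < T, (γ t).state ∈ U := by
  simp only [runPrefix, List.mem_ofFn]
  constructor
  · rintro ⟨_, ⟨i, rfl⟩, h⟩
    exact ⟨i, i.2, h⟩
  · rintro ⟨t, ht, h⟩
    exact ⟨_, ⟨⟨t, ht⟩, rfl⟩, h⟩

lemma tendsto_hitProb (G : ICGame S A₁ A₂) (π₂ : G.Policy₂) (U : Set S) :
    Filter.Tendsto (fun T => G.hitProb π₂ T U) Filter.atTop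
      (nhds ((G.runLaw G.averagePolicy π₂ G.init).real (reach U))) := by
  have : (reach U : Set (ℕ → Step S A₁ A₂)) =
      ⋃ T, {γ | ∃ x ∈ runPrefix T γ, x.state ∈ U} := by
    ext γ
    rw [Set.mem_iUnion]
    change (∃ t, (γ t).state ∈ U) ↔ ∃ T, ∃ x ∈ runPrefix T γ, x.state ∈ U
    simp only [exists_mem_runPrefix_iff]
    exact ⟨fun ⟨t, ht⟩ => ⟨t + 1, t, t.lt_succ_self, ht⟩, fun ⟨_, t, _, ht⟩ => ⟨t, ht⟩⟩
  rw [this]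
  refine (ENNReal.tendsto_toReal (measure_ne_top _ _)).comp
    (tendsto_measure_iUnion_atTop fun T T' hT γ => ?_)
  change (∃ x ∈ runPrefix T γ, x.state ∈ U) → ∃ x ∈ runPrefix T' γ, x.state ∈ U
  simp only [exists_mem_runPrefix_iff]
  exact fun ⟨t, ht, h⟩ => ⟨t, ht.trans_le hT, h⟩

open scoped Classical in
/-- The exponential supermartingale factor for the event that a run visits a deficient state. -/
def hitFactor (G : ICGame S A₁ A₂) (π₂ : G.Policy₂) (W : Set S) (m T : ℕ) (θ : ℝ)
    (h l : List (Step S A₁ A₂)) : ℝ≥0∞ :=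
  ENNReal.ofReal (Real.exp (θ * (G.hitProb π₂ T (deficient W m h) -
    if ∃ x ∈ l, x.state ∈ deficient W m h then 1 else 0) - θ ^ 2 / 8))

/-- Given the earlier runs `h`, a hit is a Bernoulli variable with mean `hitProb`, so Hoeffding's
lemma applies with parameter -θ. -/
lemma lintegral_hitFactor_le (G : ICGame S A₁ A₂) (π₂ : G.Policy₂) (W : Set S) (m T : ℕ) (θ : ℝ)
    (h : List (Step S A₁ A₂)) : ∫⁻ γ, G.hitFactor π₂ W m T θ h (runPrefix T γ)
      ∂(G.runLaw G.averagePolicy π₂ G.init) ≤ 1 := by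
  classical
  set q := G.hitProb π₂ T (deficient W m h) with hq
  set P := G.runLaw G.averagePolicy π₂ G.init with hP
  set B : Set (ℕ → Step S A₁ A₂) := {γ | ∃ x ∈ runPrefix T γ, x.state ∈ deficient W m h} with hB
  have hBm : MeasurableSet B := measurableSet_runPrefix T fun l => ∃ x ∈ l, x.state ∈ deficient W m h
  have hq' : P.real B = q := rfl
  have hq0 : 0 ≤ q := measureReal_nonneg
  have hq1 : q ≤ 1 := measureReal_le_one
  have h1 : ∀ γ, G.hitFactor π₂ W m T θ h (runPrefix T γ) =
      B.indicator (fun _ => ENNReal.ofReal (Real.exp (θ * (q - 1) - θ ^ 2 / 8))) γ +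
        Bᶜ.indicator (fun _ => ENNReal.ofReal (Real.exp (θ * q - θ ^ 2 / 8))) γ := by
    intro γ
    rw [hitFactor]
    by_cases hγ : γ ∈ B
    · have hγ' : ∃ x ∈ runPrefix T γ, x.state ∈ deficient W m h := hγ
      rw [if_pos hγ', Set.indicator_of_mem hγ, Set.indicator_of_notMem (by simpa using hγ), add_zero]
    · have hγ' : ¬ ∃ x ∈ runPrefix T γ, x.state ∈ deficient W m h := hγ
      rw [if_neg hγ', Set.indicator_of_notMem hγ, Set.indicator_of_mem hγ, zero_add, sub_zero]
  simp only [h1]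
  rw [lintegral_add_left (measurable_const.indicator hBm), lintegral_indicator hBm,
    lintegral_indicator hBm.compl, setLIntegral_const, setLIntegral_const, ← ofReal_measureReal,
    ← ofReal_measureReal, probReal_compl_eq_one_sub hBm, hq',
    ← ENNReal.ofReal_mul (Real.exp_pos _).le, ← ENNReal.ofReal_mul (Real.exp_pos _).le,
    ← ENNReal.ofReal_add (by positivity) (mul_nonneg (Real.exp_pos _).le (by linarith)),
    ← ENNReal.ofReal_one]
  refine ENNReal.ofReal_le_ofReal ?_
  have h2 := mul_exp_add_mul_exp_le hq0 hq1 (-θ)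
  have h3 : Real.exp (θ * (q - 1) - θ ^ 2 / 8) * q + Real.exp (θ * q - θ ^ 2 / 8) * (1 - q) =
      Real.exp (-(θ ^ 2 / 8)) *
        (q * Real.exp (-θ * (1 - q)) + (1 - q) * Real.exp (-θ * (0 - q))) := by
    rw [sub_eq_add_neg, Real.exp_add, sub_eq_add_neg (θ * q), Real.exp_add]
    ring_nf
  rw [h3]
  calc _ ≤ Real.exp (-(θ ^ 2 / 8)) * Real.exp ((-θ) ^ 2 / 8) :=
        mul_le_mul_of_nonneg_left h2 (Real.exp_pos _).le
    _ = 1 := by rw [← Real.exp_add]; simp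

/-- The deficient set only shrinks, so if it is hit with probability at least `q₀` in the end, it
was so before each run. Every hit lowers the deficit by at least one, hence there are at most
`deficit m h` hits in all. -/
lemma le_seqProd_hitFactor (G : ICGame S A₁ A₂) (π₂ : G.Policy₂) (W : Set S) (m T : ℕ) {θ : ℝ}
    (hθ : 0 ≤ θ) {q₀ : ℝ} (n : ℕ) : ∀ (h : List (Step S A₁ A₂)) (x : Fin n → Fin T → Step S A₁ A₂),
    q₀ ≤ G.hitProb π₂ T (deficient W m (h ++ (List.ofFn fun i => List.ofFn (x i)).flatten)) →
      ENNReal.ofReal (Real.exp (θ * (n * q₀ - deficit m h) - n * (θ ^ 2 / 8))) ≤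
        seqProd (fun h v => G.hitFactor π₂ W m T θ h (List.ofFn v)) (fun h v => h ++ List.ofFn v)
          n h x := by
  classical
  induction n with
  | zero =>
    intro h x _
    rw [seqProd, ← ENNReal.ofReal_one]
    refine ENNReal.ofReal_le_ofReal (Real.exp_le_one_iff.2 ?_)
    have : 0 ≤ θ * deficit m h := by positivity
    push_cast
    linarith
  | succ n ih =>
    intro h x hx
    rw [List.ofFn_succ, List.flatten_cons, ← List.append_assoc] at hx
    have h1 := ih (h ++ List.ofFn (x 0)) (Fin.tail x) hx
    rw [seqProd]
    refine le_trans ?_ (mul_le_mul_right h1 _)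
    rw [hitFactor, ← ENNReal.ofReal_mul (Real.exp_pos _).le, ← Real.exp_add]
    refine ENNReal.ofReal_le_ofReal (Real.exp_le_exp.2 ?_)
    have h2 : q₀ ≤ G.hitProb π₂ T (deficient W m h) := hx.trans (G.hitProb_mono _ _
      ((deficient_append_subset _ _ _ _).trans (deficient_append_subset _ _ _ _)))
    have h3 : (deficit m (h ++ List.ofFn (x 0)) : ℝ) +
        (if ∃ y ∈ List.ofFn (x 0), y.state ∈ deficient W m h then 1 else 0) ≤ deficit m h := by
      split_ifs with hc
      · exact_mod_cast deficit_append_lt hc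
      · rw [add_zero]
        exact_mod_cast deficit_append_le m h _
    have h4 : θ * ((n + 1) * q₀ - deficit m h) ≤ θ * (G.hitProb π₂ T (deficient W m h) -
        (if ∃ y ∈ List.ofFn (x 0), y.state ∈ deficient W m h then 1 else 0)) +
          θ * (n * q₀ - deficit m (h ++ List.ofFn (x 0))) := by
      rw [← mul_add]
      refine mul_le_mul_of_nonneg_left ?_ hθ
      linarith
    push_cast
    linarith

/-- The average player seldom has a large probability of reaching the states of `W` that are
visited less than `m` times in the sample. -/
lemma sampleLaw_lt_reach_le (G : ICGame S A₁ A₂) (π₂ : G.Policy₂) (W : Set S) {m n : ℕ}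
    {q₀ : ℝ} (hq₀ : Fintype.card S * m ≤ n * q₀) :
    G.sampleLaw π₂ n {D | q₀ < (G.runLaw G.averagePolicy π₂ G.init).real
      (reach {s | s ∈ W ∧ ¬ (m : ℕ∞) ≤ (visits D s).encard})} ≤
        ENNReal.ofReal (Real.exp (-(2 * (n * q₀ - Fintype.card S * m) ^ 2 / n))) := by
  classical
  -- With x = n q₀ - S m, this maximizes θ x - n θ²/8, with value 2x²/n. For `n = 0` the division
  -- convention makes θ and the exponent zero.
  set θ : ℝ := 4 * (n * q₀ - Fintype.card S * m) / n with hθdef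
  have hθ : 0 ≤ θ := div_nonneg (by linarith) (Nat.cast_nonneg n)
  set c : ℝ := 2 * (n * q₀ - Fintype.card S * m) ^ 2 / n with hc
  have hexp : c ≤ θ * (n * q₀ - Fintype.card S * m) - n * (θ ^ 2 / 8) := by
    rcases Nat.eq_zero_or_pos n with rfl | hn
    · simp [hc, hθdef]
    · have hn' : (0 : ℝ) < n := by exact_mod_cast hn
      rw [hc, hθdef]
      apply le_of_eq
      field_simp
      ring
  set g : List (Step S A₁ A₂) → ∀ T : ℕ, (Fin T → Step S A₁ A₂) → ℝ≥0∞ :=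
    fun h T v => G.hitFactor π₂ W m T θ h (List.ofFn v) with hg
  set F : ℕ → (Fin n → ℕ → Step S A₁ A₂) → ℝ≥0∞ := fun T D =>
    seqProd (fun h v => g h T v) (fun h v => h ++ List.ofFn v) n [] fun i j => D i j with hF
  have hT : ∀ T, G.sampleLaw π₂ n {D | ENNReal.ofReal (Real.exp c) ≤ F T D} ≤
      ENNReal.ofReal (Real.exp (-c)) := by
    intro T
    have hmeas : Measurable (F T) := by
      have h1 : Measurable fun (D : Fin n → ℕ → Step S A₁ A₂) (i : Fin n) (j : Fin T) => D i j :=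
        measurable_pi_lambda _ fun i => (measurable_runPrefix_fin T).comp (measurable_pi_apply i)
      exact (measurable_of_finite fun x : Fin n → Fin T → Step S A₁ A₂ =>
        seqProd (fun h v => g h T v) (fun h v => h ++ List.ofFn v) n [] x).comp h1
    have h1 := mul_meas_ge_le_lintegral (μ := G.sampleLaw π₂ n) hmeas (ENNReal.ofReal (Real.exp c))
    have h2 : ∫⁻ D, F T D ∂(G.sampleLaw π₂ n) ≤ 1 :=
      lintegral_seqProd_le_one (P := G.runLaw G.averagePolicy π₂ G.init)
        (r := fun γ (i : Fin T) => γ i) (measurable_runPrefix_fin T)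
        (g := fun h v => g h T v) (fun h v => h ++ List.ofFn v)
        (fun h => G.lintegral_hitFactor_le π₂ W m T θ h) n []
    rw [Real.exp_neg, ENNReal.ofReal_inv_of_pos (Real.exp_pos _)]
    rw [mul_comm] at h1
    exact (ENNReal.le_inv_iff_mul_le).2 (h1.trans h2)
  refine le_trans (measure_mono ?_) (measure_eventually_le hT)
  intro D hD
  change ∀ᶠ T in Filter.atTop, ENNReal.ofReal (Real.exp c) ≤ F T D
  have hev : ∀ᶠ T in Filter.atTop, ∀ s,
      ((m : ℕ∞) ≤ (visits D s).encard ↔ m ≤ (visitActs s (allSteps T D)).length) :=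
    Filter.eventually_all.2 fun s => eventually_le_length_visitActs_iff D s m
  -- For a large horizon the truncated runs have the same deficient states as the infinite ones, and
  -- the strict inequality `hD` passes to the truncated hitting probability.
  filter_upwards [hev, (G.tendsto_hitProb π₂ _).eventually (eventually_gt_nhds hD)] with T h1 h2
  have h3 : deficient W m ([] ++ allSteps T D) =
      {s | s ∈ W ∧ ¬ (m : ℕ∞) ≤ (visits D s).encard} := by
    ext s
    change (_ ∧ _) ↔ (_ ∧ _)
    rw [h1, not_le, List.nil_append]
  have h4 := G.le_seqProd_hitFactor π₂ W m T hθ (q₀ := q₀) n [] (fun i j => D i j)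
    (by change q₀ ≤ G.hitProb π₂ T (deficient W m ([] ++ allSteps T D)); rw [h3]; exact h2.le)
  refine le_trans (ENNReal.ofReal_le_ofReal (Real.exp_le_exp.2 (hexp.trans ?_))) h4
  simp [deficit]

end ICGame
end

/-! ### Samples with prescribed actions have positive probability -/

noncomputable section

namespace ICGame

section

variable {S A₁ A₂ : Type*}

/-- The visits to each state, up to `m`, after the stages `l` when there were `k` visits before. -/
def addVisits (m : ℕ) (k : S → ℕ) (l : List (Step S A₁ A₂)) (s : S) : ℕ :=
  min m (k s + (visitActs s l).length)

/-- Player 2 plays the prescribed actions `f s` at the first `m` visits to `s`, of which `k s`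
happened before. -/
def Follows (f : S → ℕ → A₂) (m : ℕ) (k : S → ℕ) (l : List (Step S A₁ A₂)) : Prop :=
  ∀ s j b, (visitActs s l)[j]? = some b → k s + j < m → b = f s (k s + j)

lemma addVisits_append (m : ℕ) (k : S → ℕ) (l l' : List (Step S A₁ A₂)) :
    addVisits m k (l ++ l') = addVisits m (addVisits m k l) l' := by
  funext s
  simp only [addVisits, visitActs_append, List.length_append]
  omega

lemma follows_nil (f : S → ℕ → A₂) (m : ℕ) (k : S → ℕ) :
    Follows f m k ([] : List (Step S A₁ A₂)) := by
  intro s j b h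
  simp at h

lemma follows_append {f : S → ℕ → A₂} {m : ℕ} {k : S → ℕ} {l l' : List (Step S A₁ A₂)} :
    Follows f m k (l ++ l') ↔ Follows f m k l ∧ Follows f m (addVisits m k l) l' := by
  constructor
  · refine fun h => ⟨fun s j b hj => h s j b ?_, fun s j b hj hlt => ?_⟩
    · rw [visitActs_append, List.getElem?_append_left (List.getElem?_eq_some_iff.1 hj).1, hj]
    · have hlt' : k s + ((visitActs s l).length + j) < m := by
        simp only [addVisits] at hlt
        omega
      have he : addVisits m k l s = k s + (visitActs s l).length := by
        simp only [addVisits]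
        omega
      rw [he, add_assoc]
      refine h s _ b ?_ hlt'
      rw [visitActs_append, List.getElem?_append_right (by omega), Nat.add_sub_cancel_left, hj]
  · rintro ⟨h1, h2⟩ s j b hj hlt
    rw [visitActs_append] at hj
    rcases lt_or_ge j (visitActs s l).length with h | h
    · rw [List.getElem?_append_left h] at hj
      exact h1 s j b hj hlt
    · rw [List.getElem?_append_right h] at hj
      have he : addVisits m k l s = k s + (visitActs s l).length := by
        simp only [addVisits]
        omega
      have := h2 s _ b hj (by rw [he]; omega)
      rw [this, he]
      congr 1
      omega

lemma follows_cons {f : S → ℕ → A₂} {m : ℕ} {k : S → ℕ} {x : Step S A₁ A₂}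
    {l : List (Step S A₁ A₂)} (hx : k x.state < m → x.act₂ = f x.state (k x.state))
    (hl : Follows f m (addVisits m k [x]) l) : Follows f m k (x :: l) := by
  refine (follows_append (l := [x])).2 ⟨fun s j b hj hlt => ?_, hl⟩
  by_cases h : x.state = s
  · subst h
    rw [visitActs_cons_of_eq rfl] at hj
    obtain ⟨rfl, rfl⟩ : j = 0 ∧ x.act₂ = b := by
      cases j with
      | zero => simpa using hj
      | succ j => simp at hj
    exact hx hlt
  · rw [visitActs_cons_of_ne h] at hj
    simp at hj

lemma addVisits_mono (m : ℕ) (k : S → ℕ) (γ : ℕ → Step S A₁ A₂) (s : S) :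
    Monotone fun T => addVisits m k (runPrefix T γ) s := by
  refine monotone_nat_of_le_succ fun T => ?_
  rw [runPrefix_succ, addVisits_append]
  simp only [addVisits]
  omega

/-- Counts capped at `m` are monotone in the horizon and bounded, hence eventually constant. Without
the cap a state visited infinitely often would have no final count. -/
lemma exists_eventually_addVisits_eq [Finite S] (m : ℕ) (k : S → ℕ) (γ : ℕ → Step S A₁ A₂) :
    ∃ k', ∀ᶠ T in Filter.atTop, addVisits m k (runPrefix T γ) = k' := by
  have : ∀ s, ∃ c, ∀ᶠ T in Filter.atTop, addVisits m k (runPrefix T γ) s = c := by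
    intro s
    have hb : BddAbove (Set.range fun T => addVisits m k (runPrefix T γ) s) :=
      ⟨m, by rintro _ ⟨T, rfl⟩; exact min_le_left _ _⟩
    obtain ⟨T₀, hT₀⟩ := Nat.sSup_mem (Set.range_nonempty _) hb
    refine ⟨addVisits m k (runPrefix T₀ γ) s, ?_⟩
    filter_upwards [Filter.eventually_ge_atTop T₀] with T hT
    refine le_antisymm ?_ (addVisits_mono m k γ s hT)
    change _ ≤ (fun T => addVisits m k (runPrefix T γ) s) T₀
    rw [hT₀]
    exact le_csSup hb ⟨T, rfl⟩
  choose k' hk' using this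
  refine ⟨k', ?_⟩
  filter_upwards [Filter.eventually_all.2 hk'] with T hT using funext hT

/-- `q'` can follow `q` when the average player plays against `σ`. -/
def Follow (G : ICGame S A₁ A₂) (σ : StationaryPolicy G.avail₂) (q q' : S) : Prop :=
  ∃ a b, G.average.dist q a ≠ 0 ∧ σ.dist q b ≠ 0 ∧ G.trans q a b q' ≠ 0

/-- `q'` can be reached from `q` when the average player plays against `σ`. -/
def Reachable (G : ICGame S A₁ A₂) (σ : StationaryPolicy G.avail₂) : S → S → Prop :=
  Relation.ReflTransGen (G.Follow σ)

open scoped Classical in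
/-- The number of visits that are missing for `m` visits to each reachable state. -/
def missing [Fintype S] (G : ICGame S A₁ A₂) (σ : StationaryPolicy G.avail₂) (m : ℕ)
    (k : S → ℕ) : ℕ := ∑ s, if G.Reachable σ G.init s then m - k s else 0

lemma missing_anti [Fintype S] (G : ICGame S A₁ A₂) (σ : StationaryPolicy G.avail₂) (m : ℕ)
    {k k' : S → ℕ} (h : k ≤ k') : G.missing σ m k' ≤ G.missing σ m k := by
  refine Finset.sum_le_sum fun s _ => ?_
  have : k s ≤ k' s := h s
  split_ifs
  · omega
  · exact le_rfl

lemma missing_lt [Fintype S] (G : ICGame S A₁ A₂) (σ : StationaryPolicy G.avail₂) (m : ℕ)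
    {k k' : S → ℕ} (h : k ≤ k') {s : S} (hs : G.Reachable σ G.init s) (hm : k s < m)
    (hlt : k s < k' s) : G.missing σ m k' < G.missing σ m k := by
  refine Finset.sum_lt_sum (fun s _ => ?_) ⟨s, Finset.mem_univ _, ?_⟩
  · have : k s ≤ k' s := h s
    split_ifs
    · omega
    · exact le_rfl
  · rw [if_pos hs, if_pos hs]
    omega

lemma le_addVisits {m : ℕ} {k : S → ℕ} (hk : ∀ s, k s ≤ m) (l : List (Step S A₁ A₂)) :
    k ≤ addVisits m k l := by
  intro s
  have := hk s
  simp only [addVisits]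
  omega

end

variable {S A₁ A₂ : Type*} [Fintype S] [Fintype A₁] [Fintype A₂]

lemma runLaw_pos_of_step {G : ICGame S A₁ A₂} {σ : StationaryPolicy G.avail₂} {q q' : S} {a : A₁}
    {b : A₂} (ha : G.average.dist q a ≠ 0) (hb : σ.dist q b ≠ 0) (hq : G.trans q a b q' ≠ 0)
    {B C : Set (ℕ → Step S A₁ A₂)} (hB : MeasurableSet B)
    (hC : 0 < G.runLaw G.averagePolicy (σ.toPolicy A₁ A₂) q' C)
    (h : ∀ γ ∈ C, consRun ⟨q, a, b⟩ γ ∈ B) :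
    0 < G.runLaw G.averagePolicy (σ.toPolicy A₁ A₂) q B := by
  rw [runLaw_apply _ _ _ _ hB, pos_iff_ne_zero]
  intro h0
  have h1 := (Finset.sum_eq_zero_iff.1 ((Finset.sum_eq_zero_iff.1 ((Finset.sum_eq_zero_iff.1 h0) a
    (Finset.mem_univ _))) b (Finset.mem_univ _))) q' (Finset.mem_univ _)
  rcases mul_eq_zero.1 h1 with h2 | h2
  · exact mul_ne_zero (mul_ne_zero ha hb) hq h2
  · exact (hC.trans_le (measure_mono h)).ne' h2

omit [Fintype S] [Fintype A₁] [Fintype A₂] in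
lemma measurableSet_stage (t : ℕ) (p : Step S A₁ A₂ → Prop) :
    MeasurableSet {γ : ℕ → Step S A₁ A₂ | p (γ t)} :=
  (measurable_pi_apply t) (MeasurableSet.of_discrete (s := {x | p x}))

/-- Almost surely, a run visits only reachable states, and Player 2 plays actions of positive
probability. -/
lemma ae_reachable (G : ICGame S A₁ A₂) (σ : StationaryPolicy G.avail₂) (q : S) :
    ∀ᵐ γ ∂(G.runLaw G.averagePolicy (σ.toPolicy A₁ A₂) q), ∀ t,
      G.Reachable σ q (γ t).state ∧ σ.dist (γ t).state (γ t).act₂ ≠ 0 := by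
  rw [ae_all_iff]
  intro t
  have hmeas : ∀ q, MeasurableSet {γ : ℕ → Step S A₁ A₂ |
      ¬ (G.Reachable σ q (γ t).state ∧ σ.dist (γ t).state (γ t).act₂ ≠ 0)} := fun q =>
    measurableSet_stage t fun x => ¬ (G.Reachable σ q x.state ∧ σ.dist x.state x.act₂ ≠ 0)
  induction t generalizing q with
  | zero =>
    rw [ae_iff, runLaw_apply _ _ _ _ (hmeas q)]
    refine Finset.sum_eq_zero fun a _ => Finset.sum_eq_zero fun b _ =>
      Finset.sum_eq_zero fun q' _ => ?_
    by_cases hb : σ.dist q b = 0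
    · have : (σ.toPolicy A₁ A₂).act [] q b = 0 := hb
      simp [this]
    · have hempty : consRun (⟨q, a, b⟩ : Step S A₁ A₂) ⁻¹' {γ : ℕ → Step S A₁ A₂ |
          ¬ (G.Reachable σ q (γ 0).state ∧ σ.dist (γ 0).state (γ 0).act₂ ≠ 0)} = ∅ :=
        Set.eq_empty_of_forall_notMem fun γ hγ => hγ ⟨Relation.ReflTransGen.refl, hb⟩
      rw [hempty, measure_empty, mul_zero]
  | succ t ih =>
    rw [ae_iff, runLaw_apply _ _ _ _ (hmeas q)]
    refine Finset.sum_eq_zero fun a _ => Finset.sum_eq_zero fun b _ =>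
      Finset.sum_eq_zero fun q' _ => ?_
    by_cases h0 : G.average.dist q a * σ.dist q b * G.trans q a b q' = 0
    · exact mul_eq_zero_of_left h0 _
    have hF : G.Follow σ q q' := ⟨a, b, left_ne_zero_of_mul (left_ne_zero_of_mul h0),
      right_ne_zero_of_mul (left_ne_zero_of_mul h0), right_ne_zero_of_mul h0⟩
    have hsub : consRun (⟨q, a, b⟩ : Step S A₁ A₂) ⁻¹' {γ : ℕ → Step S A₁ A₂ |
        ¬ (G.Reachable σ q (γ (t + 1)).state ∧ σ.dist (γ (t + 1)).state (γ (t + 1)).act₂ ≠ 0)} ⊆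
        {γ : ℕ → Step S A₁ A₂ |
          ¬ (G.Reachable σ q' (γ t).state ∧ σ.dist (γ t).state (γ t).act₂ ≠ 0)} :=
      fun γ hγ hγ' => hγ ⟨Relation.ReflTransGen.head hF hγ'.1, hγ'.2⟩
    have hih := ae_iff.1 (ih q' fun q => measurableSet_stage t
      fun x => ¬ (G.Reachable σ q x.state ∧ σ.dist x.state x.act₂ ≠ 0))
    exact mul_eq_zero_of_right _ (measure_mono_null hsub hih)

lemma one_le_runLaw_reachable (G : ICGame S A₁ A₂) (σ : StationaryPolicy G.avail₂) (q : S) :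
    1 ≤ G.runLaw G.averagePolicy (σ.toPolicy A₁ A₂) q {γ | ∀ t, G.Reachable σ q (γ t).state} := by
  rw [← measure_univ (μ := G.runLaw G.averagePolicy (σ.toPolicy A₁ A₂) q)]
  refine measure_mono_ae ?_
  filter_upwards [G.ae_reachable σ q] with γ hγ _ using fun t => (hγ t).1

omit [Fintype S] [Fintype A₁] [Fintype A₂] in
lemma exists_state_of_visitActs_getElem? {s : S} {T j : ℕ} {b : A₂} {γ : ℕ → Step S A₁ A₂}
    (h : (visitActs s (runPrefix T γ))[j]? = some b) : ∃ t, (γ t).state = s := by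
  have hb := List.mem_of_getElem? h
  obtain ⟨x, hx, _⟩ := List.mem_map.1 hb
  obtain ⟨hx1, hx2⟩ := List.mem_filter.1 hx
  obtain ⟨i, rfl⟩ := List.mem_ofFn.1 hx1
  exact ⟨i, by simpa using hx2⟩

/-- With positive probability the prescribed actions are played, and progress is made if a state
with missing visits is reachable. -/
lemma runLaw_follows_pos (G : ICGame S A₁ A₂) (σ : StationaryPolicy G.avail₂) {f : S → ℕ → A₂}
    (hf : ∀ s j, σ.dist s (f s j) ≠ 0) (m d : ℕ) : ∀ k : S → ℕ, (∀ s, k s ≤ m) →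
      G.missing σ m k = d → ∀ q, G.Reachable σ G.init q →
      0 < G.runLaw G.averagePolicy (σ.toPolicy A₁ A₂) q
        {γ | (∀ T, Follows f m k (runPrefix T γ)) ∧ ((∃ s, G.Reachable σ q s ∧ k s < m) →
          ∃ T, G.missing σ m (addVisits m k (runPrefix T γ)) < G.missing σ m k)} := by
  induction d using Nat.strong_induction_on with
  | _ d ih =>
  intro k hk hd q hq
  by_cases hdef : ∃ s, G.Reachable σ q s ∧ k s < m
  swap
  -- Nothing is prescribed at the states still reachable, so almost every run qualifies.
  · refine lt_of_lt_of_le zero_lt_one ((G.one_le_runLaw_reachable σ q).trans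
      (measure_mono fun γ hγ => ⟨fun T s j b hj hlt => ?_, fun h => absurd h hdef⟩))
    obtain ⟨t, rfl⟩ := exists_state_of_visitActs_getElem? hj
    exact absurd ⟨_, hγ t, by omega⟩ hdef
  set B : Set (ℕ → Step S A₁ A₂) := {γ | (∀ T, Follows f m k (runPrefix T γ)) ∧
    ∃ T, G.missing σ m (addVisits m k (runPrefix T γ)) < G.missing σ m k} with hB
  have hBm : MeasurableSet B := by
    have h1 : B = (⋂ T, {γ | Follows f m k (runPrefix T γ)}) ∩
        ⋃ T, {γ | G.missing σ m (addVisits m k (runPrefix T γ)) < G.missing σ m k} := by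
      ext γ
      rw [Set.mem_inter_iff, Set.mem_iInter, Set.mem_iUnion]
      rfl
    rw [h1]
    exact (MeasurableSet.iInter fun T => measurableSet_runPrefix T _).inter
      (MeasurableSet.iUnion fun T => measurableSet_runPrefix T
        fun l => G.missing σ m (addVisits m k l) < G.missing σ m k)
  have hprefix : ∀ (x : Step S A₁ A₂) (γ : ℕ → Step S A₁ A₂),
      (k x.state < m → x.act₂ = f x.state (k x.state)) →
      (∀ T, Follows f m (addVisits m k [x]) (runPrefix T γ)) →
      ∀ T, Follows f m k (runPrefix T (consRun x γ)) := by
    intro x γ hx hγ T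
    cases T with
    | zero => exact follows_nil _ _ _
    | succ T => rw [runPrefix_succ_consRun]; exact follows_cons hx (hγ T)
  -- Play the prescribed action at the current state: the number of missing visits drops at once,
  -- and the induction hypothesis takes care of the rest of the run.
  have hbase : ∀ q, G.Reachable σ G.init q → k q < m →
      0 < G.runLaw G.averagePolicy (σ.toPolicy A₁ A₂) q B := by
    intro q hq hkq
    obtain ⟨a, ha⟩ := (G.average.dist q).support_nonempty
    obtain ⟨q', hq'⟩ := (G.trans q a (f q (k q))).support_nonempty
    rw [PMF.mem_support_iff] at ha hq'
    set x : Step S A₁ A₂ := ⟨q, a, f q (k q)⟩ with hx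
    have hlt : k q < addVisits m k [x] q := by
      simp only [addVisits, visitActs_cons_of_eq (show x.state = q from rfl)]
      simp [hkq]
    have hmiss : G.missing σ m (addVisits m k [x]) < G.missing σ m k :=
      G.missing_lt σ m (le_addVisits hk _) hq hkq hlt
    have := ih _ (hd ▸ hmiss) (addVisits m k [x]) (fun s => min_le_left _ _) rfl q'
      (hq.tail ⟨a, f q (k q), ha, hf q _, hq'⟩)
    refine runLaw_pos_of_step ha (hf q _) hq' hBm this fun γ hγ =>
      ⟨hprefix x γ (fun _ => rfl) hγ.1, 1, ?_⟩
    rw [runPrefix_succ_consRun]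
    exact hmiss
  obtain ⟨s, hqs, hks⟩ := hdef
  -- Walk along a path to a state with missing visits. The states passed before have `m` visits
  -- already, so the capped counts stay the same and no action is prescribed there.
  have key : ∀ q, G.Reachable σ q s → G.Reachable σ G.init q →
      0 < G.runLaw G.averagePolicy (σ.toPolicy A₁ A₂) q B := by
    intro q hqs
    induction hqs using Relation.ReflTransGen.head_induction_on with
    | refl => exact fun h => hbase s h hks
    | head hstep _ ihq =>
      rename_i q q₁ _
      intro hq
      by_cases hkq : k q < m
      · exact hbase q hq hkq
      have hpos := ihq (hq.tail hstep)
      obtain ⟨a, b, ha, hb, hq₁⟩ := hstep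
      have he : addVisits m k [(⟨q, a, b⟩ : Step S A₁ A₂)] = k := by
        funext s'
        have := hk s'
        simp only [addVisits]
        by_cases hs' : q = s'
        · subst hs'
          omega
        · rw [visitActs_cons_of_ne (x := ⟨q, a, b⟩) hs']
          simpa using this
      refine runLaw_pos_of_step ha hb hq₁ hBm hpos fun γ hγ => ⟨hprefix ⟨q, a, b⟩ γ
        (fun h => absurd h hkq) (by rw [he]; exact hγ.1), ?_⟩
      obtain ⟨T, hT⟩ := hγ.2
      refine ⟨T + 1, ?_⟩
      rw [runPrefix_succ_consRun, ← List.singleton_append, addVisits_append, he]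
      exact hT
  exact (key q hqs hq).trans_le (measure_mono fun γ hγ => ⟨hγ.1, fun _ => hγ.2⟩)

/-- A rectangle of nonnull sets is nonnull for the law of independent runs. What is prescribed in
later runs depends on the visits in earlier ones, so the visit counts after each run have to be
fixed. Each run removes at least one missing visit, so that `n` runs suffice for `n` missing visits.
-/
lemma exists_rectangle_follows (G : ICGame S A₁ A₂) (σ : StationaryPolicy G.avail₂)
    {f : S → ℕ → A₂} (hf : ∀ s j, σ.dist s (f s j) ≠ 0) (m n : ℕ) : ∀ k : S → ℕ,
      (∀ s, k s ≤ m) → G.missing σ m k ≤ n →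
      ∃ A : Fin n → Set (ℕ → Step S A₁ A₂),
        (∀ i, G.runLaw G.averagePolicy (σ.toPolicy A₁ A₂) G.init (A i) ≠ 0) ∧
        ∀ D : Fin n → ℕ → Step S A₁ A₂, (∀ i, D i ∈ A i) → ∀ᶠ T in Filter.atTop,
          Follows f m k (allSteps T D) ∧
            ∀ s, G.Reachable σ G.init s → m ≤ addVisits m k (allSteps T D) s := by
  induction n with
  | zero =>
    intro k hk hmiss
    refine ⟨Fin.elim0, fun i => i.elim0, fun D _ => Filter.Eventually.of_forall fun T =>
      ⟨by simpa [allSteps] using follows_nil f m k, fun s hs => ?_⟩⟩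
    have h0 := (Finset.sum_eq_zero_iff.1 (Nat.le_zero.1 hmiss)) s (Finset.mem_univ _)
    rw [if_pos hs] at h0
    simp only [addVisits]
    omega
  | succ n ih =>
    intro k hk hmiss
    have hpos := G.runLaw_follows_pos σ hf m _ k hk rfl G.init Relation.ReflTransGen.refl
    set B : Set (ℕ → Step S A₁ A₂) := {γ | (∀ T, Follows f m k (runPrefix T γ)) ∧
      ((∃ s, G.Reachable σ G.init s ∧ k s < m) →
        ∃ T, G.missing σ m (addVisits m k (runPrefix T γ)) < G.missing σ m k)} with hB
    have hcover : B ⊆ ⋃ k' : S → ℕ, {γ | γ ∈ B ∧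
        ∀ᶠ T in Filter.atTop, addVisits m k (runPrefix T γ) = k'} := by
      intro γ hγ
      obtain ⟨k', hk'⟩ := exists_eventually_addVisits_eq m k γ
      exact Set.mem_iUnion.2 ⟨k', hγ, hk'⟩
    -- There are countably many possible final counts, so one of them has positive probability
    -- together with `B`.
    obtain ⟨k', hk'⟩ : ∃ k' : S → ℕ, G.runLaw G.averagePolicy (σ.toPolicy A₁ A₂) G.init
        {γ | γ ∈ B ∧ ∀ᶠ T in Filter.atTop, addVisits m k (runPrefix T γ) = k'} ≠ 0 := by
      by_contra! hcon
      exact hpos.ne' (measure_mono_null hcover (measure_iUnion_null hcon))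
    obtain ⟨γ₀, hγ₀, hγ₀'⟩ := nonempty_of_measure_ne_zero hk'
    have hk'm : ∀ s, k' s ≤ m := by
      obtain ⟨T, hT⟩ := hγ₀'.exists
      exact fun s => hT ▸ min_le_left _ _
    have hmiss' : G.missing σ m k' ≤ n := by
      by_cases hdef : ∃ s, G.Reachable σ G.init s ∧ k s < m
      · obtain ⟨T, hT⟩ := hγ₀.2 hdef
        obtain ⟨T', hT', hle⟩ := (hγ₀'.and (Filter.eventually_ge_atTop T)).exists
        have : addVisits m k (runPrefix T γ₀) ≤ k' :=
          hT' ▸ fun s => addVisits_mono m k γ₀ s hle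
        have := G.missing_anti σ m this
        omega
      · have h0 : G.missing σ m k = 0 := Finset.sum_eq_zero fun s _ => by
          split_ifs with hs
          · by_contra h
            exact hdef ⟨s, hs, by omega⟩
          · rfl
        obtain ⟨T', hT'⟩ := hγ₀'.exists
        have := G.missing_anti σ m (hT' ▸ le_addVisits hk (runPrefix T' γ₀) : k ≤ k')
        omega
    obtain ⟨A, hA, hA'⟩ := ih k' hk'm hmiss'
    refine ⟨Fin.cons {γ | γ ∈ B ∧ ∀ᶠ T in Filter.atTop, addVisits m k (runPrefix T γ) = k'} A,
      fun i => ?_, fun D hD => ?_⟩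
    · induction i using Fin.cases with
      | zero => simpa using hk'
      | succ i => simpa using hA i
    · have h0 : D 0 ∈ B ∧ ∀ᶠ T in Filter.atTop, addVisits m k (runPrefix T (D 0)) = k' := hD 0
      filter_upwards [h0.2, hA' (Fin.tail D) fun i => hD i.succ] with T h1 h2
      have happ : allSteps T D = runPrefix T (D 0) ++ allSteps T (Fin.tail D) := by
        simp [allSteps, List.ofFn_succ, Fin.tail]
      rw [happ, follows_append, addVisits_append, h1]
      exact ⟨⟨h0.1.1 T, h2.1⟩, h2.2⟩

/-- With positive probability, all the reachable states are visited at least `m` times and the first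
`m` actions of Player 2 there are the prescribed ones. -/
theorem sampleLaw_prescribed_pos (G : ICGame S A₁ A₂) (σ : StationaryPolicy G.avail₂)
    {f : S → ℕ → A₂} (hf : ∀ s j, σ.dist s (f s j) ≠ 0) {m n : ℕ} (hn : Fintype.card S * m ≤ n) :
    G.sampleLaw (σ.toPolicy A₁ A₂) n {D | ∀ s, G.Reachable σ G.init s →
      (m : ℕ∞) ≤ (visits D s).encard ∧ ∀ v : Fin m → Fin n ×ₗ ℕ, IsFirstVisits D s v →
        ∀ j, (D (ofLex (v j)).1 (ofLex (v j)).2).act₂ = f s j} ≠ 0 := by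
  obtain ⟨A, hA, hA'⟩ := G.exists_rectangle_follows σ hf m n (fun _ => 0) (fun _ => Nat.zero_le _)
    ((Finset.sum_le_sum fun s _ => by split_ifs <;> omega : _ ≤ ∑ _s : S, m).trans (by simpa using hn))
  have hpos : G.sampleLaw (σ.toPolicy A₁ A₂) n (Set.univ.pi A) ≠ 0 := by
    rw [sampleLaw, Measure.pi_pi]
    exact Finset.prod_ne_zero_iff.2 fun i _ => hA i
  refine fun h0 => hpos (measure_mono_null ?_ h0)
  intro D hD s hs
  have hev := hA' D fun i => hD i (Set.mem_univ i)
  refine ⟨?_, fun v hv j => ?_⟩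
  · obtain ⟨T, h1, h2⟩ := (hev.and (eventually_le_length_visitActs_iff D s m)).exists
    rw [h2]
    have := h1.2 s hs
    simp only [addVisits] at this
    omega
  · obtain ⟨T, h1, h2⟩ := (hev.and hv.eventually_take_visitActs).exists
    have h3 : (visitActs s (allSteps T D))[(j : ℕ)]? =
        some (D (ofLex (v j)).1 (ofLex (v j)).2).act₂ := by
      have := congrArg (fun l => l[(j : ℕ)]?) h2
      simp only [List.getElem?_take_of_lt j.2] at this
      rw [this]
      simp
    simpa using h1.1 s j _ h3 (by simp)

end ICGame
end

/-! ### Rounding of distributions and properties of the estimate -/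

noncomputable section

lemma exists_fin_fiber_card {A : Type*} [Fintype A] [DecidableEq A] {m : ℕ} (N : A → ℕ)
    (hN : ∑ b, N b = m) : ∃ f : Fin m → A, ∀ b, (Finset.univ.filter fun k => f k = b).card = N b := by
  have hcard : Fintype.card (Σ b, Fin (N b)) = Fintype.card (Fin m) := by simp [hN]
  set e := Fintype.equivOfCardEq hcard with he
  refine ⟨fun k => (e.symm k).1, fun b => ?_⟩
  rw [← Fintype.card_fin (N b), ← Finset.card_univ]
  symm
  refine Finset.card_bij (fun (i : Fin (N b)) _ => e ⟨b, i⟩) (fun i _ => by simp)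
    (fun i _ j _ h => by simpa using h) fun k hk => ?_
  obtain rfl := (Finset.mem_filter.1 hk).2
  exact ⟨(e.symm k).2, Finset.mem_univ _, by simp⟩

/-- A distribution can be rounded to an empirical distribution, without increasing the mean of a
given function. -/
lemma exists_empirical_rounding {A : Type*} [Fintype A] (p : PMF A) (g : A → ℝ) (m : ℕ) [NeZero m] :
    ∃ f : Fin m → A, (∀ k, p (f k) ≠ 0) ∧
      ∑ b, (ICGame.empirical f b).toReal * g b ≤ ∑ b, (p b).toReal * g b ∧
      TvLe p (ICGame.empirical f) (Fintype.card A / m) := by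
  classical
  have hm : (0 : ℝ) < m := by exact_mod_cast Nat.pos_of_ne_zero (NeZero.ne m)
  -- Each weight is rounded down to a multiple of 1/m, and the leftover mass goes to a support point
  -- where `g` is least, so the mean of `g` cannot increase.
  obtain ⟨b₀, hb₀, hmin⟩ := Set.exists_min_image p.support g (Set.toFinite _) p.support_nonempty
  set r : A → ℕ := fun b => ⌊m * (p b).toReal⌋₊ with hr
  have hrle : ∀ b, (r b : ℝ) ≤ m * (p b).toReal := fun b => Nat.floor_le (by positivity)
  have hsum : ∑ b, (m : ℝ) * (p b).toReal = m := by
    rw [← Finset.mul_sum, ICGame.sum_pmf_toReal, mul_one]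
  have hrm : ∑ b, r b ≤ m := by
    have := Finset.sum_le_sum fun b (_ : b ∈ Finset.univ) => hrle b
    rw [hsum] at this
    exact_mod_cast this
  obtain ⟨f, hf⟩ := exists_fin_fiber_card (m := m)
    (fun b => r b + if b = b₀ then m - ∑ b, r b else 0) (by
      rw [Finset.sum_add_distrib, Finset.sum_ite_eq']
      simp
      omega)
  have hemp : ∀ b, (ICGame.empirical f b).toReal =
      (r b + if b = b₀ then m - ∑ b, (r b : ℝ) else 0) / m := by
    intro b
    rw [ICGame.empirical_apply, hf]
    split_ifs
    · push_cast [Nat.cast_sub hrm]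
      rfl
    · simp
  have hnn : 0 ≤ (m : ℝ) - ∑ b, (r b : ℝ) := by
    have : ((∑ b, r b : ℕ) : ℝ) ≤ m := by exact_mod_cast hrm
    push_cast at this
    linarith
  refine ⟨f, fun k h0 => ?_, ?_, fun B => ?_⟩
  · have h1 : 0 < (Finset.univ.filter fun j => f j = f k).card :=
      Finset.card_pos.2 ⟨k, by simp⟩
    have h2 : f k ≠ b₀ := fun h => (PMF.mem_support_iff _ _).1 hb₀ (h ▸ h0)
    rw [hf, if_neg h2, add_zero] at h1
    simp [hr, h0] at h1
  · have h1 : ∑ b, (ICGame.empirical f b).toReal * g b =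
        (∑ b, r b * g b + (m - ∑ b, (r b : ℝ)) * g b₀) / m := by
      simp only [hemp, div_mul_eq_mul_div, add_mul, ite_mul, zero_mul, ← Finset.sum_div,
        Finset.sum_add_distrib, Finset.sum_ite_eq', Finset.mem_univ, if_true]
    rw [h1, div_le_iff₀ hm]
    have h2 : 0 ≤ ∑ b, (m * (p b).toReal - r b) * (g b - g b₀) := by
      refine Finset.sum_nonneg fun b _ => ?_
      by_cases hb : p b = 0
      · simp [hr, hb]
      · exact mul_nonneg (by linarith [hrle b])
          (by linarith [hmin b ((PMF.mem_support_iff _ _).2 hb)])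
    have h3 : ∑ b, (m * (p b).toReal - r b) * (g b - g b₀) =
        (∑ b, (p b).toReal * g b) * m - ∑ b, r b * g b - (m - ∑ b, (r b : ℝ)) * g b₀ := by
      have h4 : (m - ∑ b, (r b : ℝ)) * g b₀ = ∑ b, (m * (p b).toReal - r b) * g b₀ := by
        rw [← Finset.sum_mul, Finset.sum_sub_distrib, hsum]
      rw [h4, Finset.sum_mul, ← Finset.sum_sub_distrib, ← Finset.sum_sub_distrib]
      exact Finset.sum_congr rfl fun b _ => by ring
    linarith
  -- Rounding down loses at most 1/m per action, and the leftover mass only helps this side of the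
  -- inequality.
  · have h1 : ∀ b ∈ B, (p b).toReal - (ICGame.empirical f b).toReal ≤ 1 / m := by
      intro b _
      rw [hemp, sub_le_iff_le_add, ← add_div, le_div_iff₀ hm]
      have := (Nat.lt_floor_add_one (m * (p b).toReal)).le
      have h2 : (0 : ℝ) ≤ if b = b₀ then m - ∑ b, (r b : ℝ) else 0 := by
        split_ifs
        · exact hnn
        · exact le_rfl
      change _ ≤ (r b : ℝ) + 1 at this
      linarith
    refine (Finset.sum_le_sum h1).trans ?_
    rw [Finset.sum_const, nsmul_eq_mul, mul_one_div]
    exact div_le_div_of_nonneg_right (by exact_mod_cast Finset.card_le_univ B) hm.le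

namespace ICGame

variable {S A₁ A₂ : Type*} [Fintype S] [Fintype A₁] [Fintype A₂]

omit [Fintype S] [Fintype A₁] [Fintype A₂] in
lemma exists_estimate_eq [Finite S] [Finite A₁] [Finite A₂] (G : ICGame S A₁ A₂) {m : ℕ}
    [NeZero m] {n : ℕ} {D : Fin n → ℕ → Step S A₁ A₂} {s : S} (hs : (m : ℕ∞) ≤ (visits D s).encard)
    (hav : ∀ i t, (D i t).act₂ ∈ G.avail₂ (D i t).state) :
    ∃ v : Fin m → Fin n ×ₗ ℕ, IsFirstVisits D s v ∧
      (G.estimate m D).dist s = empirical fun k => (D (ofLex (v k)).1 (ofLex (v k)).2).act₂ := by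
  obtain ⟨v, hv⟩ := exists_isFirstVisits m hs
  have h : ∃ v : Fin m → Fin n ×ₗ ℕ, IsFirstVisits D s v ∧
      ∀ k, (D (ofLex (v k)).1 (ofLex (v k)).2).act₂ ∈ G.avail₂ s :=
    ⟨v, hv, fun k => by
      have h1 := hav (ofLex (v k)).1 (ofLex (v k)).2
      have h2 : (D (ofLex (v k)).1 (ofLex (v k)).2).state = s := hv.2.1 k
      rwa [h2] at h1⟩
  refine ⟨h.choose, h.choose_spec.1, ?_⟩
  simp only [estimate]
  rw [dif_pos h]
  rfl

lemma ae_sampleLaw (G : ICGame S A₁ A₂) (σ : StationaryPolicy G.avail₂) (n : ℕ) :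
    ∀ᵐ D ∂(G.sampleLaw (σ.toPolicy A₁ A₂) n), ∀ i t,
      G.Reachable σ G.init (D i t).state ∧ (D i t).act₂ ∈ G.avail₂ (D i t).state := by
  rw [ae_all_iff]
  intro i
  have h := (measurePreserving_eval
    (fun _ : Fin n => G.runLaw G.averagePolicy (σ.toPolicy A₁ A₂) G.init)
    i).quasiMeasurePreserving.ae (G.ae_reachable σ G.init)
  filter_upwards [h] with D hD t using ⟨(hD t).1, dist_mem_avail σ (hD t).2⟩

lemma exists_isSynthesized {G : ICGame S A₁ A₂} (hG : G.FullSupport) (m : ℕ) [NeZero m] {n : ℕ}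
    (D : Fin n → ℕ → Step S A₁ A₂) : ∃ μ, G.IsSynthesized m D μ := by
  obtain ⟨μ, hμ, -⟩ := exists_isOptimalAgainst
    (hG.withEnd (G.unknown m D ∪ G.win)) (σ := G.estimate m D)
  exact ⟨μ, hμ⟩

lemma unknown_eq {G : ICGame S A₁ A₂} (hG : G.FullSupport) (m : ℕ) {n : ℕ}
    (D : Fin n → ℕ → Step S A₁ A₂) : G.unknown m D = G.winSet \ G.known m D := by
  rw [unknown, potential_eq_winSet hG]

/-- The contraction of the output, for the synthesized policy. -/
lemma avoidProb_le_of_hasContraction {G : ICGame S A₁ A₂} (hG : G.FullSupport) {m : ℕ} [NeZero m]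
    {n : ℕ} {D : Fin n → ℕ → Step S A₁ A₂} {L : ℕ} {β : ℝ}
    (hcon : ∀ π₁ : G.Policy₁, G.IsOutput m D π₁ →
      G.HasContraction (G.unknown m D) π₁ (G.estimatePolicy m D) L β)
    {μ : StationaryPolicy G.avail₁} (hμ : G.IsSynthesized m D μ) {s : S} (hs : s ∈ G.winSet) :
    G.avoidProb (G.unknown m D ∪ G.win) L (μ.toPolicy A₁ A₂)
      ((G.estimate m D).toPolicy A₁ A₂) s ≤ β := by
  have hU := unknown_eq hG m D
  have hE : (G.winSet \ G.known m D) ∪ G.win ⊆ G.winSet :=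
    Set.union_subset Set.sdiff_subset fun s hs => G.mem_winSet_of_mem_win hs
  have h := hcon _ ⟨μ, hμ, rfl⟩ s (potential_eq_winSet hG ▸ hs)
  rw [measureReal_reachWithin, Set.union_comm, hU, avoidProb_switchPolicy] at h
  · rw [hU]
    linarith
  · intro s hs hsE a ha
    rw [← hU] at hsE hE
    exact keeps_of_isOptimalAgainst_withEnd hG hE Set.subset_union_right hμ hs hsE ha
  · exact hs

end ICGame
end

/-! ### Sample sizes and the proof of the proposition -/

noncomputable section

/-- The rounding error. Only the term with `A` of the bound on m matters, and κ² ≤ κ turns the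
quadratic condition into the linear one needed here. -/
lemma card_div_le_of_sample_bound {κ L A c ℓ m : ℝ} (hκ0 : 0 < κ) (hκ1 : κ ≤ 1) (hL : 1 ≤ L)
    (hA : 0 ≤ A) (hcA : c ≤ A) (hℓ : 0 ≤ ℓ) (hm : 0 < m)
    (h : 4 * L ^ 2 * (2 * Real.log 2 * A + ℓ) ≤ m * κ ^ 2) : c / m ≤ κ / (4 * L) := by
  have hlog2 := Real.log_two_gt_d9
  rw [div_le_div_iff₀ hm (by positivity)]
  have h1 : m * κ ^ 2 ≤ m * κ := mul_le_mul_of_nonneg_left (by nlinarith) hm.le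
  have h2 : A * L ≤ A * L ^ 2 := mul_le_mul_of_nonneg_left (by nlinarith) hA
  have h3 : A * L ^ 2 * (1 / 2) ≤ A * L ^ 2 * Real.log 2 :=
    mul_le_mul_of_nonneg_left (by linarith) (by positivity)
  have h4 : 0 ≤ L ^ 2 * ℓ := by positivity
  have h5 : c * L ≤ A * L := mul_le_mul_of_nonneg_right hcA (by linarith)
  have h6 : 4 * L ^ 2 * (2 * Real.log 2 * A + ℓ) = 8 * (A * L ^ 2 * Real.log 2) + 4 * (L ^ 2 * ℓ) := by
    ring
  linarith

/-- The estimation accuracy 3κ/(8L) is affordable because 2 (3/8)² = 9/32 exceeds 1/4. -/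
lemma le_of_sample_bound {κ L X m : ℝ} (hL : 1 ≤ L) (hX : 0 ≤ X)
    (h : 4 * L ^ 2 * X ≤ m * κ ^ 2) : X ≤ 2 * m * (3 * κ / (8 * L)) ^ 2 := by
  have h1 : 2 * m * (3 * κ / (8 * L)) ^ 2 = 9 / 32 * (m * κ ^ 2) / L ^ 2 := by
    field_simp
    ring
  rw [h1, le_div_iff₀ (by positivity)]
  have : 0 ≤ X * L ^ 2 := by positivity
  linarith

/-- Dropping a² from (nq - a)² leaves nq (nq - 2a), and the hypothesis bounds the second factor
below by e ℓ / 2. -/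
lemma le_of_run_bound {n q e a ℓ : ℝ} (hn : 0 < n) (hq : 0 < q) (he : e * q = 1)
    (h : e * ℓ / 2 + 2 * a ≤ n * q) : ℓ ≤ 2 * (n * q - a) ^ 2 / n := by
  rw [le_div_iff₀ hn]
  have h2 : n * q * (e * ℓ / 2) ≤ n * q * (n * q - 2 * a) :=
    mul_le_mul_of_nonneg_left (by linarith) (by positivity)
  have h3 : n * q * (e * ℓ / 2) = n * ℓ / 2 := by
    calc _ = (e * q) * (n * ℓ / 2) := by ring
      _ = _ := by rw [he, one_mul]
  have h4 : (n * q - a) ^ 2 = n * q * (n * q - 2 * a) + a ^ 2 := by ring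
  linarith [sq_nonneg a]

/-- The union bound over `s` states and the `2 ^ c` sets of actions; the term 2 A log 2 in the
exponent pays for the latter. -/
lemma mul_exp_neg_le_of_log {s δ A : ℝ} {c : ℕ} (hs : 0 < s) (hδ : 0 < δ) (hcA : (c : ℝ) ≤ A) :
    s * ((2 ^ c : ℕ) * Real.exp (-(2 * Real.log 2 * A + Real.log (2 * s / δ)))) ≤ δ / 2 := by
  have hlog2 := Real.log_two_gt_d9
  have h3 : Real.exp (-Real.log (2 * s / δ)) = δ / (2 * s) := by
    rw [Real.exp_neg, Real.exp_log (by positivity), inv_div]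
  have h4 : ((2 ^ c : ℕ) : ℝ) = Real.exp (Real.log 2 * c) := by
    rw [Real.exp_mul, Real.exp_log two_pos, Real.rpow_natCast]
    push_cast
    rfl
  have h5 : Real.log 2 * c ≤ Real.log 2 * A := mul_le_mul_of_nonneg_left hcA (by linarith)
  have h7 : 0 ≤ Real.log 2 * A :=
    mul_nonneg (by linarith) ((Nat.cast_nonneg c).trans hcA)
  have h6 : Real.exp (Real.log 2 * c) * Real.exp (-(2 * Real.log 2 * A)) ≤ 1 := by
    rw [← Real.exp_add]
    exact Real.exp_le_one_iff.2 (by linarith)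
  rw [h4, neg_add, Real.exp_add, h3]
  calc s * (Real.exp (Real.log 2 * c) * (Real.exp (-(2 * Real.log 2 * A)) * (δ / (2 * s))))
      = Real.exp (Real.log 2 * c) * Real.exp (-(2 * Real.log 2 * A)) * (δ / 2) := by field_simp
    _ ≤ 1 * (δ / 2) := mul_le_mul_of_nonneg_right h6 (by positivity)
    _ = δ / 2 := one_mul _

namespace ICGame

variable {S A₁ A₂ : Type*} [Fintype S] [Fintype A₁] [Fintype A₂]

/-- On a sample for which the estimate is accurate, the divergence of every synthesized policy is
almost optimal. -/
theorem exists_stopKl_le_of_isSynthesized {G : ICGame S A₁ A₂} (hG : G.FullSupport)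
    (σ : StationaryPolicy G.avail₂) {ε β κ : ℝ} {L m n : ℕ} [NeZero m] (hβ : β < 1) (hκ : 0 ≤ κ)
    (hL : 1 ≤ L) (hC : 0 < G.cMax) (hκε : κ * (G.cMax * L) = ε * (1 - β) ^ 2)
    (hround : (Fintype.card A₂ : ℝ) / m ≤ κ / (4 * L)) (hn : Fintype.card S * m ≤ n)
    (hcontr : ∀ᵐ D ∂(G.sampleLaw (σ.toPolicy A₁ A₂) n), ∀ π₁ : G.Policy₁,
      G.IsOutput m D π₁ →
        G.HasContraction (G.unknown m D) π₁ (G.estimatePolicy m D) L (β - κ)) :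
    ∃ v : S → ℝ, (∀ s ∈ G.winSet, 0 ≤ v s ∧ ∀ π₁, G.WinsFrom s π₁ →
        ENNReal.ofReal (v s) ≤ G.klFrom s π₁ (σ.toPolicy A₁ A₂)) ∧
      ∀ᵐ D ∂(G.sampleLaw (σ.toPolicy A₁ A₂) n),
        (∀ s ∈ G.known m D, ∀ v : Fin m → Fin n ×ₗ ℕ, IsFirstVisits D s v →
          TvLe (empirical fun k => (D (ofLex (v k)).1 (ofLex (v k)).2).act₂) (σ.dist s)
            (3 * κ / (8 * L))) →
        ∀ μ, G.IsSynthesized m D μ → ∀ s ∈ G.winSet, ∀ N,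
          G.stopKl (G.unknown m D ∪ G.win) μ σ N s ≤ v s + ε := by
  have hpot := potential_eq_winSet hG
  obtain ⟨ν, hν, v, hv⟩ := exists_isOptimalAgainst hG σ
  refine ⟨v, fun s hs => ⟨(hv s hs).1, (hv s hs).2.2.2⟩, ?_⟩
  -- The mean of the next value of `v` when `ν` meets the action `b`; rounding with respect to it
  -- keeps `v` a supersolution for `ν`.
  set g : S → A₂ → ℝ := fun s b =>
    ∑ a, ∑ q, (ν.dist s a).toReal * (G.trans s a b q).toReal * v q with hg
  choose f hf hfg hftv using fun s => exists_empirical_rounding (σ.dist s) (g s) m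
  have hae := (G.ae_sampleLaw σ n).and hcontr
  have hmpos : 0 < m := Nat.pos_of_ne_zero (NeZero.ne m)
  -- The prescribed samples are not a null set, so one of them satisfies the almost sure
  -- contraction. This sample provides a contracting policy against the rounding of `σ`.
  obtain ⟨D', hD', hD'ae, hD'con⟩ : ∃ D' : Fin n → ℕ → Step S A₁ A₂,
      (∀ s, G.Reachable σ G.init s → (m : ℕ∞) ≤ (visits D' s).encard ∧
        ∀ v : Fin m → Fin n ×ₗ ℕ, IsFirstVisits D' s v →
          ∀ j, (D' (ofLex (v j)).1 (ofLex (v j)).2).act₂ = f s j) ∧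
      (∀ i t, G.Reachable σ G.init (D' i t).state ∧ (D' i t).act₂ ∈ G.avail₂ (D' i t).state) ∧
      ∀ π₁ : G.Policy₁, G.IsOutput m D' π₁ →
        G.HasContraction (G.unknown m D') π₁ (G.estimatePolicy m D') L (β - κ) := by
    by_contra! hcon
    -- Indices from `m` on play no role; any action of positive probability serves as their value.
    refine G.sampleLaw_prescribed_pos σ (f := fun s j => if h : j < m then f s ⟨j, h⟩ else
      f s ⟨0, hmpos⟩) (fun s j => by split_ifs <;> exact hf s _) hn
      (measure_mono_null ?_ (ae_iff.1 hae))
    intro D hD hD2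
    obtain ⟨π₁, h1, h2⟩ := hcon D (fun s hs => ⟨(hD s hs).1, fun v hv j => by
      simpa using (hD s hs).2 v hv j⟩) hD2.1
    exact h2 (hD2.2 π₁ h1)
  obtain ⟨μ', hμ'⟩ := exists_isSynthesized hG m D'
  have hvisit : ∀ {D : Fin n → ℕ → Step S A₁ A₂} {s}, (∀ i t, G.Reachable σ G.init (D i t).state ∧
      (D i t).act₂ ∈ G.avail₂ (D i t).state) → s ∈ G.known m D → G.Reachable σ G.init s := by
    intro D s hD hs
    have : (visits D s).Nonempty := by
      rw [← Set.encard_pos]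
      exact lt_of_lt_of_le (by exact_mod_cast hmpos) hs.2
    obtain ⟨u, hu⟩ := this
    have hu' : (D (ofLex u).1 (ofLex u).2).state = s := hu
    exact hu' ▸ (hD _ _).1
  have hwinE : ∀ D : Fin n → ℕ → Step S A₁ A₂, G.unknown m D ∪ G.win ⊆ G.winSet := fun D =>
    Set.union_subset (unknown_eq hG m D ▸ Set.sdiff_subset) fun s hs => G.mem_winSet_of_mem_win hs
  have hknown : ∀ {D : Fin n → ℕ → Step S A₁ A₂} {s}, s ∈ G.winSet →
      s ∉ G.unknown m D ∪ G.win → s ∈ G.known m D := by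
    intro D s hs hsE
    by_contra h
    exact hsE (Or.inl (unknown_eq hG m D ▸ ⟨hs, h⟩))
  filter_upwards [hae] with D hD hacc μ hμ s hs N
  -- States known in `D` have been visited, hence are reachable, and `D'` knows all the reachable
  -- states of the winning region.
  have hsub : G.unknown m D' ∪ G.win ⊆ G.unknown m D ∪ G.win := by
    rintro s (hs | hs)
    · refine Or.inl ⟨hs.1, fun h => hs.2 ⟨h.1, (hD' s (hvisit hD.1 h)).1⟩⟩
    · exact Or.inr hs
  have hρ : ∀ s ∈ G.winSet, s ∉ G.unknown m D' ∪ G.win →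
      (G.estimate m D').dist s = empirical (f s) := by
    intro s hs hsE
    have hk := hknown hs hsE
    obtain ⟨u, hu, he⟩ := G.exists_estimate_eq hk.2 fun i t => (hD'ae i t).2
    rw [he]
    congr 1
    funext j
    exact (hD' s (hvisit hD'ae hk)).2 u hu j
  refine stopKl_le_of_isOptimalAgainst hG (hwinE D) hsub Set.subset_union_right (ν := ν) hμ hμ' hβ
    hκ hL hC hκε (fun s hs => avoidProb_le_of_hasContraction hG hD.2 hμ hs)
    (fun s hs => avoidProb_le_of_hasContraction hG hD'con hμ' hs) (fun s hs hsE => ?_)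
    (fun s hs hsE => ?_) (fun s hs => (hv s hs).1) (fun s hs => (hv s hs).2.1)
    (fun s hs => (hν s (hpot ▸ hs)).1) (fun s hs hsE => ?_) hs N
  · have hk := hknown hs hsE
    obtain ⟨u, hu, he⟩ := G.exists_estimate_eq hk.2 fun i t => (hD.1 i t).2
    rw [he]
    exact hacc s hk u hu
  · rw [hρ s hs hsE]
    exact fun B => (hftv s B).trans hround
  -- The rounding does not increase the mean of `g s`, so the supersolution inequality against `σ`
  -- implies the one against the estimate from `D'`.
  · refine le_trans ?_ (hv s hs).2.2.1
    rw [hρ s hs hsE, expNext_eq_sum, expNext_eq_sum]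
    exact add_le_add le_rfl (hfg s)

/-- The output of the algorithm is almost optimal and almost winning, if the synthesized policy has
an almost optimal divergence and the average player hardly ever reaches the unknown states. -/
lemma output_spec {G : ICGame S A₁ A₂} (hG : G.FullSupport) (hinit : G.init ∈ G.winSet)
    (hval : G.value ≠ ∞) (σ : StationaryPolicy G.avail₂) {ε lam w : ℝ} (hε : 0 < ε)
    (hlam : 0 < lam) (hw : w = (G.value.toReal + Real.log 2 + ε) / lam) {m n : ℕ} [NeZero m]
    {D : Fin n → ℕ → Step S A₁ A₂} {v : ℝ} (hv0 : 0 ≤ v)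
    (hv : ∀ π₁, G.IsWinning π₁ → ENNReal.ofReal v ≤ G.kl π₁ (σ.toPolicy A₁ A₂))
    {μ : StationaryPolicy G.avail₁} (hμ : G.IsSynthesized m D μ)
    (hle : ∀ N, G.stopKl (G.unknown m D ∪ G.win) μ σ N G.init ≤ v + ε)
    (hU : (G.runLaw G.averagePolicy (σ.toPolicy A₁ A₂) G.init).real (reach (G.unknown m D)) ≤
      Real.exp (-w)) :
    G.kl (G.switchPolicy (G.known m D) μ) (σ.toPolicy A₁ A₂) ≤
        (⨅ π : G.Policy₁, ⨅ _ : G.IsWinning π, G.kl π (σ.toPolicy A₁ A₂)) + ENNReal.ofReal ε ∧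
      1 - lam ≤ (G.runLaw (G.switchPolicy (G.known m D) μ) (σ.toPolicy A₁ A₂) G.init).real
        (reach G.win) := by
  have hUeq := unknown_eq hG m D
  have hE : G.unknown m D ∪ G.win ⊆ G.winSet :=
    Set.union_subset (hUeq ▸ Set.sdiff_subset) fun s hs => G.mem_winSet_of_mem_win hs
  have hkeep : ∀ s ∈ G.winSet, s ∉ G.unknown m D ∪ G.win → ∀ a, μ.dist s a ≠ 0 →
      G.Keeps G.winSet s a := fun s hs hsE a ha =>
    keeps_of_isOptimalAgainst_withEnd hG hE Set.subset_union_right hμ hs hsE ha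
  have hcost : ∀ s ∈ G.unknown m D ∪ G.win, G.stepCost s (μ.dist s) = 0 := fun s hs =>
    stepCost_of_isOptimalAgainst_withEnd hG hE Set.subset_union_right hμ hs
  have hkl : G.klFrom G.init (G.switchPolicy (G.known m D) μ) (σ.toPolicy A₁ A₂) ≤
      ENNReal.ofReal (v + ε) := by
    refine klFrom_le_of_klSum_le hG fun N => ENNReal.ofReal_le_ofReal (le_trans ?_ (hle N))
    rw [hUeq] at hcost hkeep ⊢
    exact G.klSum_switchPolicy_le σ hcost hkeep N _ hinit
  have havoid : G.avoidForever (G.unknown m D ∪ G.win) (G.switchPolicy (G.known m D) μ)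
      (σ.toPolicy A₁ A₂) G.init = 0 := by
    have h1 := G.tendsto_avoidProb (G.unknown m D ∪ G.win) (G.switchPolicy (G.known m D) μ)
      (σ.toPolicy A₁ A₂) G.init
    have h2 := G.tendsto_avoidProb (G.unknown m D ∪ G.win) (μ.toPolicy A₁ A₂)
      (σ.toPolicy A₁ A₂) G.init
    rw [avoidForever_of_isOptimalAgainst_withEnd hG hE Set.subset_union_right hμ hinit] at h2
    refine tendsto_nhds_unique h1 (h2.congr fun N => ?_)
    rw [hUeq] at hkeep ⊢
    exact (G.avoidProb_switchPolicy hkeep N _ _ hinit).symm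
  refine ⟨hkl.trans ?_, ?_⟩
  · rw [ENNReal.ofReal_add hv0 hε.le]
    exact add_le_add (le_iInf₂ hv) le_rfl
  -- The optimum against a fixed policy of Player 2 is at most the equilibrium value, so the
  -- divergence is at most v* + ε, which `w` was designed for.
  · have hvv : v ≤ G.value.toReal := by
      rw [← ENNReal.ofReal_le_iff_le_toReal hval]
      exact le_iInf₂ fun π hπ => (hv π hπ).trans (le_iSup (G.kl π) _)
    have hlog := Real.log_pos one_lt_two
    have hw0 : 0 < w := by
      rw [hw]
      exact div_pos (by linarith [ENNReal.toReal_nonneg (a := G.value)]) hlam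
    refine one_sub_le_measureReal_reach_win havoid hkl (by linarith) hw0 hU ?_
    rw [hw, mul_div_cancel₀ _ hlam.ne']
    linarith

end ICGame

end

theorem proposition3 {S A₁ A₂ : Type*} [Fintype S] [Fintype A₁] [Fintype A₂]
    (G : ICGame S A₁ A₂)
    -- all available actions are permissible
    (hperm : ∀ s, ∀ a ∈ G.avail₁ s, G.average.dist s a ≠ 0)
    -- some winning policy has a finite worst-case KL objective
    (hfin : ∃ π₁ : G.Policy₁, G.IsWinning π₁ ∧
      ∃ c : NNReal, ∀ π₂ : G.Policy₂, G.kl π₁ π₂ ≤ c)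
    -- the true policy of Player 2
    (μ₂ : StationaryPolicy G.avail₂)
    (ε δ lam β : ℝ) (hε : 0 < ε) (hδ : 0 < δ) (hδ1 : δ ≤ 1) (hlam : 0 < lam) (hlam1 : lam ≤ 1)
    (hβ : β < 1) (L m n : ℕ) [NeZero m] (hL : 1 ≤ L) (hC : 0 < G.cMax)
    (hcontr : ∀ᵐ D ∂(G.sampleLaw (μ₂.toPolicy A₁ A₂) n), ∀ π₁ : G.Policy₁,
      G.IsOutput m D π₁ →
        G.HasContraction (G.unknown m D) π₁ (G.estimatePolicy m D) L
          (β - ε * (1 - β) ^ 2 / (G.cMax * L)))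
    (hm : 4 * G.cMax ^ 2 * (L : ℝ) ^ 4 *
        (2 * Real.log 2 * (max (Fintype.card A₁) (Fintype.card A₂) : ℕ)
          + Real.log (2 * Fintype.card S / δ)) / ((1 - β) ^ 4 * ε ^ 2) ≤ m)
    (w : ℝ) (hw : w = (G.value.toReal + Real.log 2 + ε) / lam)
    (hn : Real.exp (2 * w) * Real.log (4 / δ) / 2
        + 2 * Fintype.card S * Real.exp w * m ≤ n) :
    ENNReal.ofReal (1 - δ) ≤ G.sampleLaw (μ₂.toPolicy A₁ A₂) n
      {D | (∃ π₁ : G.Policy₁, G.IsOutput m D π₁) ∧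
        ∀ π₁ : G.Policy₁, G.IsOutput m D π₁ →
          G.kl π₁ (μ₂.toPolicy A₁ A₂) ≤
            (⨅ π : G.Policy₁, ⨅ _ : G.IsWinning π, G.kl π (μ₂.toPolicy A₁ A₂))
              + ENNReal.ofReal ε ∧
          1 - lam ≤ (G.runLaw π₁ (μ₂.toPolicy A₁ A₂) G.init).real (ICGame.reach G.win)} := by
  classical
  have hG : G.FullSupport := hperm
  have hinit : G.init ∈ G.winSet := by
    obtain ⟨π₁, hπ₁, -⟩ := hfin
    exact ⟨π₁, hπ₁⟩
  have hval : G.value ≠ ∞ := by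
    obtain ⟨π₁, hπ₁, c, hc⟩ := hfin
    exact ne_top_of_le_ne_top ENNReal.coe_ne_top ((iInf₂_le π₁ hπ₁).trans (iSup_le hc))
  have hSpos : (1 : ℝ) ≤ Fintype.card S := by
    exact_mod_cast Fintype.card_pos_iff.2 ⟨G.init⟩
  have hmpos : (0 : ℝ) < m := by exact_mod_cast Nat.pos_of_ne_zero (NeZero.ne m)
  have hL0 : (1 : ℝ) ≤ L := by exact_mod_cast hL
  have h1β : 0 < 1 - β := by linarith
  have hlog2 := Real.log_two_gt_d9
  set κ := ε * (1 - β) ^ 2 / (G.cMax * L) with hκ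
  have hκ0 : 0 < κ := by positivity
  have hκε : κ * (G.cMax * L) = ε * (1 - β) ^ 2 := by
    rw [hκ]
    field_simp
  have : IsProbabilityMeasure (G.sampleLaw (μ₂.toPolicy A₁ A₂) n) := by
    rw [ICGame.sampleLaw]
    infer_instance
  -- The contraction holds for at least one sample. As an avoidance probability is nonnegative, it
  -- forces 0 ≤ β - κ, and β < 1.
  have hκ1 : κ ≤ 1 := by
    obtain ⟨D, hD⟩ := hcontr.exists
    obtain ⟨μ, hμ⟩ := ICGame.exists_isSynthesized hG m D
    have := (G.avoidProb_nonneg _ _ _ _ _).trans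
      (ICGame.avoidProb_le_of_hasContraction hG hD hμ hinit)
    linarith
  set A : ℝ := ((max (Fintype.card A₁) (Fintype.card A₂) : ℕ) : ℝ) with hA
  have hA2 : (Fintype.card A₂ : ℝ) ≤ A := by
    rw [hA]
    exact_mod_cast le_max_right _ _
  have hA0 : 0 ≤ A := by positivity
  set ℓ := Real.log (2 * Fintype.card S / δ) with hℓ
  have hℓ0 : 0 ≤ ℓ := Real.log_nonneg (by rw [le_div_iff₀ hδ]; linarith)
  set X := 2 * Real.log 2 * A + ℓ with hX
  have hX0 : 0 ≤ X := by positivity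
  -- The bound on m in terms of `κ`: the factor C_max² L⁴ / ((1-β)⁴ ε²) is L²/κ².
  have hmX : 4 * (L : ℝ) ^ 2 * X ≤ m * κ ^ 2 := by
    have h1 : 4 * G.cMax ^ 2 * (L : ℝ) ^ 4 * X / ((1 - β) ^ 4 * ε ^ 2) =
        4 * (L : ℝ) ^ 2 * X / κ ^ 2 := by
      have : (1 - β) ^ 4 * ε ^ 2 = (κ * (G.cMax * L)) ^ 2 := by rw [hκε]; ring
      rw [this]
      field_simp
    rw [h1, div_le_iff₀ (by positivity)] at hm
    exact hm
  have hround : (Fintype.card A₂ : ℝ) / m ≤ κ / (4 * L) :=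
    card_div_le_of_sample_bound hκ0 hκ1 hL0 hA0 hA2 hℓ0 hmpos hmX
  set t := 3 * κ / (8 * L) with ht
  have htm : X ≤ 2 * m * t ^ 2 := le_of_sample_bound hL0 hX0 hmX
  set q₀ := Real.exp (-w) with hq₀
  have hq₀pos : 0 < q₀ := Real.exp_pos _
  have hew : Real.exp w * q₀ = 1 := by rw [hq₀, ← Real.exp_add]; simp
  have he2w : Real.exp (2 * w) = Real.exp w * Real.exp w := by rw [← Real.exp_add]; ring_nf
  set ℓ' := Real.log (4 / δ) with hℓ'
  have hℓ'0 : 0 ≤ ℓ' := Real.log_nonneg (by rw [le_div_iff₀ hδ]; linarith)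
  have hw0 : 0 ≤ w := by
    rw [hw]
    exact div_nonneg (by linarith [ENNReal.toReal_nonneg (a := G.value)]) hlam.le
  have hew1 : 1 ≤ Real.exp w := Real.one_le_exp hw0
  set Sm : ℝ := Fintype.card S * m with hSm
  have hSm0 : 0 < Sm := by positivity
  have hnq : Real.exp w * ℓ' / 2 + 2 * Sm ≤ n * q₀ := by
    have h1 := mul_le_mul_of_nonneg_right hn hq₀pos.le
    have h2 : (Real.exp (2 * w) * ℓ' / 2 + 2 * Fintype.card S * Real.exp w * m) * q₀ =
        (Real.exp w * q₀) * (Real.exp w * ℓ' / 2 + 2 * Sm) := by rw [he2w, hSm]; ring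
    rw [h2, hew, one_mul] at h1
    exact h1
  have hn0 : (0 : ℝ) < n := by
    have : 0 < n * q₀ := lt_of_lt_of_le (by positivity) hnq
    exact (mul_pos_iff_of_pos_right hq₀pos).1 this
  have hnS : Fintype.card S * m ≤ n := by
    have h1 : 0 ≤ Real.exp (2 * w) * ℓ' / 2 := by positivity
    have h2 : Sm * 1 ≤ Sm * Real.exp w := mul_le_mul_of_nonneg_left hew1 hSm0.le
    have h3 : 0 ≤ Sm * Real.exp w := by positivity
    have : (Fintype.card S : ℝ) * m ≤ n := by
      change Sm ≤ n
      have h4 : 2 * Fintype.card S * Real.exp w * m = 2 * (Sm * Real.exp w) := by rw [hSm]; ring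
      rw [h4] at hn
      linarith
    exact_mod_cast this
  obtain ⟨v, hv, hgood⟩ := ICGame.exists_stopKl_le_of_isSynthesized hG μ₂ hβ hκ0.le hL hC hκε
    hround hnS hcontr
  set P := G.sampleLaw (μ₂.toPolicy A₁ A₂) n with hP
  set bad₁ : S → Finset A₂ → Set (Fin n → ℕ → Step S A₁ A₂) := fun s B =>
    {D | ∃ v : Fin m → Fin n ×ₗ ℕ, ICGame.IsFirstVisits D s v ∧
      t < ∑ b ∈ B, ((ICGame.empirical (fun k => (D (ofLex (v k)).1 (ofLex (v k)).2).act₂)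
        b).toReal - (μ₂.dist s b).toReal)} with hbad₁
  set bad₂ : Set (Fin n → ℕ → Step S A₁ A₂) :=
    {D | q₀ < (G.runLaw G.averagePolicy (μ₂.toPolicy A₁ A₂) G.init).real
      (ICGame.reach {s | s ∈ G.potential ∧ ¬ (m : ℕ∞) ≤ (ICGame.visits D s).encard})} with hbad₂
  set good : Set (Fin n → ℕ → Step S A₁ A₂) := {D | (∃ π₁ : G.Policy₁, G.IsOutput m D π₁) ∧
        ∀ π₁ : G.Policy₁, G.IsOutput m D π₁ →
          G.kl π₁ (μ₂.toPolicy A₁ A₂) ≤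
            (⨅ π : G.Policy₁, ⨅ _ : G.IsWinning π, G.kl π (μ₂.toPolicy A₁ A₂))
              + ENNReal.ofReal ε ∧
          1 - lam ≤ (G.runLaw π₁ (μ₂.toPolicy A₁ A₂) G.init).real (ICGame.reach G.win)} with hgooddef
  -- Outside the bad events the estimate is accurate and the unknown states are hard for the average
  -- player to reach; then every output is good. Only inclusions up to null sets are used, so `good`
  -- need not be measurable.
  have hcover : ∀ᵐ D ∂P, D ∈ good ∪ ((⋃ s, ⋃ B, bad₁ s B) ∪ bad₂) := by
    filter_upwards [hgood] with D hD
    by_cases hb : D ∈ (⋃ s, ⋃ B, bad₁ s B) ∪ bad₂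
    · exact Or.inr hb
    refine Or.inl ?_
    have hb1 : ∀ s, ∀ v : Fin m → Fin n ×ₗ ℕ, ICGame.IsFirstVisits D s v →
        TvLe (ICGame.empirical fun k => (D (ofLex (v k)).1 (ofLex (v k)).2).act₂) (μ₂.dist s) t := by
      intro s v hv B
      by_contra hlt
      exact hb (Or.inl (Set.mem_iUnion₂.2 ⟨s, B, v, hv, not_le.1 hlt⟩))
    have hb2 : (G.runLaw G.averagePolicy (μ₂.toPolicy A₁ A₂) G.init).real
        (ICGame.reach (G.unknown m D)) ≤ q₀ := by
      have hUeq : G.unknown m D =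
          {s | s ∈ G.potential ∧ ¬ (m : ℕ∞) ≤ (ICGame.visits D s).encard} := by
        ext s
        exact ⟨fun h => ⟨h.1, fun h' => h.2 ⟨h.1, h'⟩⟩, fun h => ⟨h.1, fun h' => h.2 h'.2⟩⟩
      rw [hUeq]
      by_contra hlt
      exact hb (Or.inr (not_le.1 hlt))
    have hD' := hD fun s _ => hb1 s
    obtain ⟨μ, hμ⟩ := ICGame.exists_isSynthesized hG m D
    refine ⟨⟨_, μ, hμ, rfl⟩, ?_⟩
    rintro _ ⟨μ, hμ, rfl⟩
    exact ICGame.output_spec hG hinit hval μ₂ hε hlam hw (hv _ hinit).1 (hv _ hinit).2 hμ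
      (hD' μ hμ _ hinit) hb2
  have hbad₁le : P (⋃ s, ⋃ B, bad₁ s B) ≤ ENNReal.ofReal (δ / 2) := by
    have h1 : ∀ s B, P (bad₁ s B) ≤ ENNReal.ofReal (Real.exp (-X)) := fun s B =>
      (G.sampleLaw_empirical_gt_le μ₂ s B m n (by positivity)).trans
        (ENNReal.ofReal_le_ofReal (Real.exp_le_exp.2 (by linarith)))
    have h2 : P (⋃ s, ⋃ B, bad₁ s B) ≤ ∑ _s : S, ∑ _B : Finset A₂, ENNReal.ofReal (Real.exp (-X)) :=
      (measure_iUnion_fintype_le _ _).trans (Finset.sum_le_sum fun s _ =>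
        (measure_iUnion_fintype_le _ _).trans (Finset.sum_le_sum fun B _ => h1 s B))
    refine h2.trans ?_
    simp only [Finset.sum_const, Finset.card_univ, Fintype.card_finset, nsmul_eq_mul]
    rw [← ENNReal.ofReal_natCast, ← ENNReal.ofReal_natCast, ← ENNReal.ofReal_mul (by positivity),
      ← ENNReal.ofReal_mul (by positivity)]
    refine ENNReal.ofReal_le_ofReal ?_
    exact mul_exp_neg_le_of_log (by linarith) hδ hA2
  have hbad₂le : P bad₂ ≤ ENNReal.ofReal (δ / 2) := by
    have h0 : 0 ≤ Real.exp w * ℓ' / 2 := by positivity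
    refine (G.sampleLaw_lt_reach_le (μ₂.toPolicy A₁ A₂) G.potential (m := m) (n := n) (q₀ := q₀)
      (by change Sm ≤ n * q₀; linarith)).trans (ENNReal.ofReal_le_ofReal ?_)
    change Real.exp (-(2 * (n * q₀ - Sm) ^ 2 / n)) ≤ δ / 2
    have h1 : ℓ' ≤ 2 * (n * q₀ - Sm) ^ 2 / n := le_of_run_bound hn0 hq₀pos hew hnq
    calc Real.exp (-(2 * (n * q₀ - Sm) ^ 2 / n)) ≤ Real.exp (-ℓ') :=
          Real.exp_le_exp.2 (by linarith)
      _ = δ / 4 := by rw [Real.exp_neg, hℓ', Real.exp_log (by positivity), inv_div]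
      _ ≤ δ / 2 := by linarith
  have htotal : 1 ≤ P good + ENNReal.ofReal δ := by
    calc (1 : ℝ≥0∞) = P Set.univ := measure_univ.symm
      _ ≤ P (good ∪ ((⋃ s, ⋃ B, bad₁ s B) ∪ bad₂)) := measure_mono_ae (hcover.mono fun D hD _ => hD)
      _ ≤ P good + (P (⋃ s, ⋃ B, bad₁ s B) + P bad₂) :=
          (measure_union_le _ _).trans (add_le_add le_rfl (measure_union_le _ _))
      _ ≤ P good + (ENNReal.ofReal (δ / 2) + ENNReal.ofReal (δ / 2)) :=
          add_le_add le_rfl (add_le_add hbad₁le hbad₂le)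
      _ = P good + ENNReal.ofReal δ := by
          rw [← ENNReal.ofReal_add (by positivity) (by positivity), add_halves]
  rw [ENNReal.ofReal_sub _ hδ.le, ENNReal.ofReal_one]
  exact tsub_le_iff_right.2 htotal
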